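/- Let $N=\{1,\dots,n\}$ be a set of agents and $M$ a set of $m$ goods. A valuation $v_i:2^M\to\mathbb{R}_{\ge 0}$ is binary additive if $v_i(T)=\sum_{g\in T}v_i(\{g\})$ for all $T\subseteq M$ and $v_i(\{g\})\in\{0,1\}$ for all $g\in M$. An allocation $A=(A_1,\dots,A_n)$ consists of pairwise disjoint, possibly empty bundles $A_i\subseteq M$ (goods may remain unallocated); its utility vector is $(v_1(A_1),\dots,v_n(A_n))$. An allocation is a maximum Nash welfare (MNW) allocation if, among all allocations, it maximizes the number of agents with positive utility and, subject to that, the product of the positive utilities. It is minimally complete if the set of allocated goods is exactly the set of goods $g$ with $v_i(\{g\})>0$ for some agent $i$. A deterministic rule maps each profile $v=(v_1,\dots,v_n)$ of binary additive valuations to an allocation. The rule $\mathrm{MNW}^{\mathrm{tie}}$ returns, for each profile, a minimally complete MNW allocation whose utility vector is lexicographically greatest (in the order of the agents' indices) among the utility vectors of all MNW allocations; if there are several such allocations, it picks one of them arbitrarily. **Theorem.** Under binary additive valuations, the following hold. 1. For all $n,m$ and however the arbitrary choices are made, $\mathrm{MNW}^{\mathrm{tie}}$ is - envy-free up to one good: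 the returned allocation $A$ satisfies, for all agents $i,j$ with $A_j\ne\emptyset$, $v_i(A_i)\ge v_i(A_j\setminus\{g\})$ for some $g\in A_j$; - Pareto optimal: there is no allocation $A'$ with $v_i(A'_i)\ge v_i(A_i)$ for all agents $i$ and with strict inequality for some $i$; - group strategyproof: there are no profiles $v,v'$ of binary additive valuations and no nonempty set $C\subseteq N$ such that $v'_k=v_k$ for all $k\notin C$ and $v_j(A'_j)>v_j(A_j)$ for all $j\in C$, where $A$ and $A'$ are the allocations returned for $v$ and $v'$. 2. $\mathrm{MNW}^{\mathrm{tie}}$ is well defined and computable in polynomial time: there is a Turing machine that, given $n$, $m$ and the matrix $(v_i(\{g\}))_{i\in N,\,g\in M}$, outputs in time polynomial in $n$ and $m$ an allocation that $\mathrm{MNW}^{\mathrm{tie}}$ may return for $v$. -/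

import Mathlib

open scoped NNReal

/-- Valuation functions `2^M → ℝ≥0` on the set `M = Fin m` of goods. -/
abbrev GoodsValuation (m : ℕ) : Type := Finset (Fin m) → ℝ≥0

/-- Additive (hence `v ∅ = 0`), with every single good valued at `0` or `1`. -/
def IsBinaryAdditive {m : ℕ} (v : GoodsValuation m) : Prop :=
  (∀ T : Finset (Fin m), v T = ∑ g ∈ T, v {g}) ∧ ∀ g : Fin m, v {g} = 0 ∨ v {g} = 1

/-- Valuation profiles of the agents `Fin n` all of whose valuations are binary additive. -/
abbrev BinaryProfile (n m : ℕ) : Type :=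
  {v : Fin n → GoodsValuation m // ∀ i, IsBinaryAdditive (v i)}

/-- An allocation: pairwise disjoint (possibly empty) bundles, one for each agent.
Goods may remain unallocated. -/
structure Allocation (n m : ℕ) where
  bundle : Fin n → Finset (Fin m)
  disjoint : ∀ i j, i ≠ j → Disjoint (bundle i) (bundle j)

noncomputable section

namespace Allocation

variable {n m : ℕ} (v : Fin n → GoodsValuation m) (A : Allocation n m)

/-- The utility vector `(v₁(A₁), …, vₙ(Aₙ))`. -/
def utility : Fin n → ℝ≥0 := fun i => v i (A.bundle i)

/-- The set of all allocated goods. -/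
def allocated : Finset (Fin m) := Finset.univ.biUnion A.bundle

/-- Envy-freeness up to one good. -/
def IsEF1 : Prop :=
  ∀ i j : Fin n, A.bundle j ≠ ∅ →
    ∃ g ∈ A.bundle j, v i (A.bundle j \ {g}) ≤ v i (A.bundle i)

/-- Pareto optimality among all allocations. -/
def IsPO : Prop :=
  ¬ ∃ B : Allocation n m,
    (∀ i, A.utility v i ≤ B.utility v i) ∧ ∃ i, A.utility v i < B.utility v i

/-- The set of agents with positive utility. -/
def winners : Finset (Fin n) := Finset.univ.filter fun i => 0 < A.utility v i

/-- The number of agents with positive utility is maximum among all allocations. -/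
def MaximizesWinners : Prop :=
  ∀ B : Allocation n m, (B.winners v).card ≤ (A.winners v).card

/-- Maximum Nash welfare: `A` maximizes the number of agents with positive utility and,
subject to that, the product of the positive utilities. -/
def IsMNW : Prop :=
  A.MaximizesWinners v ∧
    ∀ B : Allocation n m, B.MaximizesWinners v →
      ∏ i ∈ B.winners v, B.utility v i ≤ ∏ i ∈ A.winners v, A.utility v i

/-- Exactly the valued goods (those to which some agent attaches nonzero value) are allocated. -/
def IsMinimallyComplete : Prop :=
  ∀ g : Fin m, g ∈ A.allocated ↔ ∃ i, v i {g} ≠ 0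

/-- The allocations that `MNW^tie` may return: MNW allocations whose utility vector is
lexicographically greatest (agents in increasing order of index) among all MNW allocations,
and which are minimally complete. -/
def IsMNWTie : Prop :=
  A.IsMNW v ∧
    (∀ B : Allocation n m, B.IsMNW v → toLex (B.utility v) ≤ toLex (A.utility v)) ∧
    A.IsMinimallyComplete v

end Allocation

/-- Deterministic rules on binary additive profiles of `n` agents over `m` goods. -/
abbrev Rule (n m : ℕ) : Type := BinaryProfile n m → Allocation n m

namespace Rule

variable {n m : ℕ} (f : Rule n m)

/-- `f` is a version of `MNW^tie`, that is, of the rule with some choice among the allocations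
that it may return. -/
def IsMNWTieRule : Prop := ∀ v, (f v).IsMNWTie v.1

def IsEF1 : Prop := ∀ v, (f v).IsEF1 v.1

def IsPO : Prop := ∀ v, (f v).IsPO v.1

/-- Group strategyproofness: no nonempty group `C` has a joint misreport, other agents' reports
being unchanged, from which every member of `C` strictly gains. -/
def IsGroupStrategyproof : Prop :=
  ¬ ∃ (v v' : BinaryProfile n m) (C : Finset (Fin n)), C.Nonempty ∧
    (∀ k, k ∉ C → v'.1 k = v.1 k) ∧
    ∀ j ∈ C, v.1 j ((f v).bundle j) < v.1 j ((f v').bundle j)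

end Rule

end

/-- An `n × m` matrix of bits as a word over the alphabet `{some false, some true, none}`:
`m` in unary, a separator `none`, then the rows, each followed by a separator `none`. -/
def encodeMatrix {n m : ℕ} (M : Fin n → Fin m → Bool) : List (Option Bool) :=
  List.replicate m (some true) ++ none ::
    (List.ofFn fun i => (List.ofFn fun g => some (M i g)) ++ [none]).flatten

noncomputable section

/-- Problem instances, with any number of agents and goods. -/
abbrev BinaryInstance : Type := Σ p : ℕ × ℕ, BinaryProfile p.1 p.2

/-- Outcomes, with any number of agents and goods. -/
abbrev Outcome : Type := Σ p : ℕ × ℕ, Allocation p.1 p.2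

/-- An instance is written as the matrix of the values `v i {g} ∈ {0, 1}`. -/
def encodeInstance (I : BinaryInstance) : List (Option Bool) :=
  encodeMatrix fun i g => decide (I.2.1 i {g} = 1)

/-- An allocation is written as the matrix of the indicators of `g ∈ A i`. -/
def encodeOutcome (A : Outcome) : List (Option Bool) :=
  encodeMatrix fun i g => decide (g ∈ A.2.bundle i)

/-- One Turing machine computes the rule for all numbers of agents and goods, in time bounded
by a polynomial in the length of the input. -/
def PolyTimeComputable (f : ∀ n m : ℕ, Rule n m) : Prop :=
  Nonempty (Turing.TM2ComputableInPolyTime encodeInstance encodeOutcome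
    fun I => (⟨I.1, f I.1.1 I.1.2 I.2⟩ : Outcome))

end

/-! Once worthless goods are discarded, an allocation is an owner map and its utility vector is the
vector of loads. The rule is governed by a local property, `Balanced`: owners value what they own,
and every agent k lies in a closed set R (all goods valued in R are owned in R) none of whose
members x could improve the load vector by ceding a unit to k. So x has at most as many goods as k,
or exactly one more and a smaller index.

A score-maximal allocation is balanced. A unit can be moved along any chain of agents each of which
owns a good valued by the next (`exists_transfer`); such a move raises the score unless `NoGain`
holds (`score_lt_of_transfer`), and the agents with a chain to k form R. Conversely, all balanced
maps of a profile have the same loads (`Balanced.load_eq`), so all of them are score-maximal.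

EF1 follows because an agent owning a good valued by i lies in the closed set of i. Pareto
optimality is a count of the valued goods. Group strategyproofness and the uniqueness of loads rest
on one exchange argument, `Balanced.exists_le_of_eq_off`. If every member of C gained, then some k
outside C would lose and would be joined to some j in C by a path of goods changing hands. The
certificate of j in the first map bounds the load of k, that of k in the second map bounds the load
of j; with the gain of j and the loss of k, both bounds must be ties, and these order j and k in
opposite ways.

For the algorithm, agents take turns in index order, round after round, and get one more good if a
chain leads from a free good to them. If none does, the agents not reached by the search form a
closed set, which certifies the agent and stays closed for ever (`Greedy.closedFor_of_load`). When
no valued good is free, the map is balanced. A finite control sweeping over the value matrix carries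
this out in polynomially many passes, and a stack machine simulates each pass in time linear in the
matrix. -/

namespace FairDivision

open Finset Relation

/-! ### Balanced owner maps: closed sets, the exchange argument, transfers along chains -/

section OwnerMaps

variable {ι γ : Type*} [Fintype γ] [LinearOrder ι]

/-- The number of goods that agent `k` owns under the owner map `o`. -/
def load (o : γ → Option ι) (k : ι) : ℕ := #{g | o g = some k}

/-- Every owner values the goods it owns. -/
def NonWasteful (W : ι → γ → Prop) (o : γ → Option ι) : Prop := ∀ g k, o g = some k → W k g

/-- Every good valued by a member of `R` is owned by a member of `R`. -/
def ClosedFor (W : ι → γ → Prop) (o : γ → Option ι) (R : Finset ι) : Prop :=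
  ∀ k ∈ R, ∀ g, W k g → ∃ x ∈ R, o g = some x

/-- Moving one unit from `x` to `k` does not improve the load vector `u`. -/
def NoGain (u : ι → ℕ) (x k : ι) : Prop := u x ≤ u k ∨ u x = u k + 1 ∧ x < k

/-- Non-wasteful owner maps without improving transfers, certified by closed sets. -/
structure Balanced (W : ι → γ → Prop) (o : γ → Option ι) : Prop where
  nonWasteful : NonWasteful W o
  closed : ∀ k, ∃ R : Finset ι, k ∈ R ∧ ClosedFor W o R ∧ ∀ x ∈ R, x ≠ k → NoGain (load o) x k

theorem sum_load (o : γ → Option ι) (R : Finset ι) :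
    ∑ k ∈ R, load o k = #{g | ∃ k ∈ R, o g = some k} := by
  classical
  have : ({g | ∃ k ∈ R, o g = some k} : Finset γ) = R.biUnion fun k => {g | o g = some k} := by
    ext g; simp
  rw [this, card_biUnion]
  · rfl
  · intro x _ y _ hxy
    rw [Function.onFun, disjoint_left]
    intro g hg hg'
    simp only [mem_filter, mem_univ, true_and] at hg hg'
    exact hxy (Option.some.inj (hg.symm.trans hg'))

open scoped Classical in
theorem sum_load_le {W : ι → γ → Prop} {o : γ → Option ι} (h : NonWasteful W o) (R : Finset ι) :
    ∑ k ∈ R, load o k ≤ #{g | ∃ k ∈ R, W k g} := by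
  rw [sum_load]
  apply card_le_card
  intro g
  simp only [mem_filter, mem_univ, true_and]
  rintro ⟨k, hk, hg⟩
  exact ⟨k, hk, h g k hg⟩

-- The goods owned in `R` are among those valued in `R`, so closedness is equality of two
-- cardinalities. In this form it depends on the owner map only through the total load of `R`.
open scoped Classical in
theorem closedFor_iff {W : ι → γ → Prop} {o : γ → Option ι} (h : NonWasteful W o) (R : Finset ι) :
    ClosedFor W o R ↔ ∑ k ∈ R, load o k = #{g | ∃ k ∈ R, W k g} := by
  have hsub : ({g | ∃ k ∈ R, o g = some k} : Finset γ) ⊆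
      ({g | ∃ k ∈ R, W k g} : Finset γ) := by
    intro g
    simp only [mem_filter, mem_univ, true_and]
    rintro ⟨k, hk, hg⟩
    exact ⟨k, hk, h g k hg⟩
  rw [sum_load]
  constructor
  · intro hc
    congr 1
    refine Subset.antisymm hsub ?_
    intro g
    simp only [mem_filter, mem_univ, true_and]
    rintro ⟨k, hk, hg⟩
    exact hc k hk g hg
  · intro hc k hk g hg
    have := eq_of_subset_of_card_le hsub hc.ge
    have hg' : g ∈ ({g | ∃ k ∈ R, W k g} : Finset γ) := by
      simpa using ⟨k, hk, hg⟩
    rw [← this] at hg'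
    simpa using hg'

theorem Balanced.exists_owner {W : ι → γ → Prop} {o : γ → Option ι} (h : Balanced W o) {k : ι}
    {g : γ} (hg : W k g) : ∃ x, o g = some x := by
  obtain ⟨R, hk, hR, -⟩ := h.closed k
  obtain ⟨x, -, hx⟩ := hR k hk g hg
  exact ⟨x, hx⟩

open scoped Classical in
/-- No group `C` can jointly misreport so that each of its members gains. -/
theorem Balanced.exists_le_of_eq_off [Fintype ι] {W W' : ι → γ → Prop} {o o' : γ → Option ι}
    (h : Balanced W o) (h' : Balanced W' o') (C : Finset ι) (hC : C.Nonempty)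
    (hoff : ∀ k ∉ C, W' k = W k) :
    ∃ j ∈ C, #{g | o' g = some j ∧ W j g} ≤ load o j := by
  by_contra! hgain
  -- An edge is a good that passes from a non-member of `C` to an agent that truly values it. `S`
  -- collects the agents from which edges lead into `C`, and `p` drops from `o'` the goods not truly
  -- valued by their owner.
  set E : ι → ι → Prop := fun s t => s ∉ C ∧ ∃ g, o g = some s ∧ o' g = some t ∧ W t g with hE
  set S : Finset ι := {x | ∃ j ∈ C, ReflTransGen E x j} with hS
  set p : γ → Option ι := fun g => (o' g).filter fun j => W j g with hp
  have hpo : ∀ g j, p g = some j ↔ o' g = some j ∧ W j g := by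
    intro g j
    simp [hp, Option.filter_eq_some_iff]
  have hload : ∀ j, load p j = #{g | o' g = some j ∧ W j g} := by
    intro j; simp only [load, hpo]
  -- A good counted on the left has an owner under `o`, since `o` leaves no valued good free. That
  -- owner is in `C` or has an edge into `S`, so it lies in `S`.
  have hle : ∑ k ∈ S, load p k ≤ ∑ k ∈ S, load o k := by
    rw [sum_load, sum_load]
    apply card_le_card
    intro g
    simp only [mem_filter, mem_univ, true_and]
    rintro ⟨t, ht, hg⟩
    rw [hpo] at hg
    obtain ⟨s, hs⟩ := h.exists_owner hg.2
    refine ⟨s, ?_, hs⟩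
    by_cases hsC : s ∈ C
    · simp only [hS, mem_filter, mem_univ, true_and]
      exact ⟨s, hsC, .refl⟩
    · simp only [hS, mem_filter, mem_univ, true_and] at ht ⊢
      obtain ⟨j, hj, hr⟩ := ht
      exact ⟨j, hj, .head ⟨hsC, g, hs, hg⟩ hr⟩
  have hCS : C ⊆ S := by
    intro j hj
    simp only [hS, mem_filter, mem_univ, true_and]
    exact ⟨j, hj, .refl⟩
  -- All members of `C` gain while the total over `S` does not grow, so somebody in `S` outside `C`
  -- loses.
  obtain ⟨k, hkS, hkC, hk⟩ : ∃ k ∈ S, k ∉ C ∧ load p k < load o k := by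
    by_contra! hcon
    obtain ⟨j, hj⟩ := hC
    refine absurd hle (not_le.2 (sum_lt_sum (fun x hx => ?_) ⟨j, hCS hj, ?_⟩))
    · by_cases hxC : x ∈ C
      · exact (hload x ▸ hgain x hxC).le
      · exact hcon x hx hxC
    · rw [hload]; exact hgain j hj
  simp only [hS, mem_filter, mem_univ, true_and] at hkS
  obtain ⟨j, hj, hr⟩ := hkS
  have hne : k ≠ j := fun h => hkC (h ▸ hj)
  obtain ⟨R, hjR, hR, hRj⟩ := h.closed j
  obtain ⟨R', hkR', hR', hRk⟩ := h'.closed k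
  -- Each good on the path is valued by its receiver, so closedness under `o` carries membership in
  -- `R` back to the giver.
  have hkR : k ∈ R := by
    refine ReflTransGen.head_induction_on hr hjR ?_
    rintro s t ⟨-, g, hs, ht, hw⟩ - htR
    obtain ⟨x, hx, hox⟩ := hR t htR g hw
    rw [hs] at hox
    exact (Option.some.inj hox) ▸ hx
  -- Givers are outside `C`, so they value the good under `W'` too, and closedness under `o'`
  -- carries membership in `R'` forward to the receiver.
  have hjR' : j ∈ R' := by
    refine ReflTransGen.trans_induction_on
      (motive := fun {a b} _ => a ∈ R' → b ∈ R') hr (fun _ => id) ?_ ?_ hkR'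
    · rintro s t ⟨hsC, g, hs, ht, -⟩ hsR
      have : W' s g := by rw [hoff s hsC]; exact h.nonWasteful g s hs
      obtain ⟨x, hx, hox⟩ := hR' s hsR g this
      rw [ht] at hox
      exact (Option.some.inj hox) ▸ hx
    · intro a b c _ _ h1 h2 h3
      exact h2 (h1 h3)
  have h1 := hRj k hkR hne
  have h2 := hRk j hjR' hne.symm
  have h3 : load o j + 1 ≤ load o' j := by
    refine (hgain j hj).trans_le ?_
    apply card_le_card
    intro g
    simp only [mem_filter, mem_univ, true_and]
    exact fun h => h.1
  have h4 : load o' k = load p k := by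
    simp only [load]
    congr 1
    ext g
    simp only [mem_filter, mem_univ, true_and, hpo, iff_self_and]
    intro hg
    rw [← hoff k hkC]
    exact h'.nonWasteful g k hg
  -- By `h3`, `h4` and `hk` the two loads move by at least one each, in opposite directions. This is
  -- compatible with the bounds only if both are ties, and then `k < j` and `j < k`.
  rcases h1 with h1 | ⟨h1, h1'⟩ <;> rcases h2 with h2 | ⟨h2, h2'⟩
  · omega
  · omega
  · omega
  · exact absurd h1' h2'.asymm

/-- Two balanced maps for the same values are the case of a one-agent group that does not change its
report; applied in both directions, it bounds each load by the other. -/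
theorem Balanced.load_eq [Fintype ι] {W : ι → γ → Prop} {o o' : γ → Option ι}
    (h : Balanced W o) (h' : Balanced W o') : load o = load o' := by
  classical
  have key : ∀ {o o' : γ → Option ι}, Balanced W o → Balanced W o' → ∀ j, load o' j ≤ load o j := by
    intro o o' h h' j
    obtain ⟨i, hi, hle⟩ := h.exists_le_of_eq_off h' {j} (singleton_nonempty j) (fun _ _ => rfl)
    rw [mem_singleton] at hi
    subst hi
    refine le_trans (le_of_eq ?_) hle
    simp only [load]
    congr 1
    ext g
    simp only [mem_filter, mem_univ, true_and, iff_self_and]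
    exact h'.nonWasteful g i
  exact funext fun j => le_antisymm (key h' h j) (key h h' j)

/-- A related pair is joined by a chain without repetitions. -/
theorem exists_nodup_chain {α : Type*} {r : α → α → Prop} {a b : α} (h : ReflTransGen r a b) :
    ∃ l : List α, (a :: l).IsChain r ∧ (a :: l).Nodup ∧ (a :: l).getLast? = some b := by
  classical
  induction h using ReflTransGen.head_induction_on with
  | refl => exact ⟨[], by simp, by simp, by simp⟩
  | @head a c hac _ ih =>
    obtain ⟨l, hl, hn, hb⟩ := ih
    by_cases ha : a ∈ c :: l
    -- The chain already passes through `a`; its part from there on is kept.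
    · obtain ⟨p, q, hpq⟩ := List.append_of_mem ha
      refine ⟨q, ?_, ?_, ?_⟩
      · rw [hpq] at hl
        exact (List.isChain_append.1 hl).2.1
      · rw [hpq] at hn
        exact (List.nodup_append.1 hn).2.1
      · rw [hpq, List.getLast?_append] at hb
        simpa using hb
    · refine ⟨c :: l, ?_, ?_, ?_⟩
      · exact List.isChain_cons_cons.2 ⟨hac, hl⟩
      · exact List.nodup_cons.2 ⟨ha, hn⟩
      · simpa using hb

/-- The additive form avoids truncated subtraction and lets successive moves be summed by `omega`.
-/
theorem load_update_of_owner [DecidableEq γ] {o : γ → Option ι} {g : γ} {x y : ι}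
    (hg : o g = some x) (hxy : x ≠ y) (z : ι) :
    load (Function.update o g (some y)) z + (if z = x then 1 else 0)
      = load o z + if z = y then 1 else 0 := by
  classical
  have hpt : ∀ z, load (Function.update o g (some y)) z =
      #(({h | o h = some z} : Finset γ).erase g) + if z = y then 1 else 0 := by
    intro z
    have : ({h | Function.update o g (some y) h = some z} : Finset γ) =
        if z = y then insert g (({h | o h = some z} : Finset γ).erase g)
        else ({h | o h = some z} : Finset γ).erase g := by
      ext h
      by_cases hh : h = g
      · subst hh
        split_ifs with hz <;> simp [hz, eq_comm]
        exact fun h => hz h.symm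
      · split_ifs with hz <;> simp [hh, Function.update_of_ne]
    rw [load, this]
    split_ifs with hz
    · rw [card_insert_of_notMem (notMem_erase _ _)]
    · simp
  rw [hpt]
  by_cases hz : z = x
  · subst hz
    have : g ∈ ({h | o h = some z} : Finset γ) := by simpa using hg
    have hc := card_erase_add_one this
    simp only [load, if_true, if_neg hxy]
    omega
  · have : g ∉ ({h | o h = some z} : Finset γ) := by
      simp [hg]; exact fun h => hz h.symm
    rw [erase_eq_of_notMem this]
    simp [hz, load]

theorem load_update_of_free [DecidableEq γ] {o : γ → Option ι} {g : γ} {y : ι}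
    (hg : o g = none) (z : ι) :
    load (Function.update o g (some y)) z = load o z + if z = y then 1 else 0 := by
  classical
  have : ({h | Function.update o g (some y) h = some z} : Finset γ) =
      if z = y then insert g ({h | o h = some z} : Finset γ)
      else ({h | o h = some z} : Finset γ) := by
    ext h
    by_cases hh : h = g
    · subst hh
      split_ifs with hz <;> simp [hz, hg, eq_comm]
      exact fun h => hz h.symm
    · split_ifs with hz <;> simp [hh, Function.update_of_ne]
  rw [load, this]
  split_ifs with hz
  · rw [card_insert_of_notMem (by simp [hg])]; rfl
  · rfl

/-- One unit can be moved along a chain of agents each of which owns a good valued by the next. -/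
theorem exists_transfer {W : ι → γ → Prop} {o : γ → Option ι} (ho : NonWasteful W o) (l : List ι) :
    ∀ a b, (a :: l).IsChain (fun x y => ∃ g, o g = some x ∧ W y g) → (a :: l).Nodup →
      (a :: l).getLast? = some b → ∃ o' : γ → Option ι, NonWasteful W o' ∧
        (∀ z, load o' z + (if z = a then 1 else 0) = load o z + if z = b then 1 else 0) ∧
        ∀ x ∉ a :: l, ∀ g, o g = some x → o' g = some x := by
  classical
  induction l with
  | nil =>
    intro a b _ _ hb
    simp at hb
    subst hb
    exact ⟨o, ho, fun _ => rfl, fun _ _ _ h => h⟩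
  | cons c l ih =>
    intro a b hl hn hb
    obtain ⟨⟨g, hg, hW⟩, hl⟩ := List.isChain_cons_cons.1 hl
    obtain ⟨ha, hn⟩ := List.nodup_cons.1 hn
    obtain ⟨o', ho', hload, hkeep⟩ := ih c b hl hn (by simpa using hb)
    -- The tail of the chain is served first. Since `a` does not occur in it, `a` still owns `g` and
    -- can hand it to `c`.
    have hg' := hkeep a ha g hg
    have hac : a ≠ c := fun h => ha (h ▸ List.mem_cons_self)
    refine ⟨Function.update o' g (some c), ?_, ?_, ?_⟩
    · intro h k
      by_cases hh : h = g
      · subst hh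
        simp only [Function.update_self, Option.some.injEq]
        rintro rfl
        exact hW
      · rw [Function.update_of_ne hh]; exact ho' h k
    · intro z
      have h1 := load_update_of_owner hg' hac z
      have h2 := hload z
      omega
    · intro x hx h hh
      have hxa : x ≠ a := fun e => hx (e ▸ List.mem_cons_self)
      have : h ≠ g := by
        rintro rfl
        rw [hg] at hh
        exact hxa (Option.some.inj hh).symm
      rw [Function.update_of_ne this]
      exact hkeep x (fun e => hx (List.mem_cons_of_mem _ e)) h hh

/-- A complete non-wasteful owner map whose load vector cannot be improved by moving one unit is
balanced. -/
theorem balanced_of_noGain [Fintype ι] {W : ι → γ → Prop} {o : γ → Option ι} (ho : NonWasteful W o)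
    (hcomplete : ∀ k g, W k g → ∃ x, o g = some x)
    (hno : ∀ o' : γ → Option ι, NonWasteful W o' → ∀ a b, a ≠ b →
      (∀ z, load o' z + (if z = a then 1 else 0) = load o z + if z = b then 1 else 0) →
      NoGain (load o) a b) : Balanced W o := by
  classical
  refine ⟨ho, fun k => ?_⟩
  set E : ι → ι → Prop := fun x y => ∃ g, o g = some x ∧ W y g with hE
  -- The closed set consists of all agents with a chain to `k`: the owner of a good valued by such
  -- an agent extends its chain by one link.
  refine ⟨univ.filter fun x => ReflTransGen E x k, by simp [ReflTransGen.refl], ?_, ?_⟩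
  · intro y hy g hg
    obtain ⟨x, hx⟩ := hcomplete y g hg
    refine ⟨x, ?_, hx⟩
    simp only [mem_filter, mem_univ, true_and] at hy ⊢
    exact .head ⟨g, hx, hg⟩ hy
  · intro x hx hne
    simp only [mem_filter, mem_univ, true_and] at hx
    obtain ⟨l, h1, h2, h3⟩ := exists_nodup_chain hx
    obtain ⟨o', ho', hload, -⟩ := exists_transfer ho l x k h1 h2 h3
    exact hno o' ho' x k hne hload

end OwnerMaps

end FairDivision

namespace FairDivision

open Finset

/-! ### The order on utility vectors that `MNW^tie` maximizes -/

section Score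

variable {ι : Type*} [Fintype ι] [LinearOrder ι]

/-- The number of positive entries, then the product of the positive entries, then the vector
itself, to be compared lexicographically. -/
def score (u : ι → ℕ) : ℕ ×ₗ ℕ ×ₗ Lex (ι → ℕ) :=
  toLex (∑ i, if 0 < u i then 1 else 0, toLex (∏ i, max (u i) 1, toLex u))

theorem score_lt_score {u u' : ι → ℕ} :
    score u < score u' ↔
      (∑ i, if 0 < u i then 1 else 0) < (∑ i, if 0 < u' i then 1 else 0) ∨
      (∑ i, if 0 < u i then 1 else 0) = (∑ i, if 0 < u' i then 1 else 0) ∧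
        (∏ i, max (u i) 1 < ∏ i, max (u' i) 1 ∨
          ∏ i, max (u i) 1 = ∏ i, max (u' i) 1 ∧ toLex u < toLex u') := by
  simp only [score, Prod.Lex.toLex_lt_toLex]

theorem score_lt_of_add_one {u u' : ι → ℕ} {k : ι} (h : ∀ z, u' z = u z + if z = k then 1 else 0) :
    score u < score u' := by
  classical
  rw [score_lt_score]
  have hk : u' k = u k + 1 := by simp [h k]
  have hz : ∀ z ∈ univ.erase k, u' z = u z := by
    intro z hz
    rw [mem_erase] at hz
    simp [h z, hz.1]
  rw [← add_sum_erase _ _ (mem_univ k), ← add_sum_erase _ _ (mem_univ k),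
    ← mul_prod_erase _ _ (mem_univ k), ← mul_prod_erase _ (fun i => max (u' i) 1) (mem_univ k)]
  have h1 : ∑ i ∈ univ.erase k, (if 0 < u' i then 1 else 0) =
      ∑ i ∈ univ.erase k, (if 0 < u i then 1 else 0) :=
    sum_congr rfl fun z h => by rw [hz z h]
  have h2 : ∏ i ∈ univ.erase k, max (u' i) 1 = ∏ i ∈ univ.erase k, max (u i) 1 :=
    prod_congr rfl fun z h => by rw [hz z h]
  rw [h1, h2, hk]
  have hpos : 0 < ∏ i ∈ univ.erase k, max (u i) 1 := prod_pos fun _ _ => by simp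
  rcases Nat.eq_zero_or_pos (u k) with h0 | h0
  · left; simp [h0]
  · right
    refine ⟨by simp [h0], Or.inl ?_⟩
    apply Nat.mul_lt_mul_of_pos_right _ hpos
    omega

/-- If `u a ≥ u b + 2`, then the number of positive entries grows when `u b = 0`, and otherwise the
product does, as (u a - 1)(u b + 1) > u a · u b. If `u a = u b + 1` and `b < a`, the two entries
trade places: count and product stay, and the larger entry moves to the smaller index. -/
theorem score_lt_of_transfer {u u' : ι → ℕ} {a b : ι} (hab : a ≠ b)
    (h : ∀ z, u' z + (if z = a then 1 else 0) = u z + if z = b then 1 else 0)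
    (hg : ¬ NoGain u a b) : score u < score u' := by
  classical
  rw [score_lt_score]
  have hlt : u b + 2 ≤ u a ∨ u a = u b + 1 ∧ b < a := by
    simp only [NoGain, not_or, not_and, not_lt, not_le] at hg
    rcases Nat.lt_or_ge (u a) (u b + 2) with h' | h'
    · have he : u a = u b + 1 := by omega
      exact Or.inr ⟨he, lt_of_le_of_ne (hg.2 he) hab.symm⟩
    · exact Or.inl h'
  have ha : u' a + 1 = u a := by simpa [hab] using h a
  have hb : u' b = u b + 1 := by simpa [hab.symm] using h b
  have hz : ∀ z ∈ (univ.erase a).erase b, u' z = u z := by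
    intro z hz
    simp only [mem_erase, mem_univ, and_true] at hz
    simpa [hz] using h z
  have hmem : b ∈ univ.erase a := by simp [hab.symm]
  have hsum : ∀ f : ι → ℕ, ∑ i, f i = f a + (f b + ∑ i ∈ (univ.erase a).erase b, f i) := fun f => by
    rw [add_sum_erase _ _ hmem, add_sum_erase _ _ (mem_univ a)]
  have hprod : ∀ f : ι → ℕ, ∏ i, f i = f a * f b * ∏ i ∈ (univ.erase a).erase b, f i := fun f => by
    rw [mul_assoc, mul_prod_erase _ _ hmem, mul_prod_erase _ _ (mem_univ a)]
  rw [hsum, hsum, hprod, hprod]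
  have h1 : ∑ i ∈ (univ.erase a).erase b, (if 0 < u' i then 1 else 0) =
      ∑ i ∈ (univ.erase a).erase b, (if 0 < u i then 1 else 0) :=
    sum_congr rfl fun z h => by rw [hz z h]
  have h2 : ∏ i ∈ (univ.erase a).erase b, max (u' i) 1 =
      ∏ i ∈ (univ.erase a).erase b, max (u i) 1 :=
    prod_congr rfl fun z h => by rw [hz z h]
  rw [h1, h2, hb]
  have hpos : 0 < ∏ i ∈ (univ.erase a).erase b, max (u i) 1 := prod_pos fun _ _ => by simp
  generalize ∏ i ∈ (univ.erase a).erase b, max (u i) 1 = p at hpos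
  generalize ∑ i ∈ (univ.erase a).erase b, (if 0 < u i then 1 else 0) = s
  have hlex : b < a → toLex u < toLex u' := by
    intro hba
    refine ⟨b, fun j hj => ?_, ?_⟩
    · have h1 : j ≠ a := (hj.trans hba).ne
      have := h j
      simp only [h1, hj.ne, if_false, add_zero] at this
      exact this.symm
    · change u b < u' b
      omega
  have hua : 0 < u a := by omega
  rcases Nat.eq_zero_or_pos (u b) with h0 | h0
  · rcases hlt with hlt | ⟨hlt, hba⟩
    · left
      have : 0 < u' a := by omega
      simp [h0, this, hua]
    · right
      have h3 : u a = 1 := by omega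
      have h4 : u' a = 0 := by omega
      exact ⟨by simp [h0, h3, h4], Or.inr ⟨by simp [h0, h3, h4], hlex hba⟩⟩
  · right
    have h3 : 0 < u' a := by omega
    refine ⟨by simp [h0, hua, h3], ?_⟩
    have e1 : max (u a) 1 = u' a + 1 := by omega
    have e2 : max (u b) 1 = u b := by omega
    have e3 : max (u' a) 1 = u' a := by omega
    have e4 : max (u b + 1) 1 = u b + 1 := by omega
    rw [e1, e2, e3, e4]
    rcases hlt with hlt | ⟨hlt, hba⟩
    · left
      apply Nat.mul_lt_mul_of_pos_right _ hpos
      have : u b < u' a := by omega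
      nlinarith
    · right
      have : u b = u' a := by omega
      exact ⟨by rw [this, mul_comm (u' a + 1)], hlex hba⟩

end Score

/-! ### Allocations and owner maps -/

section Allocations

variable {n m : ℕ}

/-- Agent `k` values good `g`. -/
def Wants (v : Fin n → GoodsValuation m) (k : Fin n) (g : Fin m) : Prop := v k {g} = 1

open scoped Classical in
theorem value_eq_card {v : Fin n → GoodsValuation m} {k : Fin n} (hv : IsBinaryAdditive (v k))
    (T : Finset (Fin m)) : v k T = (#{g ∈ T | Wants v k g} : ℝ≥0) := by
  rw [hv.1 T, card_filter, Nat.cast_sum]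
  refine sum_congr rfl fun g _ => ?_
  rcases hv.2 g with h | h <;> simp [Wants, h]

theorem wants_iff {v : Fin n → GoodsValuation m} {k : Fin n} (hv : IsBinaryAdditive (v k))
    (g : Fin m) : Wants v k g ↔ v k {g} ≠ 0 := by
  rcases hv.2 g with h | h <;> simp [Wants, h]

/-- The allocation given by an owner map. -/
def ofOwner (o : Fin m → Option (Fin n)) : Allocation n m where
  bundle k := {g | o g = some k}
  disjoint i j hij := by
    rw [disjoint_left]
    intro g hi hj
    simp only [mem_filter, mem_univ, true_and] at hi hj
    exact hij (Option.some.inj (hi.symm.trans hj))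

open scoped Classical in
/-- The owner map of an allocation. -/
noncomputable def ownerOf (A : Allocation n m) (g : Fin m) : Option (Fin n) :=
  if h : ∃ k, g ∈ A.bundle k then some h.choose else none

theorem ownerOf_eq_some (A : Allocation n m) (g : Fin m) (k : Fin n) :
    ownerOf A g = some k ↔ g ∈ A.bundle k := by
  classical
  unfold ownerOf
  split_ifs with h
  · simp only [Option.some.injEq]
    constructor
    · rintro rfl
      exact h.choose_spec
    · intro hk
      by_contra hne
      exact disjoint_left.1 (A.disjoint _ _ hne) h.choose_spec hk
  · simp only [false_iff]
    exact fun hk => h ⟨k, hk⟩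

open scoped Classical in
/-- The utility vector with values in the natural numbers. -/
noncomputable def util (v : Fin n → GoodsValuation m) (A : Allocation n m) (k : Fin n) : ℕ :=
  #{g ∈ A.bundle k | Wants v k g}

theorem utility_eq {v : Fin n → GoodsValuation m} (hv : ∀ i, IsBinaryAdditive (v i))
    (A : Allocation n m) : A.utility v = fun i => (util v A i : ℝ≥0) :=
  funext fun i => value_eq_card (hv i) _

theorem util_ofOwner {v : Fin n → GoodsValuation m} {o : Fin m → Option (Fin n)}
    (ho : NonWasteful (Wants v) o) : util v (ofOwner o) = load o := by
  classical
  funext k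
  simp only [util, load, ofOwner]
  congr 1
  ext g
  simp only [mem_filter, mem_univ, true_and, and_iff_left_iff_imp]
  exact ho g k

open scoped Classical in
/-- The owner map of an allocation after every agent has discarded the goods it does not value. -/
noncomputable def trimmedOwner (v : Fin n → GoodsValuation m) (A : Allocation n m) (g : Fin m) :
    Option (Fin n) :=
  (ownerOf A g).filter fun k => Wants v k g

theorem trimmedOwner_eq_some (v : Fin n → GoodsValuation m) (A : Allocation n m) (g : Fin m)
    (k : Fin n) : trimmedOwner v A g = some k ↔ g ∈ A.bundle k ∧ Wants v k g := by
  simp [trimmedOwner, Option.filter_eq_some_iff, ownerOf_eq_some]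

theorem nonWasteful_trimmedOwner (v : Fin n → GoodsValuation m) (A : Allocation n m) :
    NonWasteful (Wants v) (trimmedOwner v A) :=
  fun g k h => ((trimmedOwner_eq_some v A g k).1 h).2

theorem load_trimmedOwner (v : Fin n → GoodsValuation m) (A : Allocation n m) :
    load (trimmedOwner v A) = util v A := by
  classical
  funext k
  simp only [util, load, trimmedOwner_eq_some]
  congr 1
  ext g
  simp

theorem card_winners {v : Fin n → GoodsValuation m} (hv : ∀ i, IsBinaryAdditive (v i))
    (A : Allocation n m) :
    (A.winners v).card = ∑ i, if 0 < util v A i then 1 else 0 := by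
  rw [Allocation.winners, card_filter, utility_eq hv]
  simp

theorem prod_winners {v : Fin n → GoodsValuation m} (hv : ∀ i, IsBinaryAdditive (v i))
    (A : Allocation n m) :
    ∏ i ∈ A.winners v, A.utility v i = ((∏ i, max (util v A i) 1 : ℕ) : ℝ≥0) := by
  rw [Allocation.winners, prod_filter, utility_eq hv, Nat.cast_prod]
  refine prod_congr rfl fun i _ => ?_
  rcases Nat.eq_zero_or_pos (util v A i) with h | h
  · simp [h]
  · have : max (util v A i) 1 = util v A i := by omega
    simp [h, this]

theorem toLex_cast_le {u u' : Fin n → ℕ} :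
    toLex (fun i => (u i : ℝ≥0)) ≤ toLex (fun i => (u' i : ℝ≥0)) ↔ toLex u ≤ toLex u' := by
  rw [← not_lt, ← not_lt, not_iff_not]
  change (∃ i, (∀ j, j < i → (u' j : ℝ≥0) = u j) ∧ (u' i : ℝ≥0) < u i) ↔
    ∃ i, (∀ j, j < i → u' j = u j) ∧ u' i < u i
  simp only [Nat.cast_inj, Nat.cast_lt]

/-- Each criterion is applied only among allocations that are optimal for the earlier ones, and this
is maximization in the lexicographic order of scores. -/
theorem isMNW_and_lex_iff {v : Fin n → GoodsValuation m} (hv : ∀ i, IsBinaryAdditive (v i))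
    (A : Allocation n m) :
    (A.IsMNW v ∧ ∀ B : Allocation n m, B.IsMNW v → toLex (B.utility v) ≤ toLex (A.utility v)) ↔
      ∀ B : Allocation n m, score (util v B) ≤ score (util v A) := by
  have hw := card_winners hv
  have hp := prod_winners hv
  constructor
  · rintro ⟨⟨h1, h2⟩, h3⟩ B
    rw [← not_lt, score_lt_score, ← hw, ← hw]
    rintro (h | ⟨h, h' | ⟨h', h''⟩⟩)
    · exact absurd h (not_lt.2 (h1 B))
    · have := h2 B fun D => (h1 D).trans h.le
      rw [hp, hp, Nat.cast_le] at this
      omega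
    · have hB : B.MaximizesWinners v := fun D => (h1 D).trans h.le
      have := h3 B ⟨hB, fun D hD => (h2 D hD).trans (by rw [hp, hp, h'])⟩
      rw [utility_eq hv, utility_eq hv, toLex_cast_le] at this
      exact absurd h'' (not_lt.2 this)
  · intro h
    have h' : ∀ B : Allocation n m, _ := fun B => (not_lt.2 (h B)) ∘ score_lt_score.2
    simp only [imp_false, not_or, not_and, ← hw, not_lt] at h'
    have h1 : A.MaximizesWinners v := fun B => (h' B).1
    refine ⟨⟨h1, fun B hB => ?_⟩, fun B hB => ?_⟩
    · rw [hp, hp, Nat.cast_le]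
      exact ((h' B).2 ((hB A).antisymm (h1 B))).1
    · rw [utility_eq hv, utility_eq hv, toLex_cast_le]
      refine not_lt.1 (((h' B).2 ((hB.1 A).antisymm (h1 B))).2 ?_)
      have := hB.2 A h1
      rw [hp, hp, Nat.cast_le] at this
      exact this.antisymm ((h' B).2 ((hB.1 A).antisymm (h1 B))).1

/-- Giving an unowned good to an agent that values it, or carrying out an improving transfer, would
raise the score. -/
theorem balanced_trimmedOwner {v : Fin n → GoodsValuation m} {A : Allocation n m}
    (h : ∀ B : Allocation n m, score (util v B) ≤ score (util v A)) :
    Balanced (Wants v) (trimmedOwner v A) := by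
  classical
  have hmax : ∀ o', NonWasteful (Wants v) o' →
      score (load o') ≤ score (load (trimmedOwner v A)) := by
    intro o' ho'
    rw [← util_ofOwner ho', load_trimmedOwner]
    exact h _
  refine balanced_of_noGain (nonWasteful_trimmedOwner v A) ?_ ?_
  · intro k g hg
    by_contra hcon
    have hnone : trimmedOwner v A g = none := by
      rw [Option.eq_none_iff_forall_ne_some]
      exact fun x hx => hcon ⟨x, hx⟩
    refine absurd (hmax (Function.update (trimmedOwner v A) g (some k)) ?_)
      (not_le.2 (score_lt_of_add_one (load_update_of_free hnone)))
    intro g' k'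
    by_cases hg' : g' = g
    · subst hg'
      simp only [Function.update_self, Option.some.injEq]
      rintro rfl
      exact hg
    · rw [Function.update_of_ne hg']
      exact nonWasteful_trimmedOwner v A g' k'
  · intro o' ho' a b hab hload
    by_contra hcon
    exact absurd (hmax o' ho') (not_le.2 (score_lt_of_transfer hab hload hcon))

theorem isMNWTie_iff {v : Fin n → GoodsValuation m} (hv : ∀ i, IsBinaryAdditive (v i))
    (A : Allocation n m) : A.IsMNWTie v ↔
      (∀ B : Allocation n m, score (util v B) ≤ score (util v A)) ∧ A.IsMinimallyComplete v := by
  rw [Allocation.IsMNWTie, ← and_assoc, isMNW_and_lex_iff hv]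

theorem isMinimallyComplete_iff (v : Fin n → GoodsValuation m) (A : Allocation n m) :
    A.IsMinimallyComplete v ↔ ∀ g, (∃ k, g ∈ A.bundle k) ↔ ∃ i, v i {g} ≠ 0 := by
  simp [Allocation.IsMinimallyComplete, Allocation.allocated]

/-- Minimal completeness admits only goods that somebody values. Each of these has an owner even
after trimming, necessarily the one it had before, so trimming removes nothing. -/
theorem trimmedOwner_eq_ownerOf {v : Fin n → GoodsValuation m} (hv : ∀ i, IsBinaryAdditive (v i))
    {A : Allocation n m} (h : A.IsMNWTie v) : trimmedOwner v A = ownerOf A := by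
  obtain ⟨h1, h2⟩ := (isMNWTie_iff hv A).1 h
  rw [isMinimallyComplete_iff] at h2
  funext g
  refine Option.ext fun k => ?_
  rw [trimmedOwner_eq_some, ownerOf_eq_some, and_iff_left_iff_imp]
  intro hk
  obtain ⟨i, hi⟩ := (h2 g).1 ⟨k, hk⟩
  obtain ⟨x, hx⟩ := (balanced_trimmedOwner h1).exists_owner ((wants_iff (hv i) g).2 hi)
  rw [trimmedOwner_eq_some] at hx
  by_cases hxk : x = k
  · exact hxk ▸ hx.2
  · exact absurd hk (disjoint_left.1 (A.disjoint _ _ hxk) hx.1)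

theorem balanced_ownerOf {v : Fin n → GoodsValuation m} (hv : ∀ i, IsBinaryAdditive (v i))
    {A : Allocation n m} (h : A.IsMNWTie v) : Balanced (Wants v) (ownerOf A) := by
  rw [← trimmedOwner_eq_ownerOf hv h]
  exact balanced_trimmedOwner ((isMNWTie_iff hv A).1 h).1

theorem load_ownerOf (A : Allocation n m) (k : Fin n) : load (ownerOf A) k = #(A.bundle k) := by
  simp [load, ownerOf_eq_some]

theorem util_eq_load {v : Fin n → GoodsValuation m} (hv : ∀ i, IsBinaryAdditive (v i))
    {A : Allocation n m} (h : A.IsMNWTie v) : util v A = load (ownerOf A) := by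
  rw [← trimmedOwner_eq_ownerOf hv h, load_trimmedOwner]

/-- If `i` values a good of `j`, then `j` lies in the closed set certifying `i` and owns at most one
good more than `i` does; removing any good from its bundle suffices. If `i` values none, the bundle
is worthless to it. -/
theorem isEF1_of_isMNWTie {v : Fin n → GoodsValuation m} (hv : ∀ i, IsBinaryAdditive (v i))
    {A : Allocation n m} (h : A.IsMNWTie v) : A.IsEF1 v := by
  classical
  have hb := balanced_ownerOf hv h
  intro i j hj
  by_cases hw : ∃ g ∈ A.bundle j, Wants v i g
  · obtain ⟨g, hg, hwg⟩ := hw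
    refine ⟨g, hg, ?_⟩
    obtain ⟨R, hi, hR, hRi⟩ := hb.closed i
    obtain ⟨x, hx, hox⟩ := hR i hi g hwg
    obtain rfl : j = x := Option.some.inj (((ownerOf_eq_some A g j).2 hg).symm.trans hox)
    have hle : #(A.bundle j) ≤ util v A i + 1 := by
      rw [util_eq_load hv h, ← load_ownerOf]
      by_cases hji : j = i
      · subst hji; omega
      · rcases hRi j hx hji with h' | h' <;> omega
    rw [value_eq_card (hv i), value_eq_card (hv i), Nat.cast_le]
    refine (card_filter_le _ _).trans ?_
    rw [sdiff_singleton_eq_erase, card_erase_of_mem hg]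
    change _ ≤ util v A i
    omega
  · obtain ⟨g, hg⟩ := nonempty_iff_ne_empty.2 hj
    refine ⟨g, hg, ?_⟩
    have : #{g' ∈ A.bundle j \ {g} | Wants v i g'} = 0 := by
      rw [card_eq_zero, filter_eq_empty_iff]
      intro g' hg' hwg'
      exact hw ⟨g', (mem_sdiff.1 hg').1, hwg'⟩
    rw [value_eq_card (hv i), this]
    simp

/-- The utilities add up to the number of goods valued by anybody, which no allocation exceeds,
whereas a Pareto improvement would increase the sum. -/
theorem isPO_of_isMNWTie {v : Fin n → GoodsValuation m} (hv : ∀ i, IsBinaryAdditive (v i))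
    {A : Allocation n m} (h : A.IsMNWTie v) : A.IsPO v := by
  classical
  have hb := balanced_ownerOf hv h
  rintro ⟨B, hle, i, hi⟩
  simp only [utility_eq hv, Nat.cast_le, Nat.cast_lt] at hle hi
  have hlt : ∑ k, util v A k < ∑ k, util v B k := sum_lt_sum (fun k _ => hle k) ⟨i, mem_univ i, hi⟩
  have hc : ClosedFor (Wants v) (ownerOf A) univ := fun k _ g hg => by
    obtain ⟨x, hx⟩ := hb.exists_owner hg
    exact ⟨x, mem_univ x, hx⟩
  have h1 := (closedFor_iff hb.nonWasteful univ).1 hc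
  rw [← util_eq_load hv h] at h1
  have h2 := sum_load_le (nonWasteful_trimmedOwner v B) univ
  rw [load_trimmedOwner] at h2
  omega

theorem isGroupStrategyproof_of_isMNWTieRule {f : Rule n m} (hf : f.IsMNWTieRule) :
    f.IsGroupStrategyproof := by
  classical
  rintro ⟨v, v', C, hC, hoff, hgain⟩
  obtain ⟨j, hj, hle⟩ := (balanced_ownerOf v.2 (hf v)).exists_le_of_eq_off
    (balanced_ownerOf v'.2 (hf v')) C hC
    (fun k hk => by funext g; simp only [Wants, hoff k hk])
  have h := hgain j hj
  rw [value_eq_card (v.2 j), value_eq_card (v.2 j), Nat.cast_lt] at h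
  rw [← util_eq_load v.2 (hf v)] at hle
  refine absurd h (not_lt.2 (le_trans (le_of_eq ?_) hle))
  congr 1
  ext g
  simp [ownerOf_eq_some]

theorem exists_max_score (v : Fin n → GoodsValuation m) :
    ∃ A : Allocation n m, ∀ B : Allocation n m, score (util v B) ≤ score (util v A) := by
  have : Finite (Allocation n m) :=
    Finite.of_injective Allocation.bundle fun A B h => by
      cases A; cases B; cases h; rfl
  have : Nonempty (Allocation n m) := ⟨ofOwner fun _ => none⟩
  exact Finite.exists_max fun A => score (util v A)

/-- Some allocation maximizes the score, and it is balanced after trimming. By uniqueness of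
balanced loads `o` has the same score, so an algorithm only has to find a balanced owner map. -/
theorem isMNWTie_ofOwner {v : Fin n → GoodsValuation m} (hv : ∀ i, IsBinaryAdditive (v i))
    {o : Fin m → Option (Fin n)} (ho : Balanced (Wants v) o) : (ofOwner o).IsMNWTie v := by
  rw [isMNWTie_iff hv, isMinimallyComplete_iff]
  constructor
  · obtain ⟨A, hA⟩ := exists_max_score v
    rw [util_ofOwner ho.nonWasteful, ho.load_eq (balanced_trimmedOwner hA), load_trimmedOwner]
    exact hA
  · intro g
    simp only [ofOwner, mem_filter, mem_univ, true_and]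
    constructor
    · rintro ⟨k, hk⟩
      exact ⟨k, (wants_iff (hv k) g).1 (ho.nonWasteful g k hk)⟩
    · rintro ⟨i, hi⟩
      exact ho.exists_owner ((wants_iff (hv i) g).2 hi)

end Allocations

end FairDivision

namespace FairDivision

/-! ### Sweep machines

A sweep machine works on a matrix of cells whose rows carry marks, and on an auxiliary row. A pass
visits the rows one after the other; in each it first evaluates a test on the cells of the row
against the auxiliary row, then updates the mark and the state, and then rewrites the row and the
auxiliary row. -/

/-- The finite control of a sweep machine with states `S`, cells `C`, row marks `Z` and auxiliary
cells `Y`. -/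
structure Sweeper (S C Z Y : Type) where
  start : S
  cell : Bool → C
  mark : Z
  aux : Y
  bit : C → Bool
  test : S → C → Y → Bool
  sep : S → Bool → Z → S × Z
  pick : S → C → Bool
  write : S → Bool → C → Y → C × Y
  finish : S → S
  halted : S → Bool

namespace Sweeper

open Turing StateTransition

variable {S C Z Y : Type} (M : Sweeper S C Z Y)

/-! #### Passes on lists -/

/-- Rewriting a row from the right; the Boolean says whether a cell has been picked. -/
def rowWrite (s : S) : List (C × Y) → Bool × List (C × Y)
  | [] => (false, [])
  | p :: l =>
    ((rowWrite s l).1 || M.pick s p.1,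
      M.write s (M.pick s p.1 && !(rowWrite s l).1) p.1 p.2 :: (rowWrite s l).2)

/-- The effect of a pass on one row. -/
def rowOp (s : S) (r : List C × Z) (ys : List Y) : S × (List C × Z) × List Y :=
  let q := M.sep s ((r.1.zip ys).any fun p => M.test s p.1 p.2) r.2
  let w := (M.rowWrite q.1 (r.1.zip ys)).2
  (q.1, (w.map Prod.fst, q.2), w.map Prod.snd)

/-- The effect of a pass on all rows. The rows come out in reverse order. -/
def passRows : S → List (List C × Z) → List Y → List (List C × Z) → S × List (List C × Z) × List Y
  | s, [], ys, acc => (s, acc, ys)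
  | s, r :: rs, ys, acc =>
    passRows (M.rowOp s r ys).1 rs (M.rowOp s r ys).2.2 ((M.rowOp s r ys).2.1 :: acc)

/-- A pass over all rows, followed by the change of state at its end. -/
def pass (c : S × List (List C × Z) × List Y) : S × List (List C × Z) × List Y :=
  let r := M.passRows c.1 c.2.1 c.2.2 []
  (M.finish r.1, r.2)

/-- Two passes, after which the rows are in the original order again. -/
def round (c : S × List (List C × Z) × List Y) : S × List (List C × Z) × List Y :=
  M.pass (M.pass c)

/-- The word that represents a list of rows. -/
def word (rs : List (List C × Z)) : List (C ⊕ Z) :=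
  rs.flatMap fun r => r.1.map Sum.inl ++ [Sum.inr r.2]

theorem length_rowWrite (s : S) (l : List (C × Y)) : (M.rowWrite s l).2.length = l.length := by
  induction l with
  | nil => rfl
  | cons p l ih => simp [rowWrite, ih]

theorem length_rowOp_aux (s : S) (r : List C × Z) (ys : List Y) (h : r.1.length = ys.length) :
    (M.rowOp s r ys).2.2.length = ys.length := by
  simp [rowOp, length_rowWrite, h]

theorem length_rowOp_row (s : S) (r : List C × Z) (ys : List Y) (h : r.1.length = ys.length) :
    (M.rowOp s r ys).2.1.1.length = ys.length := by
  simp [rowOp, length_rowWrite, h]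

/-! #### The Turing machine -/

/-- The stacks of the Turing machine. -/
inductive Stack
  | inp | out | scr
  | main (d : Bool)
  | aux (d : Bool)

/-- The stack alphabets. -/
abbrev Alphabet (C Z Y : Type) : Stack → Type
  | .inp => Option Bool
  | .out => Option Bool
  | .scr => C
  | .main _ => C ⊕ Z
  | .aux _ => Y

/-- The function labels. -/
inductive Label
  | readAux | readMain | flip
  | scan (d : Bool)
  | rewrite (d : Bool)
  | unflip | emit | emitAux

/-- The internal state: the state of the sweep machine, a flag and registers. -/
structure Reg (S C Z Y : Type) where
  s : S
  e : Bool
  i : Option (Option Bool)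
  r : Option (C ⊕ Z)
  c : Option C
  y : Option Y

instance : Finite Stack :=
  Finite.of_surjective
    (fun x : Fin 5 × Bool => match x with
      | (0, _) => Stack.inp
      | (1, _) => Stack.out
      | (2, _) => Stack.scr
      | (3, d) => Stack.main d
      | (4, d) => Stack.aux d)
    (by
      rintro (_ | _ | _ | d | d)
      exacts [⟨(0, true), rfl⟩, ⟨(1, true), rfl⟩, ⟨(2, true), rfl⟩, ⟨(3, d), rfl⟩, ⟨(4, d), rfl⟩])

instance : Finite Label :=
  Finite.of_surjective
    (fun x : Fin 8 × Bool => match x with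
      | (0, _) => Label.readAux
      | (1, _) => Label.readMain
      | (2, _) => Label.flip
      | (3, d) => Label.scan d
      | (4, d) => Label.rewrite d
      | (5, _) => Label.unflip
      | (6, _) => Label.emit
      | (7, _) => Label.emitAux)
    (by
      rintro (_ | _ | _ | d | d | _ | _ | _)
      exacts [⟨(0, true), rfl⟩, ⟨(1, true), rfl⟩, ⟨(2, true), rfl⟩, ⟨(3, d), rfl⟩, ⟨(4, d), rfl⟩,
        ⟨(5, true), rfl⟩, ⟨(6, true), rfl⟩, ⟨(7, true), rfl⟩])

instance [Finite S] [Finite C] [Finite Z] [Finite Y] : Finite (Reg S C Z Y) :=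
  Finite.of_injective (fun v : Reg S C Z Y => (v.s, v.e, v.i, v.r, v.c, v.y)) (by
    rintro ⟨⟩ ⟨⟩ h
    simp only [Prod.mk.injEq] at h
    obtain ⟨rfl, rfl, rfl, rfl, rfl, rfl⟩ := h
    rfl)

noncomputable instance : DecidableEq Stack := Classical.decEq _

/-- The main symbol for a symbol of the input. -/
def readSym : Option (Option Bool) → C ⊕ Z
  | some (some b) => .inl (M.cell b)
  | _ => .inr M.mark

/-- The output symbol for a main symbol. -/
def outSym : C ⊕ Z → Option Bool
  | .inl x => some (M.bit x)
  | .inr _ => none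

/-- The cell in register `r`. -/
def Reg.cellOf (v : Reg S C Z Y) : C :=
  match v.r with
  | some (.inl x) => x
  | _ => M.cell false

/-- The mark in register `r`. -/
def Reg.markOf (v : Reg S C Z Y) : Z :=
  match v.r with
  | some (.inr z) => z
  | _ => M.mark

/-- Register `r` holds a cell. -/
def Reg.isCell (v : Reg S C Z Y) : Bool :=
  match v.r with
  | some (.inl _) => true
  | _ => false

/-- Register `i` holds a bit. -/
def Reg.isBit (v : Reg S C Z Y) : Bool :=
  match v.i with
  | some (some _) => true
  | _ => false

/-- The initial internal state. -/
def initReg : Reg S C Z Y := ⟨M.start, false, none, none, none, none⟩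

open TM2.Stmt in
/-- The program of the Turing machine. -/
def prog : Label → TM2.Stmt (Alphabet C Z Y) Label (Reg S C Z Y)
  | .readAux =>
    pop .inp (fun v a => { v with i := a }) <|
    branch Reg.isBit
      (push (.aux false) (fun _ => M.aux) <| goto fun _ => .readAux)
      (goto fun _ => .readMain)
  | .readMain =>
    pop .inp (fun v a => { v with i := a }) <|
    branch (fun v => v.i.isNone)
      (goto fun _ => .flip)
      (push (.main true) (fun v => M.readSym v.i) <| goto fun _ => .readMain)
  | .flip =>
    pop (.main true) (fun v a => { v with r := a }) <|
    branch (fun v => v.r.isNone)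
      (goto fun _ => .scan false)
      (push (.main false) (fun v => v.r.getD (.inr M.mark)) <| goto fun _ => .flip)
  | .scan d =>
    pop (.main d) (fun v a => { v with r := a }) <|
    branch (fun v => v.r.isNone)
      (TM2.Stmt.load (fun v => { v with s := M.finish v.s }) <|
        goto fun v => if d && M.halted v.s then .unflip else .scan !d)
    <|
    branch Reg.isCell
      (pop (.aux false) (fun v a => { v with y := a }) <|
        TM2.Stmt.load (fun v => { v with e := v.e || M.test v.s (v.cellOf M) (v.y.getD M.aux) }) <|
        push .scr (fun v => v.cellOf M) <|
        push (.aux true) (fun v => v.y.getD M.aux) <|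
        goto fun _ => .scan d)
      (push (.main !d) (fun v => .inr (M.sep v.s v.e (v.markOf M)).2) <|
        TM2.Stmt.load (fun v => { v with s := (M.sep v.s v.e (v.markOf M)).1, e := false }) <|
        goto fun _ => .rewrite d)
  | .rewrite d =>
    pop .scr (fun v a => { v with c := a }) <|
    branch (fun v => v.c.isNone)
      (TM2.Stmt.load (fun v => { v with e := false }) <| goto fun _ => .scan d)
      (pop (.aux true) (fun v a => { v with y := a }) <|
        push (.main !d) (fun v => .inl (M.write v.s (M.pick v.s (v.c.getD (M.cell false)) && !v.e)
          (v.c.getD (M.cell false)) (v.y.getD M.aux)).1) <|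
        push (.aux false) (fun v => (M.write v.s (M.pick v.s (v.c.getD (M.cell false)) && !v.e)
          (v.c.getD (M.cell false)) (v.y.getD M.aux)).2) <|
        TM2.Stmt.load (fun v => { v with e := v.e || M.pick v.s (v.c.getD (M.cell false)) }) <|
        goto fun _ => .rewrite d)
  | .unflip =>
    pop (.main false) (fun v a => { v with r := a }) <|
    branch (fun v => v.r.isNone)
      (goto fun _ => .emit)
      (push (.main true) (fun v => v.r.getD (.inr M.mark)) <| goto fun _ => .unflip)
  | .emit =>
    pop (.main true) (fun v a => { v with r := a }) <|
    branch (fun v => v.r.isNone)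
      (push .out (fun _ => (none : Option Bool)) <| goto fun _ => .emitAux)
      (push .out (fun v => M.outSym (v.r.getD (.inr M.mark))) <| goto fun _ => .emit)
  | .emitAux =>
    pop (.aux false) (fun v a => { v with y := a }) <|
    branch (fun v => v.y.isNone)
      (TM2.Stmt.load (fun _ => M.initReg) halt)
      (push .out (fun _ => (some true : Option Bool)) <| goto fun _ => .emitAux)

/-- The stacks with the given contents. -/
def stk (i o : List (Option Bool)) (sc : List C) (m₀ m₁ : List (C ⊕ Z)) (a₀ a₁ : List Y) :
    ∀ k, List (Alphabet C Z Y k)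
  | .inp => i
  | .out => o
  | .scr => sc
  | .main false => m₀
  | .main true => m₁
  | .aux false => a₀
  | .aux true => a₁

section Updates

variable (i o : List (Option Bool)) (sc : List C) (m₀ m₁ : List (C ⊕ Z)) (a₀ a₁ : List Y)

theorem update_inp (l : List (Option Bool)) :
    Function.update (stk i o sc m₀ m₁ a₀ a₁) .inp l = stk l o sc m₀ m₁ a₀ a₁ := by
  funext k
  rcases k with _ | _ | _ | (_ | _) | (_ | _) <;> simp [Function.update, stk]

theorem update_out (l : List (Option Bool)) :
    Function.update (stk i o sc m₀ m₁ a₀ a₁) .out l = stk i l sc m₀ m₁ a₀ a₁ := by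
  funext k
  rcases k with _ | _ | _ | (_ | _) | (_ | _) <;> simp [Function.update, stk]

theorem update_scr (l : List C) :
    Function.update (stk i o sc m₀ m₁ a₀ a₁) .scr l = stk i o l m₀ m₁ a₀ a₁ := by
  funext k
  rcases k with _ | _ | _ | (_ | _) | (_ | _) <;> simp [Function.update, stk]

theorem update_main_false (l : List (C ⊕ Z)) :
    Function.update (stk i o sc m₀ m₁ a₀ a₁) (.main false) l = stk i o sc l m₁ a₀ a₁ := by
  funext k
  rcases k with _ | _ | _ | (_ | _) | (_ | _) <;> simp [Function.update, stk]

theorem update_main_true (l : List (C ⊕ Z)) :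
    Function.update (stk i o sc m₀ m₁ a₀ a₁) (.main true) l = stk i o sc m₀ l a₀ a₁ := by
  funext k
  rcases k with _ | _ | _ | (_ | _) | (_ | _) <;> simp [Function.update, stk]

theorem update_aux_false (l : List Y) :
    Function.update (stk i o sc m₀ m₁ a₀ a₁) (.aux false) l = stk i o sc m₀ m₁ l a₁ := by
  funext k
  rcases k with _ | _ | _ | (_ | _) | (_ | _) <;> simp [Function.update, stk]

theorem update_aux_true (l : List Y) :
    Function.update (stk i o sc m₀ m₁ a₀ a₁) (.aux true) l = stk i o sc m₀ m₁ a₀ l := by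
  funext k
  rcases k with _ | _ | _ | (_ | _) | (_ | _) <;> simp [Function.update, stk]

end Updates

/-- The configurations of the Turing machine. -/
abbrev Cfg (S C Z Y : Type) : Type := TM2.Cfg (Alphabet C Z Y) Label (Reg S C Z Y)

/-- The machine gets from one configuration to another in exactly `t` steps. -/
def Steps (t : ℕ) (a b : Cfg S C Z Y) : Prop :=
  (flip bind (TM2.step M.prog))^[t] (some a) = some b

/-! ### Step counts of the Turing machine, from reading the input to writing the output -/

variable {M}

theorem Steps.refl (a : Cfg S C Z Y) : M.Steps 0 a a := rfl

theorem Steps.trans {t t' : ℕ} {a b c : Cfg S C Z Y} (h : M.Steps t a b) (h' : M.Steps t' b c) :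
    M.Steps (t + t') a c := by
  unfold Steps at *
  rw [add_comm, Function.iterate_add_apply, h, h']

theorem Steps.head {t : ℕ} {a b c : Cfg S C Z Y} (h : TM2.step M.prog a = some b)
    (h' : M.Steps t b c) : M.Steps (t + 1) a c := by
  unfold Steps at *
  rw [Function.iterate_succ_apply]
  change (flip bind (TM2.step M.prog))^[t] (TM2.step M.prog a) = some c
  rw [h, h']

theorem steps_readAux (k : ℕ) (w : List (Option Bool)) (ys : List Y) (v : Reg S C Z Y)
    (he : v.e = false) : ∃ v' : Reg S C Z Y, v'.s = v.s ∧ v'.e = false ∧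
      M.Steps (k + 1)
        ⟨some .readAux, v, stk (List.replicate k (some true) ++ none :: w) [] [] [] [] ys []⟩
        ⟨some .readMain, v', stk w [] [] [] [] (List.replicate k M.aux ++ ys) []⟩ := by
  induction k generalizing ys v with
  | zero =>
    refine ⟨{ v with i := some none }, rfl, he, Steps.head (b := _) ?_ (Steps.refl _)⟩
    simp [prog, TM2.stepAux, stk, Reg.isBit, update_inp]
  | succ k ih =>
    obtain ⟨v', h1, h2, h3⟩ := ih (M.aux :: ys) { v with i := some (some true) } he
    refine ⟨v', h1, h2, ?_⟩
    have : List.replicate (k + 1) M.aux ++ ys = List.replicate k M.aux ++ M.aux :: ys := by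
      rw [List.replicate_succ', List.append_assoc]; rfl
    rw [this]
    refine Steps.head ?_ h3
    simp [prog, TM2.stepAux, stk, Reg.isBit, update_inp, update_aux_false, List.replicate_succ]

end Sweeper

end FairDivision

namespace FairDivision

namespace Sweeper

open Turing StateTransition

variable {S C Z Y : Type} {M : Sweeper S C Z Y}

theorem steps_readMain (w : List (Option Bool)) (m₁ : List (C ⊕ Z)) (ys : List Y)
    (v : Reg S C Z Y) (he : v.e = false) : ∃ v' : Reg S C Z Y, v'.s = v.s ∧ v'.e = false ∧
      M.Steps (w.length + 1)
        ⟨some .readMain, v, stk w [] [] [] m₁ ys []⟩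
        ⟨some .flip, v', stk [] [] [] [] ((w.map fun a => M.readSym (some a)).reverse ++ m₁) ys []⟩ := by
  induction w generalizing m₁ v with
  | nil =>
    refine ⟨{ v with i := none }, rfl, he, Steps.head (b := _) ?_ (Steps.refl _)⟩
    simp [prog, TM2.stepAux, stk, update_inp]
  | cons a w ih =>
    obtain ⟨v', h1, h2, h3⟩ := ih (M.readSym (some a) :: m₁) { v with i := some a } he
    refine ⟨v', h1, h2, Steps.head ?_ (by simpa using h3)⟩
    simp [prog, TM2.stepAux, stk, update_inp, update_main_true]

theorem steps_flip (w m₀ : List (C ⊕ Z)) (ys : List Y)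
    (v : Reg S C Z Y) (he : v.e = false) : ∃ v' : Reg S C Z Y, v'.s = v.s ∧ v'.e = false ∧
      M.Steps (w.length + 1)
        ⟨some .flip, v, stk [] [] [] m₀ w ys []⟩
        ⟨some (.scan false), v', stk [] [] [] (w.reverse ++ m₀) [] ys []⟩ := by
  induction w generalizing m₀ v with
  | nil =>
    refine ⟨{ v with r := none }, rfl, he, Steps.head (b := _) ?_ (Steps.refl _)⟩
    simp [prog, TM2.stepAux, stk, update_main_true]
  | cons a w ih =>
    obtain ⟨v', h1, h2, h3⟩ := ih (a :: m₀) { v with r := some a } he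
    refine ⟨v', h1, h2, Steps.head ?_ (by simpa using h3)⟩
    simp [prog, TM2.stepAux, stk, update_main_false, update_main_true]

theorem steps_unflip (w m₁ : List (C ⊕ Z)) (ys : List Y)
    (v : Reg S C Z Y) : ∃ v' : Reg S C Z Y,
      M.Steps (w.length + 1)
        ⟨some .unflip, v, stk [] [] [] w m₁ ys []⟩
        ⟨some .emit, v', stk [] [] [] [] (w.reverse ++ m₁) ys []⟩ := by
  induction w generalizing m₁ v with
  | nil =>
    refine ⟨{ v with r := none }, Steps.head (b := _) ?_ (Steps.refl _)⟩
    simp [prog, TM2.stepAux, stk, update_main_false]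
  | cons a w ih =>
    obtain ⟨v', h3⟩ := ih (a :: m₁) { v with r := some a }
    refine ⟨v', Steps.head ?_ (by simpa using h3)⟩
    simp [prog, TM2.stepAux, stk, update_main_false, update_main_true]

theorem steps_emit (w : List (C ⊕ Z)) (o : List (Option Bool)) (ys : List Y)
    (v : Reg S C Z Y) : ∃ v' : Reg S C Z Y,
      M.Steps (w.length + 1)
        ⟨some .emit, v, stk [] o [] [] w ys []⟩
        ⟨some .emitAux, v', stk [] (none :: ((w.map M.outSym).reverse ++ o)) [] [] [] ys []⟩ := by
  induction w generalizing o v with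
  | nil =>
    refine ⟨{ v with r := none }, Steps.head (b := _) ?_ (Steps.refl _)⟩
    simp [prog, TM2.stepAux, stk, update_main_true, update_out]
  | cons a w ih =>
    obtain ⟨v', h3⟩ := ih (M.outSym a :: o) { v with r := some a }
    refine ⟨v', Steps.head ?_ (by simpa using h3)⟩
    simp [prog, TM2.stepAux, stk, update_main_true, update_out]

theorem steps_emitAux (ys : List Y) (o : List (Option Bool)) (v : Reg S C Z Y) :
    M.Steps (ys.length + 1)
      ⟨some .emitAux, v, stk [] o [] [] [] ys []⟩
      ⟨none, M.initReg, stk [] (List.replicate ys.length (some true) ++ o) [] [] [] [] []⟩ := by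
  induction ys generalizing o v with
  | nil =>
    refine Steps.head (b := _) ?_ (Steps.refl _)
    simp [prog, TM2.stepAux, stk, update_aux_false]
  | cons a w ih =>
    have h3 := ih (some true :: o) { v with y := some a }
    have : List.replicate (a :: w).length (some true) ++ o =
        List.replicate w.length (some true) ++ some true :: o := by
      rw [List.length_cons, List.replicate_succ', List.append_assoc]; rfl
    rw [this]
    refine Steps.head ?_ h3
    simp [prog, TM2.stepAux, stk, update_aux_false, update_out]

/-- The stacks during a pass in direction `d`. -/
def stkAt (d : Bool) (sc : List C) (cur oth : List (C ⊕ Z)) (a₀ a₁ : List Y) :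
    ∀ k, List (Alphabet C Z Y k) :=
  stk [] [] sc (bif d then oth else cur) (bif d then cur else oth) a₀ a₁

section

variable (d : Bool) (sc : List C) (cur oth : List (C ⊕ Z)) (a₀ a₁ : List Y)

theorem stkAt_main : stkAt d sc cur oth a₀ a₁ (.main d) = cur := by cases d <;> rfl

theorem stkAt_main_not : stkAt d sc cur oth a₀ a₁ (.main !d) = oth := by cases d <;> rfl

theorem stkAt_scr : stkAt d sc cur oth a₀ a₁ .scr = sc := rfl

theorem stkAt_aux_false : stkAt d sc cur oth a₀ a₁ (.aux false) = a₀ := rfl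

theorem stkAt_aux_true : stkAt d sc cur oth a₀ a₁ (.aux true) = a₁ := rfl

theorem update_stkAt_main (l : List (C ⊕ Z)) :
    Function.update (stkAt d sc cur oth a₀ a₁) (.main d) l = stkAt d sc l oth a₀ a₁ := by
  cases d
  · exact update_main_false ..
  · exact update_main_true ..

theorem update_stkAt_main_not (l : List (C ⊕ Z)) :
    Function.update (stkAt d sc cur oth a₀ a₁) (.main !d) l = stkAt d sc cur l a₀ a₁ := by
  cases d
  · exact update_main_true ..
  · exact update_main_false ..

theorem update_stkAt_scr (l : List C) :
    Function.update (stkAt d sc cur oth a₀ a₁) .scr l = stkAt d l cur oth a₀ a₁ :=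
  update_scr ..

theorem update_stkAt_aux_false (l : List Y) :
    Function.update (stkAt d sc cur oth a₀ a₁) (.aux false) l = stkAt d sc cur oth l a₁ :=
  update_aux_false ..

theorem update_stkAt_aux_true (l : List Y) :
    Function.update (stkAt d sc cur oth a₀ a₁) (.aux true) l = stkAt d sc cur oth a₀ l :=
  update_aux_true ..

theorem stkAt_swap : stkAt d sc cur oth a₀ a₁ = stkAt (!d) sc oth cur a₀ a₁ := by
  cases d <;> rfl

end

/-- The row goes to the scratch stack and the auxiliary row to its second stack, both reversed,
while the flag collects the tests. The mark comes after the cells, so the change of state can depend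
on the whole row. -/
theorem steps_scan (d : Bool) (xs : List C) (ys : List Y) (h : xs.length = ys.length) (sc : List C)
    (rest oth : List (C ⊕ Z)) (a₁ : List Y) (v : Reg S C Z Y) :
    ∃ v' : Reg S C Z Y, v'.s = v.s ∧
      v'.e = (v.e || (xs.zip ys).any fun p => M.test v.s p.1 p.2) ∧
      M.Steps xs.length
        ⟨some (.scan d), v, stkAt d sc (xs.map Sum.inl ++ rest) oth ys a₁⟩
        ⟨some (.scan d), v', stkAt d (xs.reverse ++ sc) rest oth [] (ys.reverse ++ a₁)⟩ := by
  induction xs generalizing ys sc a₁ v with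
  | nil =>
    obtain rfl : ys = [] := List.length_eq_zero_iff.1 h.symm
    exact ⟨v, rfl, by simp, Steps.refl _⟩
  | cons x xs ih =>
    obtain _ | ⟨y, ys⟩ := ys
    · simp at h
    · obtain ⟨v', h1, h2, h3⟩ := ih ys (by simpa using h) (x :: sc) (y :: a₁)
        { v with r := some (.inl x), y := some y, e := v.e || M.test v.s x y }
      refine ⟨v', h1, by rw [h2]; simp [Bool.or_assoc], ?_⟩
      simp only [List.reverse_cons, List.append_assoc, List.length_cons, List.map_cons, List.cons_append]
      refine Steps.head ?_ h3
      simp [prog, TM2.stepAux, stkAt_main, stkAt_scr, stkAt_aux_false, stkAt_aux_true,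
        update_stkAt_main, update_stkAt_scr, update_stkAt_aux_false, update_stkAt_aux_true,
        Reg.isCell, Reg.cellOf]

/-- The scratch stack returns the row from its right end, hence the induction from the back of `l₁`.
The suffix `l₂` is already rewritten, and the flag records whether one of its cells was picked. -/
theorem steps_rewrite (d : Bool) (l₁ : List (C × Y)) (l₂ : List (C × Y))
    (cur oth : List (C ⊕ Z)) (v : Reg S C Z Y) (he : v.e = (M.rowWrite v.s l₂).1) :
    ∃ v' : Reg S C Z Y, v'.s = v.s ∧ v'.e = false ∧
      M.Steps (l₁.length + 1)
        ⟨some (.rewrite d), v, stkAt d (l₁.map Prod.fst).reverse cur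
          (((M.rowWrite v.s l₂).2.map Prod.fst).map Sum.inl ++ oth)
          ((M.rowWrite v.s l₂).2.map Prod.snd) (l₁.map Prod.snd).reverse⟩
        ⟨some (.scan d), v', stkAt d [] cur
          (((M.rowWrite v.s (l₁ ++ l₂)).2.map Prod.fst).map Sum.inl ++ oth)
          ((M.rowWrite v.s (l₁ ++ l₂)).2.map Prod.snd) []⟩ := by
  induction l₁ using List.reverseRecOn generalizing l₂ v with
  | nil =>
    refine ⟨{ v with c := none, e := false }, rfl, rfl, Steps.head (b := _) ?_ (Steps.refl _)⟩
    simp [prog, TM2.stepAux, stkAt_scr, update_stkAt_scr]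
  | append_singleton l p ih =>
    obtain ⟨v', h1, h2, h3⟩ := ih (p :: l₂)
      { v with c := some p.1, y := some p.2, e := v.e || M.pick v.s p.1 }
      (by simp [rowWrite, he])
    refine ⟨v', h1, h2, ?_⟩
    simp only [List.append_assoc, List.singleton_append, List.length_append, List.length_singleton]
    refine Steps.head ?_ h3
    simp [prog, TM2.stepAux, stkAt_main_not, stkAt_scr, stkAt_aux_false, stkAt_aux_true,
        update_stkAt_main_not, update_stkAt_scr, update_stkAt_aux_false, update_stkAt_aux_true,
        rowWrite, he]

theorem steps_rowOp (d : Bool) (r : List C × Z) (ys : List Y) (h : r.1.length = ys.length)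
    (rest : List (C ⊕ Z)) (acc : List (List C × Z)) (v : Reg S C Z Y) (he : v.e = false) :
    ∃ v' : Reg S C Z Y, v'.s = (M.rowOp v.s r ys).1 ∧ v'.e = false ∧
      M.Steps (2 * ys.length + 2)
        ⟨some (.scan d), v, stkAt d [] (r.1.map Sum.inl ++ Sum.inr r.2 :: rest) (word acc) ys []⟩
        ⟨some (.scan d), v', stkAt d [] rest (word ((M.rowOp v.s r ys).2.1 :: acc))
          (M.rowOp v.s r ys).2.2 []⟩ := by
  obtain ⟨v₁, h1, h2, h3⟩ := steps_scan (M := M) d r.1 ys h [] (Sum.inr r.2 :: rest) (word acc) [] v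
  set e := (r.1.zip ys).any fun p => M.test v.s p.1 p.2 with he'
  rw [he, Bool.false_or] at h2
  obtain ⟨v₂, h4, h5, h6⟩ := steps_rewrite (M := M) d (r.1.zip ys) [] rest
    (Sum.inr (M.sep v.s e r.2).2 :: word acc)
    { v₁ with r := some (.inr r.2), s := (M.sep v.s e r.2).1, e := false } rfl
  refine ⟨v₂, h4, h5, ?_⟩
  have e1 : (r.1.zip ys).map Prod.fst = r.1 := List.map_fst_zip h.le
  have e2 : (r.1.zip ys).map Prod.snd = ys := List.map_snd_zip h.ge
  have hstep : TM2.step M.prog ⟨some (.scan d), v₁, stkAt d (r.1.reverse ++ []) (Sum.inr r.2 :: rest)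
      (word acc) [] (ys.reverse ++ [])⟩ = some ⟨some (.rewrite d),
      { v₁ with r := some (.inr r.2), s := (M.sep v.s e r.2).1, e := false },
      stkAt d r.1.reverse rest (Sum.inr (M.sep v.s e r.2).2 :: word acc) [] ys.reverse⟩ := by
    simp [prog, TM2.stepAux, stkAt_main, stkAt_main_not, update_stkAt_main, update_stkAt_main_not,
      Reg.isCell, Reg.markOf, h1, h2]
  rw [e1, e2] at h6
  have := h3.trans (Steps.head hstep h6)
  have hl : (r.1.zip ys).length = ys.length := by simp [h]
  rw [hl, h] at this
  have ht : ys.length + (ys.length + 1 + 1) = 2 * ys.length + 2 := by ring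
  rw [ht] at this
  simpa [rowOp, word, ← he'] using this

theorem steps_passRows (d : Bool) (rs : List (List C × Z)) (ys : List Y)
    (h : ∀ r ∈ rs, r.1.length = ys.length) (acc : List (List C × Z)) (v : Reg S C Z Y)
    (he : v.e = false) :
    ∃ v' : Reg S C Z Y, v'.s = (M.passRows v.s rs ys acc).1 ∧ v'.e = false ∧
      M.Steps (rs.length * (2 * ys.length + 2))
        ⟨some (.scan d), v, stkAt d [] (word rs) (word acc) ys []⟩
        ⟨some (.scan d), v', stkAt d [] [] (word (M.passRows v.s rs ys acc).2.1)
          (M.passRows v.s rs ys acc).2.2 []⟩ := by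
  induction rs generalizing ys acc v with
  | nil =>
    refine ⟨v, rfl, he, ?_⟩
    rw [List.length_nil, zero_mul]
    exact Steps.refl _
  | cons r rs ih =>
    obtain ⟨v₁, h1, h2, h3⟩ := steps_rowOp (M := M) d r ys (h r List.mem_cons_self) (word rs) acc v he
    have hlen := M.length_rowOp_aux v.s r ys (h r List.mem_cons_self)
    obtain ⟨v₂, h4, h5, h6⟩ := ih (M.rowOp v.s r ys).2.2
      (fun r' hr' => by rw [hlen]; exact h r' (List.mem_cons_of_mem _ hr'))
      ((M.rowOp v.s r ys).2.1 :: acc) v₁ h2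
    rw [h1] at h4 h6
    rw [hlen] at h6
    refine ⟨v₂, h4, h5, ?_⟩
    have := h3.trans h6
    rw [List.length_cons, Nat.add_mul, one_mul, Nat.add_comm]
    simpa [word, passRows] using this

/-- All rows are as long as the auxiliary row. -/
def Rect (c : S × List (List C × Z) × List Y) : Prop := ∀ r ∈ c.2.1, r.1.length = c.2.2.length

theorem passRows_invariants (rs : List (List C × Z)) (s : S) (ys : List Y)
    (h : ∀ r ∈ rs, r.1.length = ys.length) (acc : List (List C × Z))
    (hacc : ∀ r ∈ acc, r.1.length = ys.length) :
    (M.passRows s rs ys acc).2.2.length = ys.length ∧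
    (M.passRows s rs ys acc).2.1.length = rs.length + acc.length ∧
    ∀ r ∈ (M.passRows s rs ys acc).2.1, r.1.length = ys.length := by
  induction rs generalizing s ys acc with
  | nil => exact ⟨rfl, by simp [passRows], hacc⟩
  | cons r rs ih =>
    have hr := h r List.mem_cons_self
    have hlen := M.length_rowOp_aux s r ys hr
    have := ih (M.rowOp s r ys).1 (M.rowOp s r ys).2.2
      (fun r' hr' => by rw [hlen]; exact h r' (List.mem_cons_of_mem _ hr'))
      ((M.rowOp s r ys).2.1 :: acc) (by
        intro r' hr'
        rw [hlen]
        rcases List.mem_cons.1 hr' with rfl | hr'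
        · exact M.length_rowOp_row s r ys hr
        · exact hacc r' hr')
    rw [hlen] at this
    refine ⟨this.1, ?_, this.2.2⟩
    rw [passRows, this.2.1, List.length_cons, List.length_cons]
    omega

theorem Rect.pass {c : S × List (List C × Z) × List Y} (h : Rect c) :
    Rect (M.pass c) ∧ (M.pass c).2.1.length = c.2.1.length ∧
      (M.pass c).2.2.length = c.2.2.length := by
  have := passRows_invariants (M := M) c.2.1 c.1 c.2.2 h [] (by simp)
  exact ⟨fun r hr => (this.2.2 r hr).trans this.1.symm, this.2.1, this.1⟩

theorem Rect.round {c : S × List (List C × Z) × List Y} (h : Rect c) :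
    Rect (M.round c) ∧ (M.round c).2.1.length = c.2.1.length ∧
      (M.round c).2.2.length = c.2.2.length := by
  have h1 := h.pass (M := M)
  have h2 := h1.1.pass (M := M)
  exact ⟨h2.1, h2.2.1.trans h1.2.1, h2.2.2.trans h1.2.2⟩

/-- Moving rows to the other main stack reverses their order. Inside a row the scratch stack
restores the order, and the mark is pushed before the cells, so the result is again a `word` that
the next pass can read in the other direction. -/
theorem steps_pass (d : Bool) (c : S × List (List C × Z) × List Y) (h : Rect c)
    (v : Reg S C Z Y) (hs : v.s = c.1) (he : v.e = false) :
    ∃ v' : Reg S C Z Y, v'.s = (M.pass c).1 ∧ v'.e = false ∧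
      M.Steps (c.2.1.length * (2 * c.2.2.length + 2) + 1)
        ⟨some (.scan d), v, stkAt d [] (word c.2.1) [] c.2.2 []⟩
        ⟨some (if d && M.halted (M.pass c).1 then .unflip else .scan !d), v',
          stkAt (!d) [] (word (M.pass c).2.1) [] (M.pass c).2.2 []⟩ := by
  obtain ⟨v₁, h1, h2, h3⟩ := steps_passRows (M := M) d c.2.1 c.2.2 h [] v he
  rw [hs] at h1 h3
  refine ⟨{ v₁ with r := none, s := M.finish v₁.s }, by simp [pass, h1], h2, ?_⟩
  refine h3.trans (Steps.head (b := _) ?_ (Steps.refl _))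
  rw [stkAt_swap (!d), Bool.not_not]
  simp [prog, TM2.stepAux, stkAt_main, update_stkAt_main, pass, h1]

/-- The number of steps of a round. -/
def roundTime (c : S × List (List C × Z) × List Y) : ℕ :=
  2 * (c.2.1.length * (2 * c.2.2.length + 2) + 1)

theorem steps_round (c : S × List (List C × Z) × List Y) (h : Rect c)
    (v : Reg S C Z Y) (hs : v.s = c.1) (he : v.e = false) :
    ∃ v' : Reg S C Z Y, v'.s = (M.round c).1 ∧ v'.e = false ∧
      M.Steps (roundTime c)
        ⟨some (.scan false), v, stk [] [] [] (word c.2.1) [] c.2.2 []⟩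
        ⟨some (if M.halted (M.round c).1 then .unflip else .scan false), v',
          stk [] [] [] (word (M.round c).2.1) [] (M.round c).2.2 []⟩ := by
  obtain ⟨v₁, h1, h2, h3⟩ := steps_pass (M := M) false c h v hs he
  have hp := h.pass (M := M)
  obtain ⟨v₂, h4, h5, h6⟩ := steps_pass (M := M) true (M.pass c) hp.1 v₁ h1 h2
  refine ⟨v₂, h4, h5, ?_⟩
  have := h3.trans h6
  rw [hp.2.1, hp.2.2, ← two_mul] at this
  exact this

/-- The machine gets from `c` to `c'` in `t` rounds none of which ends in a halting state. -/
inductive Rounds (M : Sweeper S C Z Y) :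
    ℕ → S × List (List C × Z) × List Y → S × List (List C × Z) × List Y → Prop
  | refl (c) : Rounds M 0 c c
  | head {t c c'} : M.halted (M.round c).1 = false → Rounds M t (M.round c) c' →
      Rounds M (t + 1) c c'

theorem steps_rounds {t : ℕ} {c c' : S × List (List C × Z) × List Y} (hr : M.Rounds t c c')
    (h : Rect c) (v : Reg S C Z Y) (hs : v.s = c.1) (he : v.e = false) :
    Rect c' ∧ c'.2.1.length = c.2.1.length ∧ c'.2.2.length = c.2.2.length ∧
    ∃ v' : Reg S C Z Y, v'.s = c'.1 ∧ v'.e = false ∧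
      M.Steps (t * roundTime c)
        ⟨some (.scan false), v, stk [] [] [] (word c.2.1) [] c.2.2 []⟩
        ⟨some (.scan false), v', stk [] [] [] (word c'.2.1) [] c'.2.2 []⟩ := by
  induction hr generalizing v with
  | refl c =>
    refine ⟨h, rfl, rfl, v, hs, he, ?_⟩
    rw [zero_mul]
    exact Steps.refl _
  | @head t c c' hh _ ih =>
    obtain ⟨v₁, h1, h2, h3⟩ := steps_round (M := M) c h v hs he
    have hp := h.round (M := M)
    obtain ⟨g1, g2, g3, v₂, h4, h5, h6⟩ := ih hp.1 v₁ h1 h2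
    refine ⟨g1, g2.trans hp.2.1, g3.trans hp.2.2, v₂, h4, h5, ?_⟩
    rw [hh] at h3
    have := h3.trans h6
    rw [show roundTime (M.round c) = roundTime c by simp [roundTime, hp.2.1, hp.2.2]] at this
    rw [Nat.add_mul, one_mul, Nat.add_comm]
    exact this

theorem length_word {c : S × List (List C × Z) × List Y} (h : Rect c) :
    (word c.2.1).length = c.2.1.length * (c.2.2.length + 1) := by
  have : ∀ (rs : List (List C × Z)) (k : ℕ), (∀ r ∈ rs, r.1.length = k) →
      (word rs).length = rs.length * (k + 1) := by
    intro rs k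
    induction rs with
    | nil => simp [word]
    | cons r rs ih =>
      intro h
      have h1 := ih fun r' hr' => h r' (List.mem_cons_of_mem _ hr')
      have h2 := h r List.mem_cons_self
      simp only [word, List.flatMap_cons, List.length_append, List.length_map,
        List.length_cons, List.length_nil] at h1 ⊢
      rw [h1, h2]
      ring
  exact this _ _ h

/-- The whole run of the machine. -/
theorem steps_run {c₀ c : S × List (List C × Z) × List Y} {t k : ℕ} {w : List (Option Bool)}
    (h₀ : c₀.1 = M.start) (hk : c₀.2.2 = List.replicate k M.aux)
    (hw : word c₀.2.1 = w.map fun a => M.readSym (some a)) (hrect : Rect c₀)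
    (hr : M.Rounds t c₀ c) (hh : M.halted (M.round c).1 = true) :
    M.Steps (k + 1 + (w.length + 1) + (w.length + 1) + (t + 1) * roundTime c₀ + (w.length + 1) +
        (w.length + 1) + (k + 1))
      ⟨some .readAux, M.initReg, stk (List.replicate k (some true) ++ none :: w) [] [] [] [] [] []⟩
      ⟨none, M.initReg, stk [] (List.replicate k (some true) ++
        none :: (word (M.round c).2.1).map M.outSym) [] [] [] [] []⟩ := by
  obtain ⟨v₁, a1, a2, a3⟩ := steps_readAux (M := M) k w [] M.initReg rfl
  obtain ⟨v₂, b1, b2, b3⟩ := steps_readMain (M := M) w [] (List.replicate k M.aux ++ []) v₁ a2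
  obtain ⟨v₃, c1, c2, c3⟩ := steps_flip (M := M) ((w.map fun a => M.readSym (some a)).reverse ++ [])
    [] (List.replicate k M.aux ++ []) v₂ b2
  rw [List.append_nil, List.append_nil, List.append_nil, List.reverse_reverse, ← hw, ← hk] at c3
  obtain ⟨r1, r2, r3, v₄, d1, d2, d3⟩ := steps_rounds hr hrect v₃
    (by rw [c1, b1, a1, h₀]; rfl) c2
  obtain ⟨v₅, e1, e2, e3⟩ := steps_round (M := M) c r1 v₄ d1 d2
  rw [hh] at e3
  have hrd := r1.round (M := M)
  obtain ⟨v₆, f1⟩ := steps_unflip (M := M) (word (M.round c).2.1) [] (M.round c).2.2 v₅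
  obtain ⟨v₇, g1⟩ := steps_emit (M := M) ((word (M.round c).2.1).reverse ++ []) []
    (M.round c).2.2 v₆
  have h1 := steps_emitAux (M := M) (M.round c).2.2
    (none :: ((((word (M.round c).2.1).reverse ++ []).map M.outSym).reverse ++ [])) v₇
  -- Rounds preserve the shape of the matrix, so each copying phase costs as much at the end as at
  -- the beginning.
  have hlen : (word (M.round c).2.1).length = w.length := by
    rw [length_word hrd.1, hrd.2.1, hrd.2.2, r2, r3, ← length_word hrect, hw, List.length_map]
  have hlen' : (M.round c).2.2.length = k := by
    rw [hrd.2.2, r3, hk, List.length_replicate]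
  rw [List.append_nil, List.append_nil] at b3
  rw [List.append_nil] at a3
  rw [List.append_nil, List.length_reverse, hlen] at g1
  rw [List.append_nil] at f1
  rw [hlen] at f1
  simp only [List.append_nil, List.map_reverse, List.reverse_reverse] at g1 h1
  rw [hlen'] at h1
  rw [hw, List.length_reverse, List.length_map, ← hw] at c3
  rw [← hk] at a3 b3
  rw [← hw] at b3
  have ht : roundTime c = roundTime c₀ := by simp [roundTime, r2, r3]
  rw [ht] at e3
  have := ((((((a3.trans b3).trans c3).trans d3).trans e3).trans f1).trans g1).trans h1
  convert this using 1
  ring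

end Sweeper

end FairDivision

/-! ### Sweep machines on matrices indexed by agents and goods -/

namespace FairDivision

namespace Sweeper

variable {S C Z Y : Type} (M : Sweeper S C Z Y) {n m : ℕ}

/-- Configurations of a sweep machine on an `n × m` matrix. -/
structure Conf (S C Z Y : Type) (n m : ℕ) where
  s : S
  X : Fin n → Fin m → C
  Z : Fin n → Z
  Y : Fin m → Y

namespace Conf

/-- A row as a list. -/
def row (c : Conf S C Z Y n m) (k : Fin n) : List C × Z := (List.ofFn (c.X k), c.Z k)

/-- The lists that represent a configuration, with the rows in the given order. -/
def lists (c : Conf S C Z Y n m) (ks : List (Fin n)) : S × List (List C × Z) × List Y :=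
  (c.s, ks.map c.row, List.ofFn c.Y)

end Conf

/-- The state and the mark after the test of row `k`. -/
def sepAt (c : Conf S C Z Y n m) (k : Fin n) : S × Z :=
  M.sep c.s (decide (∃ g, M.test c.s (c.X k g) (c.Y g) = true)) (c.Z k)

/-- `g` is the last good of row `k` that is picked in state `s`. -/
def selAt (c : Conf S C Z Y n m) (s : S) (k : Fin n) (g : Fin m) : Bool :=
  decide (M.pick s (c.X k g) = true ∧ ∀ g', g < g' → M.pick s (c.X k g') = false)

/-- The new contents of row `k` and of the auxiliary row. -/
def writeAt (c : Conf S C Z Y n m) (k : Fin n) (g : Fin m) : C × Y :=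
  M.write (M.sepAt c k).1 (M.selAt c (M.sepAt c k).1 k g) (c.X k g) (c.Y g)

/-- The effect of a pass on row `k`. -/
def visit (c : Conf S C Z Y n m) (k : Fin n) : Conf S C Z Y n m where
  s := (M.sepAt c k).1
  X := Function.update c.X k fun g => (M.writeAt c k g).1
  Z := Function.update c.Z k (M.sepAt c k).2
  Y g := (M.writeAt c k g).2

/-- The effect of a pass that visits the rows in the given order. -/
def passConf (c : Conf S C Z Y n m) (ks : List (Fin n)) : Conf S C Z Y n m :=
  { ks.foldl M.visit c with s := M.finish (ks.foldl M.visit c).s }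

/-- The effect of a round. -/
def roundConf (c : Conf S C Z Y n m) : Conf S C Z Y n m :=
  M.passConf (M.passConf c (List.finRange n)) (List.finRange n).reverse

/-- Rewriting runs from right to left, so the one cell treated as picked is the last candidate of
the row. -/
theorem rowWrite_ofFn (s : S) (p : Fin m → C × Y) :
    M.rowWrite s (List.ofFn p) = (decide (∃ g, M.pick s (p g).1 = true),
      List.ofFn fun g => M.write s
        (decide (M.pick s (p g).1 = true ∧ ∀ g', g < g' → M.pick s (p g').1 = false))
        (p g).1 (p g).2) := by
  induction m with
  | zero => simp [rowWrite]
  | succ m ih =>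
    rw [List.ofFn_succ, rowWrite, ih, List.ofFn_succ]
    refine Prod.ext ?_ ?_
    · simp only [Fin.exists_fin_succ]
      rw [Bool.eq_iff_iff]
      simp [or_comm]
    · simp only [Fin.forall_fin_succ, Fin.succ_lt_succ_iff, Fin.succ_pos, Fin.not_lt_zero]
      congr 2
      · rw [Bool.eq_iff_iff]
        simp
      · simp

theorem rowOp_row (c : Conf S C Z Y n m) (k : Fin n) :
    M.rowOp c.s (c.row k) (List.ofFn c.Y) =
      ((M.visit c k).s, (M.visit c k).row k, List.ofFn (M.visit c k).Y) := by
  have hzip : (List.ofFn (c.X k)).zip (List.ofFn c.Y) = List.ofFn fun g => (c.X k g, c.Y g) := by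
    apply List.ext_getElem <;> simp
  have hany : ((List.ofFn fun g => (c.X k g, c.Y g)).any fun p => M.test c.s p.1 p.2) =
      decide (∃ g, M.test c.s (c.X k g) (c.Y g) = true) := by
    rw [Bool.eq_iff_iff, List.any_eq_true]
    simp [List.mem_ofFn]
  simp only [rowOp, Conf.row, hzip, hany, rowWrite_ofFn, visit, Function.update_self,
    List.map_ofFn]
  rfl

theorem visit_row_of_ne (c : Conf S C Z Y n m) {k x : Fin n} (h : x ≠ k) :
    (M.visit c k).row x = c.row x := by
  simp [Conf.row, visit, h]

/-- Visiting a row changes no other row. As `ks` has no repetitions, rows already moved to `acc` and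
rows still to come may be read off from the current configuration. -/
theorem passRows_lists (ks : List (Fin n)) (c : Conf S C Z Y n m) (acc : List (Fin n))
    (h : ks.Nodup) (hacc : ∀ k ∈ ks, k ∉ acc) :
    M.passRows c.s (ks.map c.row) (List.ofFn c.Y) (acc.map c.row) =
      (ks.foldl M.visit c).lists (ks.reverse ++ acc) := by
  induction ks generalizing c acc with
  | nil => rfl
  | cons k ks ih =>
    obtain ⟨hk, hn⟩ := List.nodup_cons.1 h
    rw [List.map_cons, passRows, rowOp_row]
    have h1 : ks.map c.row = ks.map (M.visit c k).row :=
      List.map_congr_left fun x hx => (M.visit_row_of_ne c (fun e : x = k => hk (e ▸ hx))).symm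
    have h2 : acc.map c.row = acc.map (M.visit c k).row :=
      List.map_congr_left fun x hx =>
        (M.visit_row_of_ne c (fun e : x = k => hacc k List.mem_cons_self (e ▸ hx))).symm
    have := ih (M.visit c k) (k :: acc) hn (by
      intro x hx hx'
      rcases List.mem_cons.1 hx' with rfl | hx'
      · exact hk hx
      · exact hacc x (List.mem_cons_of_mem _ hx) hx')
    rw [h1, h2]
    simpa using this

theorem pass_lists (c : Conf S C Z Y n m) (ks : List (Fin n)) (h : ks.Nodup) :
    M.pass (c.lists ks) = (M.passConf c ks).lists ks.reverse := by
  have := M.passRows_lists ks c [] h (by simp)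
  rw [List.append_nil, List.map_nil] at this
  simp only [pass, Conf.lists]
  rw [this]
  rfl

theorem round_lists (c : Conf S C Z Y n m) :
    M.round (c.lists (List.finRange n)) = (M.roundConf c).lists (List.finRange n) := by
  rw [round, pass_lists _ _ _ (List.nodup_finRange n),
    pass_lists _ _ _ (List.nodup_reverse.2 (List.nodup_finRange n)), List.reverse_reverse]
  rfl

variable {M}

/-- Induction along a pass: `I pre c` holds when the rows in `pre` have been visited. -/
theorem foldl_visit_induction (I : List (Fin n) → Conf S C Z Y n m → Prop) (ks : List (Fin n))
    {c : Conf S C Z Y n m} (h0 : I [] c)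
    (hstep : ∀ pre k post c, pre ++ k :: post = ks → I pre c → I (pre ++ [k]) (M.visit c k)) :
    I ks (ks.foldl M.visit c) := by
  have : ∀ post pre c, pre ++ post = ks → I pre c → I ks (post.foldl M.visit c) := by
    intro post
    induction post with
    | nil =>
      intro pre c h hI
      rw [List.append_nil] at h
      exact h ▸ hI
    | cons k post ih =>
      intro pre c h hI
      exact ih (pre ++ [k]) (M.visit c k) (by simpa using h) (hstep pre k post c h hI)
  exact this ks [] c rfl h0

theorem notMem_of_append_cons_eq {pre post ks : List (Fin n)} {k : Fin n}
    (h : pre ++ k :: post = ks) (hn : ks.Nodup) : k ∉ pre := by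
  subst h
  intro hk
  exact (List.nodup_append.1 hn).2.2 k hk k List.mem_cons_self rfl

theorem mem_of_lt_of_append_cons_eq {pre post : List (Fin n)} {k x : Fin n}
    (h : pre ++ k :: post = List.finRange n) (hx : x < k) : x ∈ pre := by
  have hmem : x ∈ pre ++ k :: post := h ▸ List.mem_finRange x
  have hs : (pre ++ k :: post).Pairwise (· < ·) := h ▸ List.pairwise_lt_finRange n
  rcases List.mem_append.1 hmem with hx' | hx'
  · exact hx'
  · rcases List.mem_cons.1 hx' with rfl | hx'
    · exact absurd hx (lt_irrefl _)
    · have := (List.pairwise_cons.1 (List.pairwise_append.1 hs).2.1).1 x hx'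
      exact absurd hx this.asymm

/-- Rounds on configurations. -/
inductive RoundsConf (M : Sweeper S C Z Y) : ℕ → Conf S C Z Y n m → Conf S C Z Y n m → Prop
  | refl (c) : RoundsConf M 0 c c
  | head {t c c'} : M.halted (M.roundConf c).s = false → RoundsConf M t (M.roundConf c) c' →
      RoundsConf M (t + 1) c c'

theorem RoundsConf.trans {t t' : ℕ} {a b c : Conf S C Z Y n m} (h : RoundsConf M t a b)
    (h' : RoundsConf M t' b c) : RoundsConf M (t + t') a c := by
  induction h with
  | refl => simpa using h'
  | @head t _ _ hh _ ih =>
    have := RoundsConf.head hh (ih h')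
    rwa [show t + 1 + t' = t + t' + 1 by ring]

theorem RoundsConf.single {c : Conf S C Z Y n m} (h : M.halted (M.roundConf c).s = false) :
    RoundsConf M 1 c (M.roundConf c) :=
  .head h (.refl _)

theorem RoundsConf.rounds {t : ℕ} {c c' : Conf S C Z Y n m} (h : RoundsConf M t c c') :
    M.Rounds t (c.lists (List.finRange n)) (c'.lists (List.finRange n)) := by
  induction h with
  | refl => exact .refl _
  | head hh _ ih =>
    rw [← round_lists] at ih
    refine .head ?_ ih
    rw [round_lists]
    exact hh

end Sweeper

end FairDivision

namespace FairDivision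

open Finset

/-! ### Greedy rounds

In each round every agent in turn is given one more good if this is possible without changing the
loads of the others. -/

section Greedy

variable {ι γ : Type*} [Fintype γ] [LinearOrder ι]

/-- The invariant after `l` full rounds and the turns of the agents `k` with `t k = true`. -/
structure Greedy (W : ι → γ → Prop) (o : γ → Option ι) (t : ι → Bool) (l : ℕ) : Prop where
  nonWasteful : NonWasteful W o
  initial : ∀ i j, i < j → t j = true → t i = true
  load_le : ∀ k, load o k ≤ l + (t k).toNat
  load_eq_or : ∀ k, load o k = l + (t k).toNat ∨
    ∃ R : Finset ι, k ∈ R ∧ ClosedFor W o R ∧ ∀ x ∈ R, x ≠ k → NoGain (load o) x k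

variable {W : ι → γ → Prop} {o : γ → Option ι} {t : ι → Bool} {l : ℕ}

theorem load_le_card (o : γ → Option ι) (k : ι) : load o k ≤ Fintype.card γ := card_le_univ _

theorem load_none (k : ι) : load (fun _ : γ => (none : Option ι)) k = 0 := by
  simp [load]

theorem greedy_none : Greedy W (fun _ : γ => (none : Option ι)) (fun _ => false) 0 where
  nonWasteful := by intro g k h; simp at h
  initial := by intro i j _ h; simp at h
  load_le k := by simp [load_none]
  load_eq_or k := Or.inl (by simp [load_none])

namespace Greedy

/-- An agent whose load equals its number of turns cannot gain from an agent that has not had a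
later turn. -/
theorem noGain (h : Greedy W o t l) {x k : ι} (hxk : x ≠ k) (hk : load o k = l + (t k).toNat) :
    NoGain (load o) x k := by
  have hx := h.load_le x
  rcases hxk.lt_or_gt with hlt | hlt
  · by_cases hle : load o x ≤ load o k
    · exact Or.inl hle
    · refine Or.inr ⟨?_, hlt⟩
      have := Bool.toNat_le (t x)
      omega
  · left
    cases htx : t x
    · simp [htx] at hx
      omega
    · have := h.initial k x hlt htx
      simp [htx] at hx
      simp [this] at hk
      omega

/-- An agent that got a good at each of its turns is certified by the set of all agents, which is
closed once no valued good is free. The others bring their own certificates. -/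
theorem balanced [Fintype ι] (h : Greedy W o t l) (hc : ∀ k g, W k g → o g ≠ none) :
    Balanced W o := by
  refine ⟨h.nonWasteful, fun k => ?_⟩
  rcases h.load_eq_or k with hk | hk
  · refine ⟨univ, mem_univ k, fun x _ g hg => ?_, fun x _ hx => h.noGain hx hk⟩
    obtain ⟨y, hy⟩ := Option.ne_none_iff_exists'.1 (hc x g hg)
    exact ⟨y, mem_univ y, hy⟩
  · exact hk

theorem nextRound (h : Greedy W o t l) (ht : ∀ k, t k = true) :
    Greedy W o (fun _ => false) (l + 1) where
  nonWasteful := h.nonWasteful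
  initial := by intro i j _ h; simp at h
  load_le k := by simpa [ht k] using h.load_le k
  load_eq_or k := by simpa [ht k] using h.load_eq_or k

/-- A free good valued by `k` rules out a closed set containing `k`, so `k` got a good at every turn
and owns at least `l` goods. -/
theorem le_card (h : Greedy W o t l) {k : ι} {g : γ} (hW : W k g) (hg : o g = none) :
    l ≤ Fintype.card γ := by
  rcases h.load_eq_or k with hk | ⟨R, hkR, hR, -⟩
  · have := load_le_card o k
    omega
  · obtain ⟨x, -, hx⟩ := hR k hkR g hW
    rw [hg] at hx
    simp at hx

theorem initial_update (h : Greedy W o t l) {i : ι} (hlt : ∀ x < i, t x = true) :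
    ∀ a b, a < b → Function.update t i true b = true → Function.update t i true a = true := by
  intro a b hab hb
  by_cases ha : a = i
  · simp [ha]
  · rw [Function.update_of_ne ha]
    by_cases hb' : b = i
    · exact hlt a (hb' ▸ hab)
    · rw [Function.update_of_ne hb'] at hb
      exact h.initial a b hab hb

/-- If `i` got a good at each earlier turn, `noGain` for the count without the present turn makes
`R` a certificate; otherwise `i` already has one. -/
theorem fail (h : Greedy W o t l) {i : ι} (hi : t i = false) (hlt : ∀ x < i, t x = true)
    {R : Finset ι} (hiR : i ∈ R) (hR : ClosedFor W o R) :
    Greedy W o (Function.update t i true) l where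
  nonWasteful := h.nonWasteful
  initial := h.initial_update hlt
  load_le k := by
    refine (h.load_le k).trans ?_
    by_cases hk : k = i
    · simp [hk, hi]
    · simp [hk]
  load_eq_or k := by
    by_cases hk : k = i
    · subst hk
      right
      rcases h.load_eq_or k with hk | hk
      · exact ⟨R, hiR, hR, fun x _ hx => h.noGain hx hk⟩
      · exact hk
    · rw [Function.update_of_ne hk]
      exact h.load_eq_or k

/-- A closed set owns every good it values, so its total load is the largest that a non-wasteful map
allows. The extra unit therefore goes to an agent outside `R`, and the unchanged total shows that
`R` is still closed. -/
theorem closedFor_of_load {o' : γ → Option ι} (ho : NonWasteful W o) (ho' : NonWasteful W o')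
    {i : ι} (hload : ∀ z, load o' z = load o z + if z = i then 1 else 0) {R : Finset ι}
    (hR : ClosedFor W o R) : i ∉ R ∧ ClosedFor W o' R := by
  classical
  have hsum := (closedFor_iff ho R).1 hR
  have hle := sum_load_le ho' R
  have heq : ∑ k ∈ R, load o' k = ∑ k ∈ R, load o k + if i ∈ R then 1 else 0 := by
    simp_rw [hload, sum_add_distrib]
    congr 1
    rw [sum_ite_eq']
  have hi : i ∉ R := by
    intro hi
    rw [if_pos hi] at heq
    omega
  refine ⟨hi, (closedFor_iff ho' R).2 ?_⟩
  rw [heq, if_neg hi, hsum, add_zero]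

/-- Certificates persist: their sets stay closed and the loads in them do not change. An agent
without one had a load equal to its number of turns, and both numbers rise together. -/
theorem success (h : Greedy W o t l) {i : ι} (hi : t i = false) (hlt : ∀ x < i, t x = true)
    {o' : γ → Option ι} (ho' : NonWasteful W o')
    (hload : ∀ z, load o' z = load o z + if z = i then 1 else 0) :
    Greedy W o' (Function.update t i true) l where
  nonWasteful := ho'
  initial := h.initial_update hlt
  load_le k := by
    have := h.load_le k
    rw [hload]
    by_cases hk : k = i
    · subst hk
      simp [hi] at this ⊢
      omega
    · simpa [hk] using this
  load_eq_or k := by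
    rcases h.load_eq_or k with hk | ⟨R, hkR, hR, hno⟩
    · left
      rw [hload]
      by_cases hki : k = i
      · subst hki
        simp [hi] at hk ⊢
        omega
      · simpa [hki] using hk
    · right
      obtain ⟨hiR, hR'⟩ := closedFor_of_load h.nonWasteful ho' hload hR
      refine ⟨R, hkR, hR', fun x hx hxk => ?_⟩
      have h1 : load o' x = load o x := by
        rw [hload, if_neg (fun e : x = i => hiR (e ▸ hx)), add_zero]
      have h2 : load o' k = load o k := by
        rw [hload, if_neg (fun e : k = i => hiR (e ▸ hkR)), add_zero]
      have := hno x hx hxk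
      unfold NoGain at this ⊢
      rwa [h1, h2]

end Greedy

end Greedy

end FairDivision

namespace FairDivision

open Sweeper

/-! ### The sweep machine for the greedy rounds -/

/-- A matrix cell: the agent values the good (`v`), owns it (`a`), may take it next (`x`). -/
structure Cell where
  v : Bool
  a : Bool
  x : Bool

/-- The mark of an agent: it has had its turn (`t`), it has been reached by the search (`d`), it has
to take a good (`c`). -/
structure Mark where
  t : Bool
  d : Bool
  c : Bool

/-- The auxiliary cell of a good: it is free (`f`), it is free or its owner has been reached by the
search (`ok`), it has just been taken (`cur`). -/
structure Aux where
  f : Bool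
  ok : Bool
  cur : Bool

/-- What the current round does. -/
inductive Mode
  | reset (clear : Bool)
  | search (first : Bool)
  | turn
  | walk
  | halt

/-- The states: `par` tells the second pass of a round from the first, `act` says whether the
current row is to be rewritten, `glob` whether some row has been rewritten in this round. -/
structure State where
  mode : Mode
  par : Bool
  act : Bool
  glob : Bool

instance : Finite Cell :=
  Finite.of_injective (fun x : Cell => (x.v, x.a, x.x)) (by
    rintro ⟨⟩ ⟨⟩ h
    simpa using h)

instance : Finite Mark :=
  Finite.of_injective (fun x : Mark => (x.t, x.d, x.c)) (by
    rintro ⟨⟩ ⟨⟩ h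
    simpa using h)

instance : Finite Aux :=
  Finite.of_injective (fun x : Aux => (x.f, x.ok, x.cur)) (by
    rintro ⟨⟩ ⟨⟩ h
    simpa using h)

instance : Finite Mode :=
  Finite.of_surjective
    (fun x : Fin 5 × Bool => match x with
      | (0, b) => Mode.reset b
      | (1, b) => Mode.search b
      | (2, _) => Mode.turn
      | (3, _) => Mode.walk
      | (4, _) => Mode.halt)
    (by
      rintro (b | b | _ | _ | _)
      exacts [⟨(0, b), rfl⟩, ⟨(1, b), rfl⟩, ⟨(2, true), rfl⟩, ⟨(3, true), rfl⟩, ⟨(4, true), rfl⟩])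

instance : Finite State :=
  Finite.of_injective (fun x : State => (x.mode, x.par, x.act, x.glob)) (by
    rintro ⟨⟩ ⟨⟩ h
    simpa using h)

namespace Mode

/-- The test on a cell and the auxiliary cell in its column. -/
def test (mode : Mode) (par : Bool) (x : Cell) (y : Aux) : Bool :=
  match mode with
  | .reset _ => false
  | .search _ => x.v && y.ok
  | .turn => par && x.a && y.cur && !x.x
  | .walk => par && x.a && y.cur && !x.x
  | .halt => false

/-- The step at the end of a row whose test gave `e`. -/
def sep (s : State) (e : Bool) (z : Mark) : State × Mark :=
  match s.mode, s.par with
  | .reset b, _ => (s, { t := z.t && !b, d := false, c := false })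
  | .search _, _ =>
    ({ s with act := e && !z.d, glob := s.glob || (e && !z.d) }, { z with d := z.d || e })
  | .turn, false =>
    ({ s with act := !s.glob && !z.t, glob := s.glob || (!s.glob && !z.t) },
      { z with t := z.t || !s.glob })
  | .walk, false => ({ s with act := z.c, glob := s.glob || z.c }, z)
  | .turn, true => ({ s with act := s.glob }, { z with c := e && s.glob })
  | .walk, true => ({ s with act := s.glob }, { z with c := e && s.glob })
  | .halt, _ => (s, z)

/-- The rewriting of a cell and of the auxiliary cell in its column. -/
def write (s : State) (sel : Bool) (x : Cell) (y : Aux) : Cell × Aux :=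
  match s.mode, s.par, s.act with
  | .reset _, _, _ => ({ x with x := false }, { y with ok := y.f })
  | .search _, _, true => ({ x with x := x.v && y.ok }, { y with ok := y.ok || x.a })
  | .turn, false, true => ({ x with a := x.a || sel }, { y with cur := sel, f := y.f && !sel })
  | .walk, false, true => ({ x with a := x.a || sel }, { y with cur := sel, f := y.f && !sel })
  | .turn, true, true => ({ x with a := x.a && (!y.cur || x.x) }, y)
  | .walk, true, true => ({ x with a := x.a && (!y.cur || x.x) }, y)
  | _, _, _ => (x, y)

/-- The mode of the next round. -/
def next (mode : Mode) (glob : Bool) : Mode :=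
  match mode, glob with
  | .reset _, _ => .search true
  | .search _, true => .search false
  | .search true, false => .halt
  | .search false, false => .turn
  | .turn, true => .walk
  | .turn, false => .reset true
  | .walk, true => .walk
  | .walk, false => .reset false
  | .halt, _ => .halt

end Mode

/-- The sweep machine that computes `MNW^tie`. -/
def greedySweeper : Sweeper State Cell Mark Aux where
  start := ⟨.reset false, false, false, false⟩
  cell b := ⟨b, false, false⟩
  mark := ⟨false, false, false⟩
  aux := ⟨true, true, false⟩
  bit x := x.a
  test s := s.mode.test s.par
  sep := Mode.sep
  pick _ x := x.x
  write := Mode.write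
  finish s := match s.par with
    | false => ⟨s.mode, true, false, s.glob⟩
    | true => ⟨s.mode.next s.glob, false, false, false⟩
  halted s := match s.mode with
    | .halt => true
    | _ => false

/-- Configurations of the machine on an instance with `n` agents and `m` goods. -/
abbrev GConf (n m : ℕ) : Type := Conf State Cell Mark Aux n m

variable {n m : ℕ}

/-- The configuration represents the values `W`, the owner map `o` and the turns `t`. -/
structure Base (W : Fin n → Fin m → Prop) (o : Fin m → Option (Fin n)) (t : Fin n → Bool)
    (c : GConf n m) : Prop where
  v : ∀ k g, (c.X k g).v = true ↔ W k g
  a : ∀ k g, (c.X k g).a = true ↔ o g = some k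
  f : ∀ g, (c.Y g).f = true ↔ o g = none
  t : ∀ k, (c.Z k).t = t k

open Finset in
/-- The invariant of the search for agents that can get one more good. -/
structure Search (W : Fin n → Fin m → Prop) (o : Fin m → Option (Fin n)) (t : Fin n → Bool)
    (rank : Fin n → ℕ) (c : GConf n m) : Prop extends Base W o t c where
  d : ∀ k, (c.Z k).d = true ↔ ∃ g, (c.X k g).x = true
  -- With no agents a pass visits no row and leaves the auxiliary row as it was; the property is
  -- therefore required only in the presence of an agent.
  ok : Fin n → ∀ g, (c.Y g).ok = true ↔ o g = none ∨ ∃ k, o g = some k ∧ (c.Z k).d = true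
  x : ∀ k g, (c.X k g).x = true →
    W k g ∧ (o g = none ∨ ∃ k', o g = some k' ∧ (c.Z k').d = true ∧ rank k' < rank k)
  rank_lt : ∀ k, (c.Z k).d = true → rank k < #{x | (c.Z x).d = true}

theorem greedy_test (s : State) (x : Cell) (y : Aux) :
    greedySweeper.test s x y = s.mode.test s.par x y := rfl

/-! #### Reset -/

theorem base_reset {W : Fin n → Fin m → Prop} {o : Fin m → Option (Fin n)} {t : Fin n → Bool}
    {b par : Bool} (ks : List (Fin n)) (hmem : ∀ k, k ∈ ks)
    {c : GConf n m} (h : Base W o t c) (hs : c.s = ⟨.reset b, par, false, false⟩) :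
    (ks.foldl greedySweeper.visit c).s = ⟨.reset b, par, false, false⟩ ∧
    Search W o (fun k => t k && !b) 0 (ks.foldl greedySweeper.visit c) ∧
    ∀ k, ((ks.foldl greedySweeper.visit c).Z k).d = false := by
  have key := foldl_visit_induction (M := greedySweeper)
    (I := fun pre c' => c'.s = ⟨.reset b, par, false, false⟩ ∧
      (∀ k g, (c'.X k g).v = (c.X k g).v ∧ (c'.X k g).a = (c.X k g).a) ∧
      (∀ g, (c'.Y g).f = (c.Y g).f) ∧ (pre ≠ [] → ∀ g, (c'.Y g).ok = (c.Y g).f) ∧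
      (∀ k ∈ pre, (∀ g, (c'.X k g).x = false) ∧ c'.Z k = ⟨t k && !b, false, false⟩) ∧
      -- Clearing a turn twice is the same as clearing it once, so the visit of a row need not know
      -- whether the row was visited before.
      ∀ k, (c'.Z k).t = t k ∨ (c'.Z k).t = (t k && !b)) ks (c := c)
    ⟨hs, fun _ _ => ⟨rfl, rfl⟩, fun _ => rfl, fun h => absurd rfl h, by simp, fun k => Or.inl (h.t k)⟩
    (by
      rintro pre k post c' - ⟨h1, h2, h3, h4, h5, h6⟩
      have hsep : greedySweeper.sepAt c' k =
          (⟨.reset b, par, false, false⟩, ⟨t k && !b, false, false⟩) := by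
        rcases h6 k with h6 | h6 <;> simp [sepAt, greedySweeper, Mode.sep, h1, h6]
      have hwr : ∀ g, greedySweeper.writeAt c' k g =
          (⟨(c'.X k g).v, (c'.X k g).a, false⟩, ⟨(c'.Y g).f, (c'.Y g).f, (c'.Y g).cur⟩) := by
        intro g
        rw [writeAt, hsep]
        rfl
      refine ⟨by simp [visit, hsep], fun x g => ?_, fun g => ?_, fun _ g => ?_, fun x hx => ?_,
        fun x => ?_⟩
      · by_cases hx : x = k
        · subst hx; simpa [visit, hwr] using h2 x g
        · simpa [visit, hx] using h2 x g
      · simpa [visit, hwr] using h3 g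
      · simpa [visit, hwr] using h3 g
      · by_cases hxk : x = k
        · subst hxk; simp [visit, hwr, hsep]
        · have : x ∈ pre := by simpa [hxk] using hx
          simpa [visit, hxk] using h5 x this
      · by_cases hxk : x = k
        · subst hxk; simp [visit, hsep]
        · simpa [visit, hxk] using h6 x)
  obtain ⟨h1, h2, h3, h4, h5, -⟩ := key
  set c' := ks.foldl greedySweeper.visit c
  have hd : ∀ k, (c'.Z k).d = false := fun k => by rw [(h5 k (hmem k)).2]
  have hx : ∀ k g, (c'.X k g).x = false := fun k => (h5 k (hmem k)).1
  refine ⟨h1, ⟨⟨?_, ?_, ?_, ?_⟩, ?_, ?_, ?_, ?_⟩, hd⟩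
  · intro k g; rw [(h2 k g).1, h.v]
  · intro k g; rw [(h2 k g).2, h.a]
  · intro g; rw [h3, h.f]
  · intro k; rw [(h5 k (hmem k)).2]
  · intro k; simp [hd, hx]
  · intro k g
    rw [h4 (List.ne_nil_of_mem (hmem k)), h.f]
    simp [hd]
  · intro k g hxk; simp [hx] at hxk
  · intro k hk; simp [hd] at hk

theorem reset_round {W : Fin n → Fin m → Prop} {o : Fin m → Option (Fin n)} {t : Fin n → Bool}
    {b : Bool} {c : GConf n m} (h : Base W o t c) (hs : c.s = ⟨.reset b, false, false, false⟩) :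
    (greedySweeper.roundConf c).s = ⟨.search true, false, false, false⟩ ∧
    Search W o (fun k => t k && !b) 0 (greedySweeper.roundConf c) ∧
    ∀ k, ((greedySweeper.roundConf c).Z k).d = false := by
  obtain ⟨h1, h2, h3⟩ := base_reset (List.finRange n) List.mem_finRange h hs
  set c₁ := greedySweeper.passConf c (List.finRange n) with hc₁
  have hs₁ : c₁.s = ⟨.reset b, true, false, false⟩ := by
    simp only [hc₁, passConf, h1]; rfl
  have hb₁ : Base W o (fun k => t k && !b) c₁ := ⟨h2.v, h2.a, h2.f, h2.t⟩
  obtain ⟨g1, g2, g3⟩ := base_reset (List.finRange n).reverse (by simp) hb₁ hs₁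
  refine ⟨?_, ?_, g3⟩
  · simp only [roundConf, ← hc₁]
    rw [passConf, g1]
    rfl
  · have : (fun k => (t k && !b) && !b) = fun k => t k && !b := by
      funext k; cases b <;> simp
    rw [this] at g2
    exact ⟨⟨g2.v, g2.a, g2.f, g2.t⟩, g2.d, g2.ok, g2.x, g2.rank_lt⟩

end FairDivision

namespace FairDivision

open Sweeper Finset

variable {n m : ℕ}

/-! #### Search -/

/-- The number of agents reached by the search. -/
def reached (c : GConf n m) : ℕ := #{x | (c.Z x).d = true}

/-- The search has come to an end. -/
def Stuck (W : Fin n → Fin m → Prop) (c : GConf n m) (k : Fin n) : Prop :=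
  (c.Z k).d = true ∨ ∀ g, W k g → (c.Y g).ok = false

theorem Search.visit_old {W : Fin n → Fin m → Prop} {o : Fin m → Option (Fin n)} {t : Fin n → Bool}
    {rank : Fin n → ℕ} {c : GConf n m} (h : Search W o t rank c) {b : Bool}
    (hs : c.s.mode = .search b) {k : Fin n} (hk : Stuck W c k) :
    greedySweeper.visit c k = { c with s := { c.s with act := false } } := by
  obtain ⟨⟨mode, par, act, glob⟩, X, Z, Y⟩ := c
  dsimp only at hs
  subst hs
  have hsep : greedySweeper.sepAt (⟨⟨.search b, par, act, glob⟩, X, Z, Y⟩ : GConf n m) k =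
      (⟨.search b, par, false, glob⟩, Z k) := by
    unfold sepAt
    by_cases he : ∃ g, greedySweeper.test (⟨.search b, par, act, glob⟩ : State) (X k g) (Y g) = true
    · have hd : (Z k).d = true := by
        obtain ⟨g, hg⟩ := he
        simp only [greedy_test, Mode.test, Bool.and_eq_true] at hg
        rcases hk with hk | hk
        · exact hk
        · have h1 := hk g ((h.v k g).1 hg.1)
          have h2 := hg.2
          dsimp only at h1
          rw [h1] at h2
          exact absurd h2 (by simp)
      simp only [he, decide_true]
      generalize Z k = z at hd
      obtain ⟨zt, zd, zc⟩ := z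
      dsimp only at hd
      subst hd
      simp [greedySweeper, Mode.sep]
    · simp only [he, decide_false]
      simp [greedySweeper, Mode.sep]
  simp only [visit, writeAt, hsep]
  congr 1
  · exact Function.update_eq_self k X
  · exact Function.update_eq_self k Z

/-- The rank of an agent is the number of agents reached before it. Marks are set from the old
values of `ok`, so a marked good is free or owned by an agent of smaller rank; only afterwards do
the agent's own goods become available. -/
theorem Search.visit_new {W : Fin n → Fin m → Prop} {o : Fin m → Option (Fin n)} {t : Fin n → Bool}
    {rank : Fin n → ℕ} {c : GConf n m} (h : Search W o t rank c) {b : Bool}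
    (hs : c.s.mode = .search b) {k : Fin n} (hk : ¬ Stuck W c k) :
    (greedySweeper.visit c k).s = { c.s with act := true, glob := true } ∧
    reached (greedySweeper.visit c k) = reached c + 1 ∧
    Search W o t (Function.update rank k (reached c)) (greedySweeper.visit c k) := by
  simp only [Stuck, not_or, not_forall, Bool.not_eq_true, Bool.not_eq_false] at hk
  obtain ⟨hkd, g₀, hW₀, hok₀⟩ := hk
  have htest : decide (∃ g, greedySweeper.test c.s (c.X k g) (c.Y g) = true) = true := by
    rw [decide_eq_true_eq]
    refine ⟨g₀, ?_⟩
    simp [greedy_test, Mode.test, hs, hok₀, (h.v k g₀).2 hW₀]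
  have hsep : greedySweeper.sepAt c k =
      ({ c.s with act := true, glob := true }, { c.Z k with d := true }) := by
    rw [sepAt, htest]
    simp [greedySweeper, Mode.sep, hs, hkd]
  have hwr : ∀ g, greedySweeper.writeAt c k g =
      ({ c.X k g with x := (c.X k g).v && (c.Y g).ok },
        { c.Y g with ok := (c.Y g).ok || (c.X k g).a }) := by
    intro g
    rw [writeAt, hsep]
    simp [greedySweeper, Mode.write, hs]
  have hZ : ∀ x, ((greedySweeper.visit c k).Z x).d = true ↔ x = k ∨ (c.Z x).d = true := by
    intro x
    by_cases hx : x = k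
    · subst hx; simp [visit, hsep]
    · simp [visit, hx]
  have hreach : reached (greedySweeper.visit c k) = reached c + 1 := by
    have : ({x | ((greedySweeper.visit c k).Z x).d = true} : Finset (Fin n)) =
        insert k ({x | (c.Z x).d = true} : Finset (Fin n)) := by
      ext x; simp [hZ]
    rw [reached, this, card_insert_of_notMem (by simp [hkd])]
    rfl
  refine ⟨by simp [visit, hsep], hreach, ⟨⟨?_, ?_, ?_, ?_⟩, ?_, ?_, ?_, ?_⟩⟩
  · intro x g
    by_cases hx : x = k
    · subst hx; simpa [visit, hwr] using h.v x g
    · simpa [visit, hx] using h.v x g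
  · intro x g
    by_cases hx : x = k
    · subst hx; simpa [visit, hwr] using h.a x g
    · simpa [visit, hx] using h.a x g
  · intro g
    simpa [visit, hwr] using h.f g
  · intro x
    by_cases hx : x = k
    · subst hx; simpa [visit, hsep] using h.t x
    · simpa [visit, hx] using h.t x
  · intro x
    rw [hZ]
    by_cases hx : x = k
    · subst hx
      simp only [true_or, true_iff]
      refine ⟨g₀, ?_⟩
      simp [visit, hwr, hok₀, (h.v x g₀).2 hW₀]
    · simpa [visit, hx] using h.d x
  · intro _ g
    simp only [hZ]
    have : ((greedySweeper.visit c k).Y g).ok = ((c.Y g).ok || (c.X k g).a) := by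
      simp [visit, hwr]
    rw [this, Bool.or_eq_true, h.ok k, h.a]
    constructor
    · rintro ((h' | ⟨x, h', h''⟩) | h')
      · exact Or.inl h'
      · exact Or.inr ⟨x, h', Or.inr h''⟩
      · exact Or.inr ⟨k, h', Or.inl rfl⟩
    · rintro (h' | ⟨x, h', rfl | h''⟩)
      · exact Or.inl (Or.inl h')
      · exact Or.inr h'
      · exact Or.inl (Or.inr ⟨x, h', h''⟩)
  · intro x g hxg
    by_cases hx : x = k
    · subst hx
      have : (c.X x g).v = true ∧ (c.Y g).ok = true := by
        simpa [visit, hwr] using hxg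
      rw [h.v, h.ok x] at this
      refine ⟨this.1, this.2.imp id ?_⟩
      rintro ⟨y, hy, hyd⟩
      have hyx : y ≠ x := by
        rintro rfl
        rw [hkd] at hyd
        exact absurd hyd (by simp)
      refine ⟨y, hy, (hZ y).2 (Or.inr hyd), ?_⟩
      rw [Function.update_self, Function.update_of_ne hyx]
      exact h.rank_lt y hyd
    · have hxg' : (c.X x g).x = true := by simpa [visit, hx] using hxg
      obtain ⟨h1, h2⟩ := h.x x g hxg'
      refine ⟨h1, h2.imp id ?_⟩
      rintro ⟨y, hy, hyd, hlt⟩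
      have hyx : y ≠ k := by
        rintro rfl
        rw [hkd] at hyd
        exact absurd hyd (by simp)
      refine ⟨y, hy, (hZ y).2 (Or.inr hyd), ?_⟩
      rwa [Function.update_of_ne hx, Function.update_of_ne hyx]
  · intro x hx
    change _ < reached _
    rw [hreach]
    by_cases hxk : x = k
    · subst hxk; simp
    · rw [Function.update_of_ne hxk]
      have := h.rank_lt x (((hZ x).1 hx).resolve_left hxk)
      exact this.trans (Nat.lt_succ_self _)

/-- As long as `glob` is false, every visited row was stuck and nothing relevant has changed, so
rows found stuck early in the pass are still stuck at its end. -/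
theorem search_pass {W : Fin n → Fin m → Prop} {o : Fin m → Option (Fin n)} {t : Fin n → Bool}
    {rank : Fin n → ℕ} {c : GConf n m} (h : Search W o t rank c) {b par : Bool}
    (hs : c.s.mode = .search b) (hp : c.s.par = par) (ks : List (Fin n)) (hmem : ∀ k, k ∈ ks) :
    ∃ rank', Search W o t rank' (ks.foldl greedySweeper.visit c) ∧
      (ks.foldl greedySweeper.visit c).s.mode = .search b ∧
      (ks.foldl greedySweeper.visit c).s.par = par ∧
      reached c ≤ reached (ks.foldl greedySweeper.visit c) ∧
      (c.s.glob = true → (ks.foldl greedySweeper.visit c).s.glob = true) ∧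
      ((ks.foldl greedySweeper.visit c).s.glob = true →
        c.s.glob = true ∨ reached c < reached (ks.foldl greedySweeper.visit c)) ∧
      ((ks.foldl greedySweeper.visit c).s.glob = false →
        (ks.foldl greedySweeper.visit c).Z = c.Z ∧
        ∀ k, Stuck W (ks.foldl greedySweeper.visit c) k) := by
  obtain ⟨r, h1, h2, h3, h4, h5, h6, h7⟩ := foldl_visit_induction (M := greedySweeper)
    (I := fun pre c' => ∃ rank', Search W o t rank' c' ∧ c'.s.mode = .search b ∧ c'.s.par = par ∧
      reached c ≤ reached c' ∧ (c.s.glob = true → c'.s.glob = true) ∧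
      (c'.s.glob = true → c.s.glob = true ∨ reached c < reached c') ∧
      (c'.s.glob = false → c'.Z = c.Z ∧ ∀ k ∈ pre, Stuck W c' k)) ks (c := c)
    ⟨rank, h, hs, hp, le_rfl, id, Or.inl, fun _ => ⟨rfl, by simp⟩⟩
    (by
      rintro pre k post c' - ⟨r, h1, h2, h3, h4, h5, h6, h7⟩
      by_cases hk : Stuck W c' k
      · rw [h1.visit_old h2 hk]
        refine ⟨r, ⟨⟨h1.v, h1.a, h1.f, h1.t⟩, h1.d, h1.ok, h1.x, h1.rank_lt⟩, h2, h3, h4, h5, h6,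
          fun hg => ⟨(h7 hg).1, ?_⟩⟩
        intro x hx
        rcases List.mem_append.1 hx with hx | hx
        · exact (h7 hg).2 x hx
        · rw [List.mem_singleton] at hx
          subst hx
          exact hk
      · obtain ⟨g1, g2, g3⟩ := h1.visit_new h2 hk
        refine ⟨_, g3, by rw [g1]; exact h2, by rw [g1]; exact h3, by omega, ?_, ?_, ?_⟩
        · intro _; rw [g1]
        · intro _; right; omega
        · intro hg
          rw [g1] at hg
          exact absurd hg (by simp))
  exact ⟨r, h1, h2, h3, h4, h5, h6, fun hg => ⟨(h7 hg).1, fun k => (h7 hg).2 k (hmem k)⟩⟩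

/-- If neither pass reaches anybody, the search is complete. In mode `.search true`, that of the
first search round after a reset, this means that no agent can get another good, and the machine
halts; in a later round a turn follows. -/
theorem search_round {W : Fin n → Fin m → Prop} {o : Fin m → Option (Fin n)} {t : Fin n → Bool}
    {rank : Fin n → ℕ} {c : GConf n m} (h : Search W o t rank c) {b : Bool}
    (hs : c.s = ⟨.search b, false, false, false⟩) :
    ∃ rank', Search W o t rank' (greedySweeper.roundConf c) ∧
      ((greedySweeper.roundConf c).s = ⟨.search false, false, false, false⟩ ∧
        reached c < reached (greedySweeper.roundConf c) ∨
      (greedySweeper.roundConf c).s = ⟨bif b then .halt else .turn, false, false, false⟩ ∧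
        (greedySweeper.roundConf c).Z = c.Z ∧ ∀ k, Stuck W (greedySweeper.roundConf c) k) := by
  obtain ⟨r₁, h1, h2, h3, h4, -, h6, h7⟩ := search_pass h (b := b) (par := false)
    (by rw [hs]) (by rw [hs]) (List.finRange n) List.mem_finRange
  have hfg : c.s.glob = false := by rw [hs]
  set d₁ := (List.finRange n).foldl greedySweeper.visit c with hd₁
  set c₁ := greedySweeper.passConf c (List.finRange n) with hc₁
  have hs₁ : c₁.s = ⟨.search b, true, false, d₁.s.glob⟩ := by
    simp only [hc₁, passConf, ← hd₁]
    simp [greedySweeper, h2, h3]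
  have hb₁ : Search W o t r₁ c₁ := ⟨⟨h1.v, h1.a, h1.f, h1.t⟩, h1.d, h1.ok, h1.x, h1.rank_lt⟩
  have hr₁ : reached c₁ = reached d₁ := rfl
  obtain ⟨r₂, g1, g2, g3, g4, g5, g6, g7⟩ := search_pass hb₁ (b := b) (par := true)
    (by rw [hs₁]) (by rw [hs₁]) (List.finRange n).reverse (by simp)
  set d₂ := (List.finRange n).reverse.foldl greedySweeper.visit c₁ with hd₂
  have hs₂ : (greedySweeper.roundConf c).s = ⟨(Mode.search b).next d₂.s.glob, false, false, false⟩ := by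
    simp only [roundConf, ← hc₁]
    simp only [passConf, ← hd₂]
    simp [greedySweeper, g2, g3]
  have hr₂ : reached (greedySweeper.roundConf c) = reached d₂ := rfl
  have hg₁ : c₁.s.glob = d₁.s.glob := by rw [hs₁]
  refine ⟨r₂, ⟨⟨g1.v, g1.a, g1.f, g1.t⟩, g1.d, g1.ok, g1.x, g1.rank_lt⟩, ?_⟩
  rw [hs₂, hr₂]
  cases hg : d₂.s.glob
  · right
    have hg' : d₁.s.glob = false := by
      by_contra hne
      rw [Bool.not_eq_false] at hne
      rw [g5 (by rw [hg₁, hne])] at hg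
      exact absurd hg (by simp)
    obtain ⟨e1, e2⟩ := g7 hg
    refine ⟨by cases b <;> rfl, ?_, e2⟩
    exact e1.trans (h7 hg').1
  · left
    refine ⟨by cases b <;> rfl, ?_⟩
    rcases g6 hg with hg' | hg'
    · rw [hg₁] at hg'
      rcases h6 hg' with h' | h'
      · rw [hfg] at h'
        exact absurd h' (by simp)
      · exact h'.trans_le (hr₁ ▸ g4)
    · rw [hr₁] at hg'
      exact h4.trans_lt hg'

theorem reached_le (c : GConf n m) : reached c ≤ n := by
  simpa [reached] using card_le_univ ({x | (c.Z x).d = true} : Finset (Fin n))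

/-- From the second search round on, the search ends after at most `n + 1` rounds. -/
theorem search_rounds {W : Fin n → Fin m → Prop} {o : Fin m → Option (Fin n)} {t : Fin n → Bool}
    (K : ℕ) {rank : Fin n → ℕ} {c : GConf n m} (h : Search W o t rank c)
    (hs : c.s = ⟨.search false, false, false, false⟩) (hK : n ≤ reached c + K) :
    ∃ r ≤ K + 1, ∃ c' rank', RoundsConf greedySweeper r c c' ∧ Search W o t rank' c' ∧
      c'.s = ⟨.turn, false, false, false⟩ ∧ (∀ k, Stuck W c' k) ∧ reached c ≤ reached c' := by
  induction K generalizing c rank with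
  | zero =>
    obtain ⟨r, h1, ⟨h2, h3⟩ | ⟨h2, h3, h4⟩⟩ := search_round h hs
    · have := reached_le (greedySweeper.roundConf c)
      omega
    · refine ⟨1, le_rfl, _, r, .single ?_, h1, h2, h4, ?_⟩
      · rw [h2]; rfl
      · rw [reached, reached, h3]
  | succ K ih =>
    obtain ⟨r, h1, ⟨h2, h3⟩ | ⟨h2, h3, h4⟩⟩ := search_round h hs
    · obtain ⟨r', hr', c', rank', g1, g2, g3, g4, g5⟩ := ih h1 h2 (by omega)
      refine ⟨r' + 1, by omega, c', rank', .head ?_ g1, g2, g3, g4, by omega⟩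
      rw [h2]; rfl
    · refine ⟨1, by omega, _, r, .single ?_, h1, h2, h4, ?_⟩
      · rw [h2]; rfl
      · rw [reached, reached, h3]

end FairDivision

namespace FairDivision

open Sweeper Finset

variable {n m : ℕ}

/-! #### Taking goods -/

/-- From `c` to `c'` agent `i` has taken the good `g₀`, if there is one that it may take. -/
structure Took (c : GConf n m) (i : Fin n) (g₀ : Option (Fin m)) (c' : GConf n m) : Prop where
  v : ∀ k g, (c'.X k g).v = (c.X k g).v
  x : ∀ k g, (c'.X k g).x = (c.X k g).x
  a : ∀ k g, (c'.X k g).a = true ↔ (c.X k g).a = true ∨ k = i ∧ g₀ = some g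
  cur : ∀ g, (c'.Y g).cur = true ↔ g₀ = some g
  f : ∀ g, (c'.Y g).f = true ↔ (c.Y g).f = true ∧ g₀ ≠ some g
  some_x : ∀ g, g₀ = some g → (c.X i g).x = true
  none_x : g₀ = none → ∀ g, (c.X i g).x = false

theorem exists_selAt (c : GConf n m) (s : State) (i : Fin n) :
    ∃ g₀ : Option (Fin m), (∀ g, greedySweeper.selAt c s i g = true ↔ g₀ = some g) ∧
      (∀ g, g₀ = some g → (c.X i g).x = true) ∧ (g₀ = none → ∀ g, (c.X i g).x = false) := by
  by_cases h : ∃ g, (c.X i g).x = true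
  · have hne : ({g | (c.X i g).x = true} : Finset (Fin m)).Nonempty := by
      obtain ⟨g, hg⟩ := h
      exact ⟨g, by simpa using hg⟩
    have hmax := max'_mem _ hne
    set g₀ := ({g | (c.X i g).x = true} : Finset (Fin m)).max' hne with hg₀
    have hx : (c.X i g₀).x = true := by simpa using hmax
    have hlt : ∀ g, g₀ < g → (c.X i g).x = false := by
      intro g hg
      by_contra hcon
      rw [Bool.not_eq_false] at hcon
      exact absurd (le_max' _ g (by simpa using hcon)) (not_le.2 hg)
    refine ⟨some g₀, fun g => ?_, fun g hg => Option.some.inj hg ▸ hx, fun h => by simp at h⟩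
    simp only [selAt, decide_eq_true_eq, Option.some.injEq]
    change ((c.X i g).x = true ∧ ∀ g', g < g' → (c.X i g').x = false) ↔ g₀ = g
    constructor
    · rintro ⟨h1, h2⟩
      rcases lt_trichotomy g₀ g with h' | h' | h'
      · rw [hlt g h'] at h1
        exact absurd h1 (by simp)
      · exact h'
      · have := h2 g₀ h'
        rw [hx] at this
        exact absurd this (by simp)
    · rintro rfl
      exact ⟨hx, hlt⟩
  · simp only [not_exists, Bool.not_eq_true] at h
    refine ⟨none, fun g => ?_, fun g hg => by simp at hg, fun _ => h⟩
    simp only [selAt, decide_eq_true_eq, reduceCtorEq, iff_false, not_and]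
    intro hg
    change (c.X i g).x = true at hg
    rw [h g] at hg
    exact absurd hg (by simp)

theorem visit_take {c : GConf n m} {i : Fin n}
    (hm : (greedySweeper.sepAt c i).1.mode = .turn ∨ (greedySweeper.sepAt c i).1.mode = .walk)
    (hp : (greedySweeper.sepAt c i).1.par = false) (ha : (greedySweeper.sepAt c i).1.act = true) :
    ∃ g₀, Took c i g₀ (greedySweeper.visit c i) := by
  obtain ⟨g₀, h1, h2, h3⟩ := exists_selAt c (greedySweeper.sepAt c i).1 i
  have hwr : ∀ g, greedySweeper.writeAt c i g =
      ({ c.X i g with a := (c.X i g).a || greedySweeper.selAt c (greedySweeper.sepAt c i).1 i g },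
        { c.Y g with
          cur := greedySweeper.selAt c (greedySweeper.sepAt c i).1 i g
          f := (c.Y g).f && !greedySweeper.selAt c (greedySweeper.sepAt c i).1 i g }) := by
    intro g
    rw [writeAt]
    rcases hm with hm | hm <;> simp [greedySweeper, Mode.write] at hm hp ha ⊢ <;>
      simp [hm, hp, ha]
  refine ⟨g₀, ⟨?_, ?_, ?_, ?_, ?_, h2, h3⟩⟩
  · intro k g
    by_cases hk : k = i
    · subst hk; simp [visit, hwr]
    · simp [visit, hk]
  · intro k g
    by_cases hk : k = i
    · subst hk; simp [visit, hwr]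
    · simp [visit, hk]
  · intro k g
    by_cases hk : k = i
    · subst hk; simp [visit, hwr, h1]
    · simp [visit, hk]
  · intro g
    simp [visit, hwr, h1]
  · intro g
    simp [visit, hwr, ← h1]

theorem visit_skip {c : GConf n m} {i : Fin n}
    (hm : (greedySweeper.sepAt c i).1.mode = .turn ∨ (greedySweeper.sepAt c i).1.mode = .walk)
    (ha : (greedySweeper.sepAt c i).1.act = false) :
    (greedySweeper.visit c i).X = c.X ∧ (greedySweeper.visit c i).Y = c.Y := by
  have hwr : ∀ g, greedySweeper.writeAt c i g = (c.X i g, c.Y g) := by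
    intro g
    rw [writeAt]
    rcases hm with hm | hm <;> simp [greedySweeper, Mode.write] at hm ha ⊢ <;> simp [hm, ha]
  constructor
  · simp [visit, hwr]
  · simp [visit, hwr]

theorem Took.congr {c d c' : GConf n m} {i : Fin n} {g₀ : Option (Fin m)} (h : Took d i g₀ c')
    (hX : d.X = c.X) (hY : d.Y = c.Y) : Took c i g₀ c' := by
  obtain ⟨h1, h2, h3, h4, h5, h6, h7⟩ := h
  rw [hX] at h1 h2 h3 h6 h7
  rw [hY] at h5
  exact ⟨h1, h2, h3, h4, h5, h6, h7⟩

theorem Took.congr_right {c c' d' : GConf n m} {i : Fin n} {g₀ : Option (Fin m)}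
    (h : Took c i g₀ c') (hX : d'.X = c'.X) (hY : d'.Y = c'.Y) : Took c i g₀ d' := by
  obtain ⟨h1, h2, h3, h4, h5, h6, h7⟩ := h
  rw [← hX] at h1 h2 h3
  rw [← hY] at h4 h5
  exact ⟨h1, h2, h3, h4, h5, h6, h7⟩

theorem walk_first_pass {c : GConf n m} {dem : Option (Fin n)}
    (hs : c.s = ⟨.walk, false, false, false⟩) (hc : ∀ k, (c.Z k).c = true ↔ dem = some k) :
    ∀ c', c' = (List.finRange n).foldl greedySweeper.visit c →
      c'.s.mode = .walk ∧ c'.s.par = false ∧ c'.Z = c.Z ∧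
      ((c'.s.glob = false ∧ c'.X = c.X ∧ c'.Y = c.Y ∧ dem = none) ∨
        (c'.s.glob = true ∧ ∃ i, dem = some i ∧ ∃ g₀, Took c i g₀ c')) := by
  rintro _ rfl
  obtain ⟨h1, h2, h3, h4⟩ := foldl_visit_induction (M := greedySweeper)
    (I := fun pre c' => c'.s.mode = .walk ∧ c'.s.par = false ∧ c'.Z = c.Z ∧
      ((c'.s.glob = false ∧ c'.X = c.X ∧ c'.Y = c.Y ∧ ∀ x ∈ pre, dem ≠ some x) ∨
        (c'.s.glob = true ∧ ∃ i ∈ pre, dem = some i ∧ ∃ g₀, Took c i g₀ c')))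
    (List.finRange n) (c := c)
    ⟨by rw [hs], by rw [hs], rfl, Or.inl ⟨by rw [hs], rfl, rfl, by simp⟩⟩
    (by
      rintro pre k post c' hk ⟨h1, h2, h3, h4⟩
      have hkn := notMem_of_append_cons_eq hk (List.nodup_finRange n)
      have hsep : greedySweeper.sepAt c' k = ({ c'.s with
          act := (c'.Z k).c, glob := c'.s.glob || (c'.Z k).c }, c'.Z k) := by
        simp [sepAt, greedySweeper, Mode.sep, h1, h2]
      refine ⟨by simp [visit, hsep, h1], by simp [visit, hsep, h2], by simp [visit, hsep, h3], ?_⟩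
      have hgl : (greedySweeper.visit c' k).s.glob = (c'.s.glob || (c.Z k).c) := by
        simp [visit, hsep, h3]
      cases hck : (c.Z k).c
      · have hdk : dem ≠ some k := fun e => by rw [(hc k).2 e] at hck; exact absurd hck (by simp)
        obtain ⟨e1, e2⟩ := visit_skip (c := c') (i := k) (Or.inr (by rw [hsep]; exact h1))
          (by rw [hsep, h3]; exact hck)
        rw [hck, Bool.or_false] at hgl
        rcases h4 with ⟨a1, a2, a3, a4⟩ | ⟨a1, i, a2, a3, g₀, a4⟩
        · refine Or.inl ⟨hgl.trans a1, e1.trans a2, e2.trans a3, fun x hx => ?_⟩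
          rcases List.mem_append.1 hx with hx | hx
          · exact a4 x hx
          · rw [List.mem_singleton] at hx
            exact hx ▸ hdk
        · exact Or.inr ⟨hgl.trans a1, i, List.mem_append_left _ a2, a3, g₀, a4.congr_right e1 e2⟩
      · have hdk := (hc k).1 hck
        rw [hck, Bool.or_true] at hgl
        rcases h4 with ⟨a1, a2, a3, a4⟩ | ⟨a1, i, a2, a3, g₀, a4⟩
        · obtain ⟨g₀, hg₀⟩ := visit_take (c := c') (i := k) (Or.inr (by rw [hsep]; exact h1))
            (by rw [hsep]; exact h2) (by rw [hsep, h3]; exact hck)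
          exact Or.inr ⟨hgl, k, by simp, hdk, g₀, hg₀.congr a2 a3⟩
        · rw [hdk] at a3
          exact absurd (Option.some.inj a3 ▸ a2) hkn)
  refine ⟨h1, h2, h3, ?_⟩
  rcases h4 with ⟨a1, a2, a3, a4⟩ | ⟨a1, i, a2, a3⟩
  · refine Or.inl ⟨a1, a2, a3, ?_⟩
    rw [Option.eq_none_iff_forall_ne_some]
    exact fun x => a4 x (List.mem_finRange x)
  · exact Or.inr ⟨a1, i, a3⟩

/-- Rows come in index order, and `glob` records that a turn has been given. Thus exactly the first
agent without a turn acts: earlier rows are excluded by `t`, later ones by `glob`. -/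
theorem turn_first_pass {c : GConf n m} {t : Fin n → Bool}
    (hs : c.s = ⟨.turn, false, false, false⟩) (ht : ∀ k, (c.Z k).t = t k) :
    ∀ c', c' = (List.finRange n).foldl greedySweeper.visit c →
      c'.s.mode = .turn ∧ c'.s.par = false ∧
      ((c'.s.glob = false ∧ c'.X = c.X ∧ c'.Y = c.Y ∧ (∀ k, (c'.Z k).t = t k) ∧
          ∀ k, t k = true) ∨
        (c'.s.glob = true ∧ ∃ i, t i = false ∧ (∀ x < i, t x = true) ∧
          (∀ k, (c'.Z k).t = Function.update t i true k) ∧ ∃ g₀, Took c i g₀ c')) := by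
  rintro _ rfl
  obtain ⟨h1, h2, h4⟩ := foldl_visit_induction (M := greedySweeper)
    (I := fun pre c' => c'.s.mode = .turn ∧ c'.s.par = false ∧
      ((c'.s.glob = false ∧ c'.X = c.X ∧ c'.Y = c.Y ∧ (∀ k, (c'.Z k).t = t k) ∧
          ∀ x ∈ pre, t x = true) ∨
        (c'.s.glob = true ∧ ∃ i, t i = false ∧ (∀ x < i, t x = true) ∧
          (∀ k, (c'.Z k).t = Function.update t i true k) ∧ ∃ g₀, Took c i g₀ c')))
    (List.finRange n) (c := c)
    ⟨by rw [hs], by rw [hs], Or.inl ⟨by rw [hs], rfl, rfl, ht, by simp⟩⟩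
    (by
      rintro pre k post c' hk ⟨h1, h2, h4⟩
      have hsep : greedySweeper.sepAt c' k = ({ c'.s with
          act := !c'.s.glob && !(c'.Z k).t, glob := c'.s.glob || (!c'.s.glob && !(c'.Z k).t) },
          { c'.Z k with t := (c'.Z k).t || !c'.s.glob }) := by
        simp [sepAt, greedySweeper, Mode.sep, h1, h2]
      refine ⟨by simp [visit, hsep, h1], by simp [visit, hsep, h2], ?_⟩
      have hgl : (greedySweeper.visit c' k).s.glob =
          (c'.s.glob || (!c'.s.glob && !(c'.Z k).t)) := by
        simp [visit, hsep]
      have hZ : ∀ x, ((greedySweeper.visit c' k).Z x).t =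
          if x = k then ((c'.Z k).t || !c'.s.glob) else (c'.Z x).t := by
        intro x
        by_cases hx : x = k
        · subst hx; simp [visit, hsep]
        · simp [visit, hx]
      rcases h4 with ⟨a1, a2, a3, a4, a5⟩ | ⟨a1, i, a2, a3, a4, g₀, a5⟩
      · cases htk : t k
        · right
          obtain ⟨g₀, hg₀⟩ := visit_take (c := c') (i := k) (Or.inl (by rw [hsep]; exact h1))
            (by rw [hsep]; exact h2) (by simp [hsep, a1, a4, htk])
          refine ⟨by simp [hgl, a1, a4, htk], k, htk, fun x hx =>
            a5 x (mem_of_lt_of_append_cons_eq hk hx), fun x => ?_, g₀, hg₀.congr a2 a3⟩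
          rw [hZ]
          by_cases hx : x = k
          · simp [hx, a1]
          · simp [hx, a4]
        · left
          obtain ⟨e1, e2⟩ := visit_skip (c := c') (i := k) (Or.inl (by rw [hsep]; exact h1))
            (by simp [hsep, a4, htk])
          refine ⟨by simp [hgl, a1, a4, htk], e1.trans a2, e2.trans a3, fun x => ?_, fun x hx => ?_⟩
          · rw [hZ]
            by_cases hx : x = k
            · simp [hx, a4, htk]
            · simp [hx, a4]
          · rcases List.mem_append.1 hx with hx | hx
            · exact a5 x hx
            · rw [List.mem_singleton] at hx
              exact hx ▸ htk
      · right
        obtain ⟨e1, e2⟩ := visit_skip (c := c') (i := k) (Or.inl (by rw [hsep]; exact h1))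
            (by simp [hsep, a1])
        refine ⟨by simp [hgl, a1], i, a2, a3, fun x => ?_, g₀, a5.congr_right e1 e2⟩
        rw [hZ]
        by_cases hx : x = k
        · simp [hx, a1, a4]
        · simp [hx, a4])
  refine ⟨h1, h2, ?_⟩
  rcases h4 with ⟨a1, a2, a3, a4, a5⟩ | h4
  · exact Or.inl ⟨a1, a2, a3, a4, fun x => a5 x (List.mem_finRange x)⟩
  · exact Or.inr h4

/-- After a good is taken from an owner, two rows claim it. The taker has marked it and the former
owner has not (see `Took.walk`), so the unmarked claim is dropped and that row has to take a good
next. A separate pass is needed because the former owner's row may precede the taker's. -/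
theorem second_pass {c : GConf n m} (hm : c.s.mode = .turn ∨ c.s.mode = .walk)
    (hp : c.s.par = true) :
    ∀ c', c' = (List.finRange n).reverse.foldl greedySweeper.visit c →
      c'.s.mode = c.s.mode ∧ c'.s.par = true ∧ c'.s.glob = c.s.glob ∧ c'.Y = c.Y ∧
      (∀ k, (c'.Z k).t = (c.Z k).t) ∧
      (∀ k g, c'.X k g = { c.X k g with
        a := (c.X k g).a && (!c.s.glob || (!(c.Y g).cur || (c.X k g).x)) }) ∧
      ∀ k, (c'.Z k).c = true ↔ c.s.glob = true ∧
        ∃ g, (c.X k g).a = true ∧ (c.Y g).cur = true ∧ (c.X k g).x = false := by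
  rintro _ rfl
  obtain ⟨h1, h2, h3, h4, h5, h6, h7⟩ := foldl_visit_induction (M := greedySweeper)
    (I := fun pre c' => c'.s.mode = c.s.mode ∧ c'.s.par = true ∧ c'.s.glob = c.s.glob ∧
      c'.Y = c.Y ∧ (∀ k, (c'.Z k).t = (c.Z k).t) ∧ (∀ k ∉ pre, c'.X k = c.X k) ∧
      ∀ k ∈ pre, (∀ g, c'.X k g = { c.X k g with
          a := (c.X k g).a && (!c.s.glob || (!(c.Y g).cur || (c.X k g).x)) }) ∧
        ((c'.Z k).c = true ↔ c.s.glob = true ∧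
          ∃ g, (c.X k g).a = true ∧ (c.Y g).cur = true ∧ (c.X k g).x = false))
    (List.finRange n).reverse (c := c)
    ⟨rfl, hp, rfl, rfl, fun _ => rfl, fun _ _ => rfl, by simp⟩
    (by
      rintro pre k post c' hk ⟨h1, h2, h3, h4, h5, h6, h7⟩
      have hkn := notMem_of_append_cons_eq hk (List.nodup_reverse.2 (List.nodup_finRange n))
      have hXk := h6 k hkn
      have htest : ∀ g, greedySweeper.test c'.s (c'.X k g) (c'.Y g) = true ↔
          (c.X k g).a = true ∧ (c.Y g).cur = true ∧ (c.X k g).x = false := by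
        intro g
        rw [greedy_test, hXk, h4, h1, h2]
        rcases hm with hm | hm <;> simp [Mode.test, hm, and_assoc]
      have hsep : greedySweeper.sepAt c' k = ({ c'.s with act := c.s.glob },
          { c'.Z k with c := decide (∃ g, (c.X k g).a = true ∧ (c.Y g).cur = true ∧
            (c.X k g).x = false) && c.s.glob }) := by
        simp only [sepAt, htest]
        rcases hm with hm | hm <;> simp [greedySweeper, Mode.sep, h1, h2, h3, hm]
      have hwr : ∀ g, greedySweeper.writeAt c' k g = ({ c.X k g with
          a := (c.X k g).a && (!c.s.glob || (!(c.Y g).cur || (c.X k g).x)) }, c.Y g) := by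
        intro g
        rw [writeAt, hsep, hXk, h4]
        rcases hm with hm | hm <;> cases hg : c.s.glob <;>
          simp [greedySweeper, Mode.write, h1, h2, hm]
      refine ⟨by simp [visit, hsep, h1], by simp [visit, hsep, h2], by simp [visit, hsep, h3],
        by simp [visit, hwr], fun x => ?_, fun x hx => ?_, fun x hx => ?_⟩
      · by_cases hxk : x = k
        · subst hxk; simp [visit, hsep, h5]
        · simp [visit, hxk, h5]
      · simp only [List.mem_append, List.mem_singleton, not_or] at hx
        simp [visit, hx.2, h6 x hx.1]
      · by_cases hxk : x = k
        · subst hxk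
          simp [visit, hsep, hwr, and_comm]
        · have : x ∈ pre := by simpa [hxk] using hx
          simpa [visit, hxk] using h7 x this)
  exact ⟨h1, h2, h3, h4, h5, fun k => (h7 k (by simp)).1, fun k => (h7 k (by simp)).2⟩

end FairDivision

/-! ### Passing goods along a chain, and the main loop -/

namespace FairDivision

open Sweeper Finset

variable {n m : ℕ}

/-- The goods that the agents of rank at most `rank i` may take are valued by them, and free or
owned by agents of smaller rank that may take a good themselves. -/
def Link (W : Fin n → Fin m → Prop) (o : Fin m → Option (Fin n)) (rank : Fin n → ℕ) (c : GConf n m)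
    (i : Fin n) : Prop :=
  ∀ x g, rank x ≤ rank i → (c.X x g).x = true → W x g ∧ (o g = none ∨
    ∃ k, o g = some k ∧ (∃ g', (c.X k g').x = true) ∧ rank k < rank x)

/-- The owner map after agent `i` has taken the good `g₀`, if any. -/
def takeOwner (o : Fin m → Option (Fin n)) (i : Fin n) (g₀ : Option (Fin m)) :
    Fin m → Option (Fin n) :=
  g₀.elim o fun g => Function.update o g (some i)

/-- The invariant while goods are passed on: agent `dem` has to take a good. -/
structure Walk (W : Fin n → Fin m → Prop) (o : Fin m → Option (Fin n)) (t : Fin n → Bool)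
    (rank : Fin n → ℕ) (dem : Option (Fin n)) (c : GConf n m) : Prop extends Base W o t c where
  mark : ∀ k, (c.Z k).c = true ↔ dem = some k
  x : ∀ i, dem = some i → ∃ g, (c.X i g).x = true
  link : ∀ i, dem = some i → Link W o rank c i

/-- The former owner `k` of `g` cannot have marked `g`, since the owner of a marked good has smaller
rank than the agent that marked it. For the same reason no agent of rank at most that of `k` has
marked `g`, so the new owner of `g` does not disturb `Link` for `k`. -/
theorem Took.walk {W : Fin n → Fin m → Prop} {o : Fin m → Option (Fin n)} {t t' : Fin n → Bool}
    {rank : Fin n → ℕ} {c c₁ : GConf n m} {i : Fin n} {g₀ : Option (Fin m)} (h : Base W o t c)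
    (hl : Link W o rank c i) (hT : Took c i g₀ c₁) (ht : ∀ k, (c₁.Z k).t = t' k)
    (hm : c₁.s.mode = .turn ∨ c₁.s.mode = .walk) (hp : c₁.s.par = true) (hg : c₁.s.glob = true)
    (c₂ : GConf n m) (hc₂ : c₂ = (List.finRange n).reverse.foldl greedySweeper.visit c₁) :
    Walk W (takeOwner o i g₀) t' rank (g₀.bind o) c₂ ∧
      ∀ k, g₀.bind o = some k → rank k < rank i := by
  obtain ⟨-, -, -, h4, h5, h6, h7⟩ := second_pass hm hp c₂ hc₂
  simp only [hg, Bool.not_true, Bool.false_or, true_and] at h6 h7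
  have hx : ∀ k g, (c₂.X k g).x = (c.X k g).x := fun k g => by rw [h6, ← hT.x]
  have hv : ∀ k g, (c₂.X k g).v = true ↔ W k g := fun k g => by rw [h6, ← h.v, ← hT.v]
  have hcur : ∀ g, (c₁.Y g).cur = false ↔ g₀ ≠ some g := fun g => by
    rw [← Bool.not_eq_true, hT.cur]
  have ha : ∀ k g, (c₂.X k g).a = true ↔
      (o g = some k ∨ k = i ∧ g₀ = some g) ∧ (g₀ ≠ some g ∨ (c.X k g).x = true) := by
    intro k g
    rw [h6]
    simp only [Bool.and_eq_true, Bool.or_eq_true, Bool.not_eq_true', hT.a, hcur, hT.x, h.a]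
  have hf : ∀ g, (c₂.Y g).f = true ↔ o g = none ∧ g₀ ≠ some g := fun g => by
    rw [h4, hT.f, h.f]
  have hc : ∀ k, (c₂.Z k).c = true ↔
      ∃ g, (o g = some k ∨ k = i ∧ g₀ = some g) ∧ g₀ = some g ∧ (c.X k g).x = false := by
    intro k
    simp only [h7, hT.a, hT.cur, hT.x, h.a]
  have ht₂ : ∀ k, (c₂.Z k).t = t' k := fun k => by rw [h5, ht]
  cases g₀ with
  | none =>
    refine ⟨⟨⟨hv, ?_, ?_, ht₂⟩, ?_, ?_, ?_⟩, ?_⟩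
    · intro k g; simp [ha, takeOwner]
    · intro g; simp [hf, takeOwner]
    · intro k; simp [hc]
    · intro k hk; simp at hk
    · intro k hk; simp at hk
    · intro k hk; simp at hk
  | some g =>
    have hxg := hT.some_x g rfl
    obtain ⟨hWg, hog⟩ := hl i g le_rfl hxg
    have hnot : ∀ k, o g = some k →
        (c.X k g).x = false ∧ rank k < rank i ∧ ∃ g', (c.X k g').x = true := by
      intro k hk
      obtain ⟨k', hk', hxk', hlt⟩ := hog.resolve_left (by rw [hk]; simp)
      obtain rfl : k = k' := Option.some.inj (hk.symm.trans hk')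
      refine ⟨?_, hlt, hxk'⟩
      by_contra hcon
      rw [Bool.not_eq_false] at hcon
      obtain ⟨-, h' | ⟨k'', hk'', -, hlt'⟩⟩ := hl k g hlt.le hcon
      · rw [hk] at h'; simp at h'
      · rw [hk] at hk''
        obtain rfl := Option.some.inj hk''
        exact lt_irrefl _ hlt'
    have hbind : (some g).bind o = o g := rfl
    rw [hbind]
    refine ⟨⟨⟨hv, ?_, ?_, ht₂⟩, ?_, ?_, ?_⟩, fun k hk => (hnot k hk).2.1⟩
    · intro k g'
      rw [ha]
      by_cases hgg : g = g'
      · subst hgg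
        simp only [takeOwner, Option.elim_some, Function.update_self, Option.some.injEq, ne_eq,
          not_true_eq_false, false_or, and_true]
        constructor
        · rintro ⟨h' | h', h''⟩
          · rw [(hnot k h').1] at h''
            exact absurd h'' (by simp)
          · exact h'.symm
        · rintro rfl
          exact ⟨Or.inr rfl, hxg⟩
      · simp [takeOwner, Function.update_of_ne (Ne.symm hgg), hgg]
    · intro g'
      rw [hf]
      by_cases hgg : g = g'
      · subst hgg; simp [takeOwner]
      · simp [takeOwner, Function.update_of_ne (Ne.symm hgg), hgg]
    · intro k
      rw [hc]
      constructor
      · rintro ⟨g', h' | ⟨h', -⟩, h'', hxf⟩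
        · rw [Option.some.inj h'']
          exact h'
        · subst h'
          rw [← Option.some.inj h'', hxg] at hxf
          exact absurd hxf (by simp)
      · intro hk
        exact ⟨g, Or.inl hk, rfl, (hnot k hk).1⟩
    · intro k hk
      obtain ⟨g', hg'⟩ := (hnot k hk).2.2
      exact ⟨g', by rw [hx, hg']⟩
    · intro k hk x g' hxk hxg'
      rw [hx] at hxg'
      obtain ⟨h1, h2⟩ := hl x g' (hxk.trans (hnot k hk).2.1.le) hxg'
      have hne : g' ≠ g := by
        rintro rfl
        rcases h2 with h2 | ⟨k', hk', -, hlt⟩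
        · rw [hk] at h2; simp at h2
        · rw [hk] at hk'
          obtain rfl := Option.some.inj hk'
          omega
      refine ⟨h1, ?_⟩
      simpa only [takeOwner, Option.elim_some, Function.update_of_ne hne, hx] using h2

theorem nonWasteful_takeOwner {W : Fin n → Fin m → Prop} {o : Fin m → Option (Fin n)}
    (ho : NonWasteful W o) {i : Fin n} {g : Fin m} (hg : W i g) :
    NonWasteful W (takeOwner o i (some g)) := by
  intro g' k hk
  by_cases hgg : g' = g
  · subst hgg
    simp only [takeOwner, Option.elim_some, Function.update_self, Option.some.injEq] at hk
    exact hk ▸ hg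
  · rw [takeOwner, Option.elim_some, Function.update_of_ne hgg] at hk
    exact ho g' k hk

/-- Agent `dem` takes a good. -/
theorem Walk.round {W : Fin n → Fin m → Prop} {o : Fin m → Option (Fin n)} {t : Fin n → Bool}
    {rank : Fin n → ℕ} {i : Fin n} {c : GConf n m} (h : Walk W o t rank (some i) c)
    (hs : c.s = ⟨.walk, false, false, false⟩) :
    (greedySweeper.roundConf c).s = ⟨.walk, false, false, false⟩ ∧
    ∃ g, W i g ∧ (∀ k, o g = some k → rank k < rank i) ∧
      Walk W (takeOwner o i (some g)) t rank (o g) (greedySweeper.roundConf c) := by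
  obtain ⟨h1, h2, h3, ⟨-, -, -, h4⟩ | ⟨h4, j, hj, g₀, hT⟩⟩ := walk_first_pass hs h.mark _ rfl
  · simp at h4
  obtain rfl := Option.some.inj hj
  set d₁ := (List.finRange n).foldl greedySweeper.visit c with hd₁
  set c₁ := greedySweeper.passConf c (List.finRange n) with hc₁
  have hs₁ : c₁.s = ⟨.walk, true, false, true⟩ := by
    simp only [hc₁, passConf, ← hd₁]
    simp [greedySweeper, h1, h2, h4]
  have hT₁ : Took c i g₀ c₁ := hT.congr_right rfl rfl
  obtain ⟨hw, hr⟩ := hT₁.walk h.toBase (h.link i rfl)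
    (t' := t) (fun k => by
      change (d₁.Z k).t = t k
      rw [h3, h.t])
    (Or.inr (by rw [hs₁])) (by rw [hs₁]) (by rw [hs₁]) _ rfl
  obtain ⟨e1, e2, e3, -⟩ := second_pass (c := c₁) (Or.inr (by rw [hs₁])) (by rw [hs₁]) _ rfl
  rw [hs₁] at e1 e3
  set d₂ := (List.finRange n).reverse.foldl greedySweeper.visit c₁ with hd₂
  constructor
  · simp only [roundConf, ← hc₁]
    simp only [passConf, ← hd₂]
    simp [greedySweeper, e1, e2, e3, Mode.next]
  · cases g₀ with
    | none =>
      obtain ⟨g, hg⟩ := h.x i rfl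
      rw [hT.none_x rfl g] at hg
      exact absurd hg (by simp)
    | some g =>
      refine ⟨g, (h.link i rfl i g le_rfl (hT.some_x g rfl)).1, hr, ?_⟩
      exact ⟨⟨hw.v, hw.a, hw.f, hw.t⟩, hw.mark, hw.x, hw.link⟩

/-- Nobody has to take a good any more. -/
theorem Walk.round_none {W : Fin n → Fin m → Prop} {o : Fin m → Option (Fin n)} {t : Fin n → Bool}
    {rank : Fin n → ℕ} {c : GConf n m} (h : Walk W o t rank none c)
    (hs : c.s = ⟨.walk, false, false, false⟩) :
    (greedySweeper.roundConf c).s = ⟨.reset false, false, false, false⟩ ∧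
      Base W o t (greedySweeper.roundConf c) := by
  obtain ⟨h1, h2, h3, ⟨h4, h5, h6, -⟩ | ⟨h4, j, hj, g₀, hT⟩⟩ := walk_first_pass hs h.mark _ rfl
  · set d₁ := (List.finRange n).foldl greedySweeper.visit c with hd₁
    set c₁ := greedySweeper.passConf c (List.finRange n) with hc₁
    have hs₁ : c₁.s = ⟨.walk, true, false, false⟩ := by
      simp only [hc₁, passConf, ← hd₁]
      simp [greedySweeper, h1, h2, h4]
    obtain ⟨e1, e2, e3, e4, e5, e6, -⟩ :=
      second_pass (c := c₁) (Or.inr (by rw [hs₁])) (by rw [hs₁]) _ rfl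
    rw [hs₁] at e1 e3
    simp only [hs₁, Bool.not_false, Bool.true_or, Bool.and_true] at e6
    set d₂ := (List.finRange n).reverse.foldl greedySweeper.visit c₁ with hd₂
    have hX : d₂.X = c.X := by
      funext k g
      rw [e6]
      change d₁.X k g = c.X k g
      rw [h5]
    have hY : d₂.Y = c.Y := e4.trans h6
    constructor
    · simp only [roundConf, ← hc₁]
      simp only [passConf, ← hd₂]
      simp [greedySweeper, e1, e2, e3, Mode.next]
    · refine ⟨fun k g => ?_, fun k g => ?_, fun g => ?_, fun k => ?_⟩
      · change (d₂.X k g).v = true ↔ _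
        rw [hX, h.v]
      · change (d₂.X k g).a = true ↔ _
        rw [hX, h.a]
      · change (d₂.Y g).f = true ↔ _
        rw [hY, h.f]
      · change (d₂.Z k).t = _
        rw [e5]
        change (d₁.Z k).t = _
        rw [h3, h.t]
  · simp at hj

/-- Goods are passed on until a free good is taken. -/
theorem Walk.rounds {W : Fin n → Fin m → Prop} {t : Fin n → Bool} {rank : Fin n → ℕ} (N : ℕ) :
    ∀ {o : Fin m → Option (Fin n)} {i : Fin n} {c : GConf n m}, rank i ≤ N → NonWasteful W o →
      Walk W o t rank (some i) c → c.s = ⟨.walk, false, false, false⟩ →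
      ∃ r ≤ N + 2, ∃ c' o', RoundsConf greedySweeper r c c' ∧ Base W o' t c' ∧
        c'.s = ⟨.reset false, false, false, false⟩ ∧ NonWasteful W o' ∧
        ∀ z, load o' z = load o z + if z = i then 1 else 0 := by
  induction N using Nat.strong_induction_on with
  | _ N ih =>
    intro o i c hi ho h hs
    obtain ⟨hs', g, hW, hlt, hw⟩ := h.round hs
    have ho' := nonWasteful_takeOwner ho hW
    have hh : greedySweeper.halted (greedySweeper.roundConf c).s = false := by rw [hs']; rfl
    cases hog : o g with
    | none =>
      rw [hog] at hw
      obtain ⟨e1, e2⟩ := hw.round_none hs'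
      refine ⟨2, by omega, _, _, .head hh (.single (by rw [e1]; rfl)), e2, e1, ho', ?_⟩
      intro z
      exact load_update_of_free hog z
    | some k =>
      rw [hog] at hw
      have hk := hlt k hog
      -- The rank decreases along the chain. The unit that `k` lost to `i` is made good by the
      -- induction hypothesis, so on balance only `i` gains.
      obtain ⟨r, hr, c', o', g1, g2, g3, g4, g5⟩ := ih (rank k) (by omega) le_rfl ho' hw hs'
      refine ⟨r + 1, by omega, c', o', .head hh g1, g2, g3, g4, fun z => ?_⟩
      have hki : k ≠ i := by rintro rfl; exact lt_irrefl _ hk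
      have := load_update_of_owner hog hki z
      have e := g5 z
      simp only [takeOwner, Option.elim_some] at e
      omega

theorem Search.link {W : Fin n → Fin m → Prop} {o : Fin m → Option (Fin n)} {t : Fin n → Bool}
    {rank : Fin n → ℕ} {c : GConf n m} (h : Search W o t rank c) (i : Fin n) :
    Link W o rank c i := by
  intro x g _ hx
  obtain ⟨h1, h2⟩ := h.x x g hx
  refine ⟨h1, h2.imp id ?_⟩
  rintro ⟨k, hk, hd, hlt⟩
  exact ⟨k, hk, (h.d k).1 hd, hlt⟩

/-- The agents that have not been reached form a closed set. -/
theorem Search.closedFor {W : Fin n → Fin m → Prop} {o : Fin m → Option (Fin n)} {t : Fin n → Bool}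
    {rank : Fin n → ℕ} {c : GConf n m} (h : Search W o t rank c) (hst : ∀ k, Stuck W c k) :
    ClosedFor W o {k | (c.Z k).d = false} := by
  intro k hk g hg
  simp only [mem_filter, mem_univ, true_and] at hk
  have hok : ¬ (c.Y g).ok = true := by
    rcases hst k with h' | h'
    · rw [hk] at h'; exact absurd h' (by simp)
    · rw [h' g hg]; simp
  rw [h.ok k, not_or, not_exists] at hok
  obtain ⟨x, hx⟩ := Option.ne_none_iff_exists'.1 hok.1
  refine ⟨x, ?_, hx⟩
  have := hok.2 x
  simp only [mem_filter, mem_univ, true_and]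
  rw [← Bool.not_eq_true]
  exact fun hd => this ⟨hx, hd⟩

/-- The turn of the next agent, if there is one in this round. -/
theorem turn_rounds {W : Fin n → Fin m → Prop} {o : Fin m → Option (Fin n)} {t : Fin n → Bool}
    {rank : Fin n → ℕ} {c : GConf n m} (ho : NonWasteful W o) (h : Search W o t rank c)
    (hst : ∀ k, Stuck W c k) (hs : c.s = ⟨.turn, false, false, false⟩) :
    ∃ r ≤ n + 2, ∃ c' o' t' b, RoundsConf greedySweeper r c c' ∧ Base W o' t' c' ∧
      c'.s = ⟨.reset b, false, false, false⟩ ∧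
      ((b = true ∧ o' = o ∧ t' = t ∧ ∀ k, t k = true) ∨
       (b = false ∧ ∃ i, t i = false ∧ (∀ x < i, t x = true) ∧ t' = Function.update t i true ∧
        ((o' = o ∧ ∃ R : Finset (Fin n), i ∈ R ∧ ClosedFor W o R) ∨
          NonWasteful W o' ∧ ∀ z, load o' z = load o z + if z = i then 1 else 0))) := by
  obtain ⟨h1, h2, h3⟩ := turn_first_pass hs h.t _ rfl
  set d₁ := (List.finRange n).foldl greedySweeper.visit c with hd₁
  set c₁ := greedySweeper.passConf c (List.finRange n) with hc₁
  have hs₁ : c₁.s = ⟨.turn, true, false, d₁.s.glob⟩ := by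
    simp only [hc₁, passConf, ← hd₁]
    simp [greedySweeper, h1, h2]
  obtain ⟨e1, e2, e3, e4, e5, e6, -⟩ :=
    second_pass (c := c₁) (Or.inl (by rw [hs₁])) (by rw [hs₁]) _ rfl
  rw [hs₁] at e1 e3
  simp only [hs₁] at e6
  set d₂ := (List.finRange n).reverse.foldl greedySweeper.visit c₁ with hd₂
  have hs₂ : (greedySweeper.roundConf c).s = ⟨Mode.turn.next d₁.s.glob, false, false, false⟩ := by
    simp only [roundConf, ← hc₁]
    simp only [passConf, ← hd₂]
    simp [greedySweeper, e1, e2, e3]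
  rcases h3 with ⟨a1, a2, a3, a4, a5⟩ | ⟨a1, i, a2, a3, a4, g₀, hT⟩
  · rw [a1] at hs₂
    simp only [a1, Bool.not_false, Bool.true_or, Bool.and_true] at e6
    have hX : d₂.X = c.X := by
      funext k g
      rw [e6]
      change d₁.X k g = c.X k g
      rw [a2]
    have hY : d₂.Y = c.Y := e4.trans a3
    refine ⟨1, by omega, _, o, t, true, .single (by rw [hs₂]; rfl), ⟨fun k g => ?_, fun k g => ?_,
      fun g => ?_, fun k => ?_⟩, hs₂, Or.inl ⟨rfl, rfl, rfl, a5⟩⟩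
    · change (d₂.X k g).v = true ↔ _
      rw [hX, h.v]
    · change (d₂.X k g).a = true ↔ _
      rw [hX, h.a]
    · change (d₂.Y g).f = true ↔ _
      rw [hY, h.f]
    · change (d₂.Z k).t = _
      rw [e5]
      exact a4 k
  · rw [a1] at hs₂ hs₁
    have hT₁ : Took c i g₀ c₁ := hT.congr_right rfl rfl
    obtain ⟨hw, hr⟩ := hT₁.walk h.toBase (h.link i) (t' := Function.update t i true) a4
      (Or.inl (by rw [hs₁])) (by rw [hs₁]) (by rw [hs₁]) _ rfl
    have hw' : Walk W (takeOwner o i g₀) (Function.update t i true) rank (g₀.bind o)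
        (greedySweeper.roundConf c) :=
      ⟨⟨hw.v, hw.a, hw.f, hw.t⟩, hw.mark, hw.x, hw.link⟩
    have hh : greedySweeper.halted (greedySweeper.roundConf c).s = false := by rw [hs₂]; rfl
    -- Without a former owner, the next round finds nobody who has to take a good and leads to the
    -- reset.
    have hdone : g₀.bind o = none → ∃ r ≤ n + 2, ∃ c', RoundsConf greedySweeper r c c' ∧
        Base W (takeOwner o i g₀) (Function.update t i true) c' ∧
        c'.s = ⟨.reset false, false, false, false⟩ := by
      intro hb
      rw [hb] at hw'
      obtain ⟨f1, f2⟩ := hw'.round_none hs₂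
      exact ⟨2, by omega, _, .head hh (.single (by rw [f1]; rfl)), f2, f1⟩
    cases g₀ with
    | none =>
      obtain ⟨r, hr, c', g1, g2, g3⟩ := hdone rfl
      -- An agent without marked goods was not reached, so it belongs to the closed set of unreached
      -- agents.
      refine ⟨r, hr, c', o, _, false, g1, g2, g3, Or.inr ⟨rfl, i, a2, a3, rfl, Or.inl ⟨rfl, _, ?_,
        h.closedFor hst⟩⟩⟩
      simp only [mem_filter, mem_univ, true_and]
      rw [← Bool.not_eq_true, h.d]
      rintro ⟨g, hg⟩
      rw [hT.none_x rfl g] at hg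
      exact absurd hg (by simp)
    | some g =>
      have hx := hT.some_x g rfl
      have hW := (h.x i g hx).1
      have ho' := nonWasteful_takeOwner ho hW
      cases hog : o g with
      | none =>
        obtain ⟨r, hr, c', g1, g2, g3⟩ := hdone hog
        exact ⟨r, hr, c', _, _, false, g1, g2, g3, Or.inr ⟨rfl, i, a2, a3, rfl, Or.inr
          ⟨ho', fun z => load_update_of_free hog z⟩⟩⟩
      | some k =>
        have hb : (some g).bind o = some k := hog
        have hk := hr k hb
        rw [hb] at hw'
        have hin : rank i < n :=
          (h.rank_lt i ((h.d i).2 ⟨g, hx⟩)).trans_le (reached_le c)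
        obtain ⟨r, hr, c', o', g1, g2, g3, g4, g5⟩ := hw'.rounds (rank k) le_rfl ho' hs₂
        refine ⟨r + 1, by omega, c', o', _, false, .head hh g1, g2, g3, Or.inr ⟨rfl, i, a2, a3, rfl,
          Or.inr ⟨g4, fun z => ?_⟩⟩⟩
        have hki : k ≠ i := by rintro rfl; exact lt_irrefl _ hk
        have := load_update_of_owner hog hki z
        have e := g5 z
        simp only [takeOwner, Option.elim_some] at e
        omega

/-- One iteration of the main loop, from one reset to the next. -/
theorem main_loop {W : Fin n → Fin m → Prop} {o : Fin m → Option (Fin n)} {t : Fin n → Bool}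
    {b : Bool} {l : ℕ} {c : GConf n m} (h : Base W o t c)
    (hs : c.s = ⟨.reset b, false, false, false⟩) (hG : Greedy W o (fun k => t k && !b) l) :
    ∃ r ≤ 2 * n + 5, ∃ c', RoundsConf greedySweeper r c c' ∧
      ((greedySweeper.halted (greedySweeper.roundConf c').s = true ∧
        Base W o (fun k => t k && !b) (greedySweeper.roundConf c') ∧ Balanced W o) ∨
      (l ≤ m ∧ ∃ o' t' b' l', Base W o' t' c' ∧ c'.s = ⟨.reset b', false, false, false⟩ ∧
        Greedy W o' (fun k => t' k && !b') l' ∧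
        l' * (n + 1) + #{k | (t' k && !b') = true} =
          l * (n + 1) + #{k | (t k && !b) = true} + 1)) := by
  obtain ⟨h1, h2, h3⟩ := reset_round h hs
  have hh₁ : greedySweeper.halted (greedySweeper.roundConf c).s = false := by rw [h1]; rfl
  set c₁ := greedySweeper.roundConf c with hc₁
  set u : Fin n → Bool := fun k => t k && !b with hu
  obtain ⟨rank, g1, ⟨g2, g3⟩ | ⟨g2, g3, g4⟩⟩ := search_round h2 h1
  · obtain ⟨r, hr, c₂, rank₂, a1, a2, a3, a4, a5⟩ := search_rounds n g1 g2 (by omega)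
    have hh₂ : greedySweeper.halted (greedySweeper.roundConf c₁).s = false := by rw [g2]; rfl
    obtain ⟨r', hr', c', o', t', b', e1, e2, e3, e4⟩ := turn_rounds hG.nonWasteful a2 a4 a3
    -- One reset round, one search round that reaches somebody, at most n + 1 further search rounds
    -- and at most n + 2 rounds for the turn.
    refine ⟨(r + 1) + 1 + r', by omega, c', (RoundsConf.head hh₁ (.head hh₂ a1)).trans e1,
      Or.inr ⟨?_, o', t', b', ?_⟩⟩
    · have hpos : 0 < reached c₂ := by omega
      obtain ⟨k, hk⟩ := card_pos.1 hpos
      -- Going down in rank from a reached agent must end at one that marked a free good, which it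
      -- values.
      have hinduct : ∃ k g, W k g ∧ o g = none := by
        by_contra! hcon
        have hx := fun k hd => (a2.d k).1 hd
        have hmin : ∀ N, ∀ k, rank₂ k ≤ N → (c₂.Z k).d ≠ true := by
          intro N
          induction N with
          | zero =>
            intro k hN hd
            obtain ⟨g, hg⟩ := hx k hd
            obtain ⟨hW, h' | ⟨k', -, -, hlt⟩⟩ := a2.x k g hg
            · exact hcon k g hW h'
            · omega
          | succ N ih =>
            intro k hN hd
            obtain ⟨g, hg⟩ := hx k hd
            obtain ⟨hW, h' | ⟨k', -, hd', hlt⟩⟩ := a2.x k g hg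
            · exact hcon k g hW h'
            · exact ih k' (by omega) hd'
        exact hmin _ k le_rfl (by simpa using hk)
      obtain ⟨k, g, hW, hg⟩ := hinduct
      simpa using hG.le_card hW hg
    · rcases e4 with ⟨rfl, rfl, rfl, hall⟩ | ⟨rfl, i, hi, hlt, rfl, hcase⟩
      · refine ⟨l + 1, e2, e3, ?_, ?_⟩
        · simpa using hG.nextRound hall
        · have hcard : #{k | u k = true} = n := by
            rw [filter_true_of_mem fun k _ => hall k, card_univ, Fintype.card_fin]
          rw [hcard]
          simp only [Bool.not_true, Bool.and_false, Bool.false_eq_true, filter_false, card_empty]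
          ring
      · have hcard : #{k | (Function.update u i true k && !false) = true} =
            #{k | u k = true} + 1 := by
          have : ({k | (Function.update u i true k && !false) = true} : Finset (Fin n)) =
              insert i ({k | u k = true} : Finset (Fin n)) := by
            ext k
            by_cases hk : k = i
            · simp [hk]
            · simp [hk]
          rw [this, card_insert_of_notMem (by simp [hi])]
        refine ⟨l, e2, e3, ?_, by rw [hcard]; ring⟩
        simp only [Bool.not_false, Bool.and_true]
        rcases hcase with ⟨rfl, R, hiR, hR⟩ | ⟨hn, hload⟩
        · exact hG.fail hi hlt hiR hR
        · exact hG.success hi hlt hn hload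
  · refine ⟨1, by omega, c₁, .single hh₁, Or.inl ⟨by rw [g2]; rfl, g1.toBase, ?_⟩⟩
    -- All rows are stuck although nobody was reached, so no valued good is free.
    refine hG.balanced fun k g hW hg => ?_
    have hd : ((greedySweeper.roundConf c₁).Z k).d = false := by rw [g3]; exact h3 k
    rcases g4 k with h' | h'
    · rw [hd] at h'; exact absurd h' (by simp)
    · have := (g1.ok k g).2 (Or.inl hg)
      rw [h' g hW] at this
      exact absurd this (by simp)

/-- The machine halts after polynomially many rounds with a balanced owner map. -/
theorem exists_halting_rounds {W : Fin n → Fin m → Prop} (K : ℕ) :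
    ∀ {o : Fin m → Option (Fin n)} {t : Fin n → Bool} {b : Bool} {l : ℕ} {c : GConf n m},
      Base W o t c → c.s = ⟨.reset b, false, false, false⟩ → Greedy W o (fun k => t k && !b) l →
      (m + 1) * (n + 1) ≤ l * (n + 1) + #{k | (t k && !b) = true} + K →
      ∃ r ≤ (K + 1) * (2 * n + 5), ∃ c' o' t', RoundsConf greedySweeper r c c' ∧
        greedySweeper.halted (greedySweeper.roundConf c').s = true ∧
        Base W o' t' (greedySweeper.roundConf c') ∧ Balanced W o' := by
  induction K with
  | zero =>
    intro o t b l c h hs hG hK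
    obtain ⟨r, hr, c', h1, ⟨h2, h3, h4⟩ | ⟨h2, -⟩⟩ := main_loop h hs hG
    · exact ⟨r, by omega, c', o, _, h1, h2, h3, h4⟩
    -- Each iteration raises l(n + 1) plus the number of turns by exactly one, also when n turns
    -- give way to a new level. As `l ≤ m` before every iteration that does not halt, this quantity
    -- is then below (m + 1)(n + 1).
    · have : #{k | (t k && !b) = true} ≤ n := by
        simpa using card_le_univ ({k | (t k && !b) = true} : Finset (Fin n))
      have h5 : l * (n + 1) ≤ m * (n + 1) := Nat.mul_le_mul_right _ h2
      have h6 : (m + 1) * (n + 1) = m * (n + 1) + n + 1 := by ring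
      omega
  | succ K ih =>
    intro o t b l c h hs hG hK
    obtain ⟨r, hr, c', h1, ⟨h2, h3, h4⟩ | ⟨-, o', t', b', l', h3, h4, h5, h6⟩⟩ := main_loop h hs hG
    · refine ⟨r, ?_, c', o, _, h1, h2, h3, h4⟩
      have : (K + 1 + 1) * (2 * n + 5) = (K + 1) * (2 * n + 5) + (2 * n + 5) := by ring
      omega
    · obtain ⟨r', hr', c'', o'', t'', g1, g2, g3, g4⟩ := ih h3 h4 h5 (by omega)
      refine ⟨r + r', ?_, c'', o'', t'', h1.trans g1, g2, g3, g4⟩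
      have : (K + 1 + 1) * (2 * n + 5) = (K + 1) * (2 * n + 5) + (2 * n + 5) := by ring
      omega

end FairDivision

/-! ### The Turing machine with its encodings and time bound -/

namespace FairDivision

open Sweeper Turing

namespace Sweeper

variable {S C Z Y : Type}

/-- The Turing machine of a sweep machine. -/
noncomputable def machine [Finite S] [Finite C] [Finite Z] [Finite Y] (M : Sweeper S C Z Y) :
    FinTM2 where
  K := Stack
  kFin := Fintype.ofFinite _
  k₀ := .inp
  k₁ := .out
  Γ := Alphabet C Z Y
  Λ := Label
  main := .readAux
  ΛFin := Fintype.ofFinite _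
  σ := Reg S C Z Y
  initialState := M.initReg
  σFin := Fintype.ofFinite _
  Γk₀Fin := inferInstanceAs (Fintype (Option Bool))
  m := M.prog

variable [Finite S] [Finite C] [Finite Z] [Finite Y] (M : Sweeper S C Z Y)

theorem initList_machine (w : List (Option Bool)) :
    initList M.machine w = ⟨some Label.readAux, M.initReg, stk w [] [] [] [] [] []⟩ := by
  unfold initList
  congr 1
  funext k
  change Stack at k
  rcases k with _ | _ | _ | (_ | _) | (_ | _) <;> first
    | exact dif_pos rfl
    | exact dif_neg (by simp [machine])

/-- A halting configuration must have the initial internal state and all stacks but the output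
empty; hence the program clears its stacks and restores `initReg` at the end. -/
theorem haltList_machine (w : List (Option Bool)) :
    haltList M.machine w = ⟨none, M.initReg, stk [] w [] [] [] [] []⟩ := by
  unfold haltList
  congr 1
  funext k
  change Stack at k
  rcases k with _ | _ | _ | (_ | _) | (_ | _) <;> first
    | exact dif_pos rfl
    | exact dif_neg (by simp [machine])

theorem nonempty_outputsInTime {t T : ℕ} {w w' : List (Option Bool)}
    (h : M.Steps t ⟨some .readAux, M.initReg, stk w [] [] [] [] [] []⟩
      ⟨none, M.initReg, stk [] w' [] [] [] [] []⟩) (ht : t ≤ T) :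
    Nonempty (TM2OutputsInTime M.machine w (some w') T) := by
  refine ⟨⟨⟨t, ?_⟩, ht⟩⟩
  exact (congrArg (fun a => (flip bind (TM2.step M.prog))^[t] (some a))
    (initList_machine M w)).trans (Eq.trans h (congrArg some (haltList_machine M w').symm))

end Sweeper

variable {n m : ℕ}

/-- The rows of a matrix of bits as a word. -/
def rowsWord (B : Fin n → Fin m → Bool) : List (Option Bool) :=
  (List.ofFn fun i => (List.ofFn fun g => some (B i g)) ++ [none]).flatten

theorem encodeMatrix_eq (B : Fin n → Fin m → Bool) :
    encodeMatrix B = List.replicate m (some true) ++ none :: rowsWord B := rfl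

theorem length_rowsWord (B : Fin n → Fin m → Bool) : (rowsWord B).length = n * (m + 1) := by
  simp [rowsWord, List.length_flatten, List.map_ofFn, Function.comp_def]

theorem length_encodeMatrix (B : Fin n → Fin m → Bool) :
    (encodeMatrix B).length = (m + 1) * (n + 1) := by
  rw [encodeMatrix_eq, List.length_append, List.length_cons, length_rowsWord,
    List.length_replicate]
  ring

/-- The initial configuration on a matrix of bits. -/
def initConf (B : Fin n → Fin m → Bool) : GConf n m where
  s := greedySweeper.start
  X k g := greedySweeper.cell (B k g)
  Z _ := greedySweeper.mark
  Y _ := greedySweeper.aux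

theorem word_lists (c : GConf n m) : word (c.lists (List.finRange n)).2.1 =
    (List.ofFn fun i => (List.ofFn fun g => Sum.inl (c.X i g)) ++ [Sum.inr (c.Z i)]).flatten := by
  simp [word, Conf.lists, Conf.row, List.flatMap, List.map_map, Function.comp_def,
    List.ofFn_eq_map]

theorem word_initConf (B : Fin n → Fin m → Bool) :
    word ((initConf B).lists (List.finRange n)).2.1 =
      (rowsWord B).map fun a => greedySweeper.readSym (some a) := by
  rw [word_lists]
  simp only [rowsWord, List.map_flatten, List.map_ofFn, Function.comp_def, List.map_append,
    List.map_cons, List.map_nil]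
  rfl

theorem map_outSym_word (c : GConf n m) :
    (word (c.lists (List.finRange n)).2.1).map greedySweeper.outSym =
      rowsWord fun i g => (c.X i g).a := by
  rw [word_lists]
  simp only [rowsWord, List.map_flatten, List.map_ofFn, Function.comp_def, List.map_append,
    List.map_cons, List.map_nil]
  rfl

theorem rect_lists (c : GConf n m) : Rect (c.lists (List.finRange n)) := by
  intro r hr
  simp only [Conf.lists, List.mem_map] at hr
  obtain ⟨k, -, rfl⟩ := hr
  simp [Conf.row, Conf.lists]

open Polynomial in
/-- The time bound. -/
noncomputable def timeBound : ℕ[X] :=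
  6 * X + 4 + ((X + 1) * (2 * X + 5) + 1) * (4 * X + 2)

theorem exists_isMNWTie_outputsInTime {v : Fin n → GoodsValuation m}
    (hv : ∀ i, IsBinaryAdditive (v i)) :
    ∃ A : Allocation n m, A.IsMNWTie v ∧
      Nonempty (TM2OutputsInTime greedySweeper.machine
        (encodeMatrix fun i g => decide (v i {g} = 1))
        (some (encodeMatrix fun i g => decide (g ∈ A.bundle i)))
        (timeBound.eval (encodeMatrix fun i g => decide (v i {g} = 1)).length)) := by
  classical
  set B : Fin n → Fin m → Bool := fun i g => decide (v i {g} = 1) with hB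
  have hbase : Base (Wants v) (fun _ => none) (fun _ => false) (initConf B) :=
    ⟨fun k g => by simp [initConf, greedySweeper, hB, Wants],
      fun k g => by simp [initConf, greedySweeper], fun g => by simp [initConf, greedySweeper],
      fun k => rfl⟩
  obtain ⟨r, hr, c, o, t, h1, h2, h3, h4⟩ := exists_halting_rounds ((m + 1) * (n + 1)) (b := false)
    (l := 0) hbase rfl (by simpa using greedy_none) (by omega)
  refine ⟨ofOwner o, isMNWTie_ofOwner hv h4, ?_⟩
  have hrun := steps_run (M := greedySweeper) (k := m) (w := rowsWord B)
    (c₀ := (initConf B).lists (List.finRange n)) rfl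
    (by simp [Conf.lists, initConf]) (word_initConf B) (rect_lists _) h1.rounds
    (by rw [round_lists]; exact h2)
  rw [round_lists, map_outSym_word] at hrun
  have hout : (fun i g => ((greedySweeper.roundConf c).X i g).a) =
      fun i g => decide (g ∈ (ofOwner o).bundle i) := by
    funext i g
    rw [Bool.eq_iff_iff, h3.a]
    simp [ofOwner]
  rw [hout, ← encodeMatrix_eq, ← encodeMatrix_eq] at hrun
  refine nonempty_outputsInTime _ hrun ?_
  have htime : roundTime ((initConf B).lists (List.finRange n)) = 4 * (n * (m + 1)) + 2 := by
    simp only [roundTime, Conf.lists, List.length_map, List.length_finRange, List.length_ofFn]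
    ring
  rw [htime, length_rowsWord, length_encodeMatrix]
  -- `L` is the input length. It bounds `n` and n(m + 1), so there are at most (L + 1)(2L + 5)
  -- rounds and a final halting one, each of cost at most 4L + 2; reading and writing take at most
  -- 6L + 4 steps.
  generalize hL : (m + 1) * (n + 1) = L at hr ⊢
  have hL' : L = m + 1 + n * (m + 1) := by rw [← hL]; ring
  have hn : n ≤ L := by
    have : n * 1 ≤ n * (m + 1) := Nat.mul_le_mul_left _ (by omega)
    omega
  have hw : n * (m + 1) ≤ L := by omega
  have hr' : r ≤ (L + 1) * (2 * L + 5) := hr.trans (Nat.mul_le_mul_left _ (by omega))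
  have hmul : (r + 1) * (4 * (n * (m + 1)) + 2) ≤ ((L + 1) * (2 * L + 5) + 1) * (4 * L + 2) :=
    Nat.mul_le_mul (by omega) (by omega)
  simp only [timeBound, Polynomial.eval_add, Polynomial.eval_mul, Polynomial.eval_X,
    Polynomial.eval_one, Polynomial.eval_ofNat]
  omega

/-- Each chosen allocation comes with a run of one fixed machine that writes it within one fixed
bound, so the rule made of these choices is the function that the machine computes. -/
theorem exists_polyTimeComputable :
    ∃ f : ∀ n m : ℕ, Rule n m, (∀ n m : ℕ, (f n m).IsMNWTieRule) ∧ PolyTimeComputable f := by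
  choose A hA hT using fun (n m : ℕ) (v : BinaryProfile n m) => exists_isMNWTie_outputsInTime v.2
  refine ⟨A, hA, ⟨⟨⟨greedySweeper.machine, Equiv.refl _, Equiv.refl _⟩, timeBound, fun I => ?_⟩⟩⟩
  have e (l : List (Option Bool)) : l = l.map (Equiv.refl (Option Bool)).invFun := (List.map_id l).symm
  exact cast (congrArg₂ (fun a b => TM2OutputsInTime greedySweeper.machine a (some b) _) (e _) (e _))
    (hT I.1.1 I.1.2 I.2).some

end FairDivision

theorem theorem1 :
    (∀ (n m : ℕ) (f : Rule n m), f.IsMNWTieRule →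
      f.IsEF1 ∧ f.IsPO ∧ f.IsGroupStrategyproof) ∧
    ∃ f : ∀ n m : ℕ, Rule n m, (∀ n m : ℕ, (f n m).IsMNWTieRule) ∧ PolyTimeComputable f :=
  ⟨fun _ _ _ hf => ⟨fun v => FairDivision.isEF1_of_isMNWTie v.2 (hf v),
    fun v => FairDivision.isPO_of_isMNWTie v.2 (hf v),
    FairDivision.isGroupStrategyproof_of_isMNWTieRule hf⟩, FairDivision.exists_polyTimeComputable⟩
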